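/- Let $\mathcal{G}=(\mathcal{G}_0,\mathcal{O}_{\mathcal{G}})$ be a Lie supergroup with multiplication $\mu$, unit point $e\in\mathcal{G}_0$ and Lie superalgebra $$\mathfrak{g}=\{X\in\mathrm{Der}\,\mathcal{O}(\mathcal{G})\;:\;\mu^\sharp\circ X=(X\otimes \mathrm{id})\circ\mu^\sharp\},$$ where $\mathrm{Der}$ denotes the real superderivations (sums of even and odd ones). Let $\Psi:\mathcal{G}\otimes\mathcal{M}\to\mathcal{M}$ be an action of $\mathcal{G}$ on a (real, smooth) supermanifold $\mathcal{M}$, with pullback $\psi^\sharp:\mathcal{O}(\mathcal{M})\to\mathcal{O}(\mathcal{G}\otimes\mathcal{M})$ of superfunctions. For $g\in\mathcal{G}_0$ let $\delta_g^\sharp:\mathcal{O}(\mathcal{G})\to\mathbb{R}$ be the evaluation at $g$, and for $X\in\mathfrak{g}$ put $$\gamma(X)=(\delta_e^\sharp\circ X\otimes\mathrm{id})\circ\psi^\sharp:\ \mathcal{O}(\mathcal{M})\to\mathcal{O}(\mathcal{M}).$$ 1. A superfunction $f\in\mathcal{O}(\mathcal{M})$ is called $\mathcal{G}$-invariant if $\psi^\sharp(f)=1_{\mathcal{G}}\otimes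 f$, and $\mathcal{G}_0$-invariant if $(\delta_g^\sharp\otimes\mathrm{id})\,\psi^\sharp(f)=f$ for all $g\in\mathcal{G}_0$. Then $f$ is $\mathcal{G}$-invariant if and only if $f$ is $\mathcal{G}_0$-invariant and $\gamma(X)f=0$ for all $X\in\mathfrak{g}$. 2. Let $\mathcal{V}$ be a real vector space and $T:\mathcal{O}(\mathcal{M})\to\mathcal{V}$ a linear map. Call $T$ $\mathcal{G}$-invariant if $(\mathrm{id}\otimes T)\circ\psi^\sharp=1_{\mathcal{G}}\otimes T$, and $\mathcal{G}_0$-invariant if $T\circ(\delta_g^\sharp\otimes\mathrm{id})\circ\psi^\sharp=T$ for all $g\in\mathcal{G}_0$. Here the equality of $\mathcal{V}$-valued superfunctions on $\mathcal{G}$ means equality of all derivatives at all points, that is, $$T\big((\delta_g^\sharp\circ Z\otimes\mathrm{id})\,\psi^\sharp(f)\big)=\delta_g^\sharp(Z1_{\mathcal{G}})\,T(f)$$ for all $f\in\mathcal{O}(\mathcal{M})$, all $g\in\mathcal{G}_0$ and all $Z=X_1\cdots X_k$ with $k\ge 0$ and $X_i\in\mathrm{Der}\,\mathcal{O}(\mathcal{G})$.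 Then $T$ is $\mathcal{G}$-invariant if and only if $T$ is $\mathcal{G}_0$-invariant and $T\circ\gamma(X)=0$ for all $X\in\mathfrak{g}$. -/

import Mathlib

open CategoryTheory CategoryTheory.Limits TopologicalSpace Opposite AlgebraicGeometry
open scoped Manifold ContDiff TensorProduct

universe u w

noncomputable section

namespace Supergeometry

/-! ### The local model `C^∞(V) ⊗ Λ_N` -/

/-- The Grassmann algebra `Λ_N` on `N` anticommuting generators. -/
abbrev Grassmann (N : ℕ) : Type := ExteriorAlgebra ℝ (Fin N → ℝ)

/-- The parity grading of `Λ_N`: products of an even, resp. odd, number of generators. -/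
abbrev grassmannParity (N : ℕ) (k : ZMod 2) : Submodule ℝ (Grassmann N) :=
  CliffordAlgebra.evenOdd (0 : QuadraticForm ℝ (Fin N → ℝ)) k

/-- The augmentation `Λ_N → ℝ`, which sets all the generators to zero. -/
abbrev augmentation (N : ℕ) : Grassmann N →ₐ[ℝ] ℝ := ExteriorAlgebra.algebraMapInv

lemma augmentation_odd {N : ℕ} {a : Grassmann N} (ha : a ∈ grassmannParity N 1) :
    augmentation N a = 0 := by
  have h : (augmentation N).comp CliffordAlgebra.involute = augmentation N := by
    apply CliffordAlgebra.hom_ext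
    ext m
    simp [augmentation, ExteriorAlgebra.algebraMapInv, ExteriorAlgebra.lift]
  have h1 := DFunLike.congr_fun h a
  rw [AlgHom.comp_apply, CliffordAlgebra.involute_eq_of_mem_odd ha, map_neg] at h1
  linarith

section Model

variable {D : ℕ} {X : Type u} [TopologicalSpace X] [ChartedSpace (EuclideanSpace ℝ (Fin D)) X]

/-- Smooth real functions on the open set `V`. -/
abbrev Smooth (V : Opens X) : Type u := C^∞⟮𝓡 D, V; 𝓘(ℝ, ℝ), ℝ⟯

/-- Restriction of smooth functions to a smaller open set. -/
def smoothRes {V W : Opens X} (h : W ≤ V) : Smooth (D := D) V →ₐ[ℝ] Smooth (D := D) W :=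
  { ContMDiffMap.restrictRingHom (𝓡 D) 𝓘(ℝ, ℝ) ℝ h with
    commutes' := fun _ => rfl }

/-- Evaluation of smooth functions at a point of their domain. -/
def smoothEval {V : Opens X} (p : X) (hp : p ∈ V) : Smooth (D := D) V →ₐ[ℝ] ℝ :=
  { ContMDiffMap.evalRingHom (⟨p, hp⟩ : V) with
    commutes' := fun _ => rfl }

/-- The superalgebra `C^∞(V) ⊗ Λ_N`. -/
abbrev Model (N : ℕ) (V : Opens X) : Type u := Smooth (D := D) V ⊗[ℝ] Grassmann N

/-- Functions have parity `0`, so the part of parity `k` is `C^∞(V) ⊗ (Λ_N)_k`. -/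
def modelParity (N : ℕ) (V : Opens X) (k : ZMod 2) : Submodule ℝ (Model (D := D) N V) :=
  LinearMap.range (LinearMap.lTensor (Smooth (D := D) V) (grassmannParity N k).subtype)

def modelRes (N : ℕ) {V W : Opens X} (h : W ≤ V) :
    Model (D := D) N V →ₐ[ℝ] Model (D := D) N W :=
  Algebra.TensorProduct.map (smoothRes h) (AlgHom.id ℝ (Grassmann N))

/-- Drop the anticommuting variables and evaluate at `p`. -/
def modelEval (N : ℕ) {V : Opens X} (p : X) (hp : p ∈ V) : Model (D := D) N V →ₐ[ℝ] ℝ :=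
  Algebra.TensorProduct.lift (smoothEval p hp) (augmentation N) (fun _ _ => mul_comm _ _)

lemma modelEval_modelRes (N : ℕ) {V W : Opens X} (h : W ≤ V) (p : X) (hp : p ∈ W)
    (f : Model (D := D) N V) :
    modelEval N p hp (modelRes N h f) = modelEval N p (h hp) f := by
  induction f using TensorProduct.induction_on with
  | zero => simp
  | add a b ha hb => rw [map_add, map_add, map_add, ha, hb]
  | tmul a b => rfl

lemma modelEval_odd {N : ℕ} {V : Opens X} (p : X) (hp : p ∈ V) {f : Model (D := D) N V}
    (hf : f ∈ modelParity N V 1) : modelEval N p hp f = 0 := by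
  obtain ⟨t, rfl⟩ := hf
  induction t using TensorProduct.induction_on with
  | zero => simp
  | add a b ha hb => rw [map_add, map_add, ha, hb, add_zero]
  | tmul a b =>
    change smoothEval p hp a * augmentation N b = 0
    rw [augmentation_odd b.2, mul_zero]

end Model

/-! ### Supermanifolds -/

/-- The sections over `U` of the structure sheaf of a space ringed in `ℝ`-algebras. -/
abbrev Sections (X : SheafedSpace.{u + 1, u, u} (AlgCat.{u} ℝ)) (U : Opens X) : Type u :=
  X.presheaf.obj (op U)

/-- Restriction of sections. -/
def sectionRes (X : SheafedSpace.{u + 1, u, u} (AlgCat.{u} ℝ)) {U V : Opens X} (h : U ≤ V) :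
    Sections X V →ₐ[ℝ] Sections X U :=
  (X.presheaf.map (homOfLE h).op).hom

/-- An isomorphism of sheaves of superalgebras, over the open set `U`, between the structure sheaf
and `C^∞ ⊗ Λ_N`. -/
structure Trivialization {D : ℕ} (X : SheafedSpace.{u + 1, u, u} (AlgCat.{u} ℝ))
    [ChartedSpace (EuclideanSpace ℝ (Fin D)) X]
    (parity : ∀ U : Opens X, ZMod 2 → Submodule ℝ (Sections X U)) (N : ℕ) (U : Opens X) where
  equiv : ∀ V : Opens X, V ≤ U → (Sections X V ≃ₐ[ℝ] Model (D := D) N V)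
  equiv_res : ∀ (V W : Opens X) (hV : V ≤ U) (hW : W ≤ V) (f : Sections X V),
    equiv W (hW.trans hV) (sectionRes X hW f) = modelRes N hW (equiv V hV f)
  equiv_parity : ∀ (V : Opens X) (hV : V ≤ U) (k : ZMod 2) (f : Sections X V),
    f ∈ parity V k ↔ equiv V hV f ∈ modelParity N V k

/-- A supermanifold of dimension `evenDim|oddDim`: a smooth manifold with a sheaf of real
superalgebras which is locally isomorphic to `C^∞ ⊗ Λ_N`, where `N` is `oddDim`. -/
structure Supermanifold where
  space : SheafedSpace.{u + 1, u, u} (AlgCat.{u} ℝ)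
  evenDim : ℕ
  oddDim : ℕ
  [t2 : T2Space space]
  [secondCountable : SecondCountableTopology space]
  [charted : ChartedSpace (EuclideanSpace ℝ (Fin evenDim)) space]
  [smooth : IsManifold (𝓡 evenDim) ∞ space]
  /-- the even and the odd sections -/
  parity : ∀ U : Opens space, ZMod 2 → Submodule ℝ (Sections space U)
  gradedMonoid : ∀ U, SetLike.GradedMonoid (parity U)
  isInternal : ∀ U, DirectSum.IsInternal (parity U)
  res_parity : ∀ {U V : Opens space} (h : U ≤ V) (k : ZMod 2) (f : Sections space V),
    f ∈ parity V k → sectionRes space h f ∈ parity U k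
  locallyTrivial : ∀ p : space, ∃ U : Opens space, p ∈ U ∧
    Nonempty (Trivialization (D := evenDim) space parity oddDim U)

attribute [instance] Supermanifold.t2 Supermanifold.secondCountable Supermanifold.charted
  Supermanifold.smooth Supermanifold.gradedMonoid

namespace Supermanifold

/-- The algebra of superfunctions, that is, of global sections of the structure sheaf. -/
abbrev Functions (M : Supermanifold.{u}) : Type u := Sections M.space ⊤

/-- The pullback `φ^♯` from the sections over `U` to those over the preimage of `U`. -/
def comorphism {X Y : SheafedSpace.{u + 1, u, u} (AlgCat.{u} ℝ)} (φ : X ⟶ Y) (U : Opens Y) :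
    Sections Y U →ₐ[ℝ] Sections X ((Opens.map φ.hom.base).obj U) :=
  (φ.hom.c.app (op U)).hom

/-- A morphism of supermanifolds: a smooth map with a morphism of sheaves of superalgebras from the
structure sheaf of the target to the push forward of that of the source. -/
@[ext]
structure Hom (M N : Supermanifold.{u}) where
  map : M.space ⟶ N.space
  contMDiff : ContMDiff (𝓡 M.evenDim) (𝓡 N.evenDim) ∞ map.hom.base
  parity : ∀ (U : Opens N.space) (k : ZMod 2) (f : Sections N.space U),
    f ∈ N.parity U k → comorphism map U f ∈ M.parity _ k

instance : Category Supermanifold.{u} where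
  Hom := Hom
  id M :=
    { map := 𝟙 _
      contMDiff := contMDiff_id
      parity := fun _ _ _ hf => hf }
  comp φ ψ :=
    { map := φ.map ≫ ψ.map
      contMDiff := ψ.contMDiff.comp φ.contMDiff
      parity := fun _ k _ hf => φ.parity _ k _ (ψ.parity _ k _ hf) }

/-- The pullback `φ^♯ : 𝒪(N) → 𝒪(M)` of superfunctions along `φ : M ⟶ N`. -/
def pullback {M N : Supermanifold.{u}} (φ : M ⟶ N) : N.Functions →ₐ[ℝ] M.Functions :=
  comorphism (Hom.map φ) ⊤

/-! ### Points -/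

variable (M : Supermanifold.{u})

/-- An open set around `p` over which the structure sheaf is trivial. -/
def trivDomain (p : M.space) : Opens M.space := (M.locallyTrivial p).choose

lemma mem_trivDomain (p : M.space) : p ∈ M.trivDomain p := (M.locallyTrivial p).choose_spec.1

def triv (p : M.space) :
    Trivialization (D := M.evenDim) M.space M.parity M.oddDim (M.trivDomain p) :=
  (M.locallyTrivial p).choose_spec.2.some

/-- The value `[f]_0(p)` at `p` of a section `f` over an open set around `p`: drop the
anticommuting variables in a local trivialization and evaluate at `p`. (An algebra homomorphism
from the germs at `p` to `ℝ` is unique, so the trivialization does not matter.) -/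
def value (p : M.space) (U : Opens M.space) (hp : p ∈ U) : Sections M.space U →ₐ[ℝ] ℝ :=
  ((modelEval (D := M.evenDim) M.oddDim p
      (show p ∈ U ⊓ M.trivDomain p from ⟨hp, M.mem_trivDomain p⟩)).comp
    ((M.triv p).equiv (U ⊓ M.trivDomain p) inf_le_right).toAlgHom).comp
    (sectionRes M.space inf_le_left)

lemma sectionRes_sectionRes {X : SheafedSpace.{u + 1, u, u} (AlgCat.{u} ℝ)} {U V W : Opens X} (h : U ≤ V)
    (h' : V ≤ W) (f : Sections X W) :
    sectionRes X h (sectionRes X h' f) = sectionRes X (h.trans h') f := by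
  have := X.presheaf.map_comp (homOfLE h').op (homOfLE h).op
  exact (ConcreteCategory.congr_hom this f).symm

lemma value_res (p : M.space) {U V : Opens M.space} (h : U ≤ V) (hp : p ∈ U)
    (f : Sections M.space V) :
    M.value p U hp (sectionRes M.space h f) = M.value p V (h hp) f := by
  have h1 : U ⊓ M.trivDomain p ≤ V ⊓ M.trivDomain p := inf_le_inf_right _ h
  have h2 := (M.triv p).equiv_res _ _ inf_le_right h1 (sectionRes M.space inf_le_left f)
  have h3 := modelEval_modelRes (D := M.evenDim) M.oddDim h1 p ⟨hp, M.mem_trivDomain p⟩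
    ((M.triv p).equiv _ inf_le_right (sectionRes M.space inf_le_left f))
  rw [← h2, sectionRes_sectionRes] at h3
  change modelEval _ _ _ ((M.triv p).equiv _ _ (sectionRes M.space _ (sectionRes M.space _ f))) = _
  rw [sectionRes_sectionRes]
  exact h3

lemma value_odd (p : M.space) {U : Opens M.space} (hp : p ∈ U) {f : Sections M.space U}
    (hf : f ∈ M.parity U 1) : M.value p U hp f = 0 :=
  modelEval_odd _ _ (((M.triv p).equiv_parity _ _ _ _).1 (M.res_parity inf_le_left _ _ hf))

/-- The evaluation `δ_p^♯` of superfunctions at the point `p`. -/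
def evalAt (p : M.space) : M.Functions →ₐ[ℝ] ℝ := M.value p ⊤ trivial

variable {M}

/-- The sheaf part of the constant morphism: `f ↦ f(p) · 1` on sections over a neighbourhood of
`p`, and the map to the zero algebra of sections over `∅` on all others. -/
def constApp (S : Supermanifold.{u}) (p : M.space) (U : Opens M.space) :
    M.space.presheaf.obj (op U) ⟶ S.space.presheaf.obj
      (op ((Opens.map (TopCat.ofHom (ContinuousMap.const S.space p))).obj U)) :=
  open Classical in
  if h : p ∈ U then AlgCat.ofHom ((Algebra.ofId ℝ _).comp (M.value p U h))
  else (S.space.sheaf.isTerminalOfEqEmpty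
    (U := (Opens.map (TopCat.ofHom (ContinuousMap.const S.space p))).obj U)
    (by ext x; exact ⟨fun hx => absurd hx h, fun hx => hx.elim⟩)).from _

lemma constApp_of_mem (S : Supermanifold.{u}) (p : M.space) (U : Opens M.space) (h : p ∈ U)
    (f : Sections M.space U) :
    (constApp S p U).hom f = algebraMap ℝ _ (M.value p U h f) := by
  have h1 : constApp S p U = AlgCat.ofHom ((Algebra.ofId ℝ _).comp (M.value p U h)) := dif_pos h
  rw [h1]
  rfl

/-- There is only one section over the empty set. -/
lemma constApp_target_subsingleton (S : Supermanifold.{u}) (p : M.space) (U : Opens M.space)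
    (h : p ∉ U) : Subsingleton (S.space.presheaf.obj
      (op ((Opens.map (TopCat.ofHom (ContinuousMap.const S.space p))).obj U))) := by
  have t : IsTerminal (S.space.presheaf.obj
      (op ((Opens.map (TopCat.ofHom (ContinuousMap.const S.space p))).obj U))) :=
    S.space.sheaf.isTerminalOfEqEmpty
      (by ext x; exact ⟨fun hx => absurd hx h, fun hx => hx.elim⟩)
  have e : S.space.presheaf.obj
      (op ((Opens.map (TopCat.ofHom (ContinuousMap.const S.space p))).obj U)) ≅
      AlgCat.of ℝ PUnit.{u + 1} :=
    t.uniqueUpToIso (IsTerminal.ofUniqueHom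
      (fun _ => AlgCat.ofHom
        { toFun := fun _ => PUnit.unit
          map_one' := rfl
          map_mul' := fun _ _ => rfl
          map_zero' := rfl
          map_add' := fun _ _ => rfl
          commutes' := fun _ => rfl })
      (fun _ _ => by ext))
  refine ⟨fun a b => ?_⟩
  have h1 := ConcreteCategory.congr_hom e.hom_inv_id a
  have h2 := ConcreteCategory.congr_hom e.hom_inv_id b
  exact h1.symm.trans ((congrArg e.inv.hom (Subsingleton.elim (α := PUnit) _ _)).trans h2)

lemma constApp_parity (S : Supermanifold.{u}) (p : M.space) (U : Opens M.space) (k : ZMod 2)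
    (f : Sections M.space U) (hf : f ∈ M.parity U k) :
    (constApp S p U).hom f ∈ S.parity _ k := by
  by_cases h : p ∈ U
  · rw [constApp_of_mem S p U h]
    by_cases hk : k = 0
    · subst hk
      rw [Algebra.algebraMap_eq_smul_one]
      exact Submodule.smul_mem _ _ (SetLike.GradedOne.one_mem)
    · obtain rfl : k = 1 := (show ∀ k : ZMod 2, k ≠ 0 → k = 1 by decide) k hk
      rw [M.value_odd p h hf, map_zero]
      exact Submodule.zero_mem _
  · have := constApp_target_subsingleton S p U h
    rw [Subsingleton.elim ((constApp S p U).hom f) 0]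
    exact Submodule.zero_mem _

/-- The constant morphism `S → {∗} → M` to the point `p` of `M`. -/
def const (S : Supermanifold.{u}) (p : M.space) : S ⟶ M :=
  Hom.mk
    (InducedCategory.homMk (F := SheafedSpace.toPresheafedSpace)
      { base := TopCat.ofHom (ContinuousMap.const S.space p)
        c :=
          { app := fun U => constApp S p U.unop
            naturality := by
              intro V U i
              apply AlgCat.hom_ext
              apply AlgHom.ext
              intro f
              by_cases h : p ∈ U.unop
              · have hUV : U.unop ≤ V.unop := leOfHom i.unop
                have e1 := constApp_of_mem S p U.unop h (sectionRes M.space hUV f)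
                have e2 := constApp_of_mem S p V.unop (hUV h) f
                rw [value_res] at e1
                refine e1.trans (Eq.symm ((congrArg _ e2).trans ?_))
                exact AlgHom.commutes (S.space.presheaf.map _).hom _
              · have := constApp_target_subsingleton S p U.unop h
                exact Subsingleton.elim (α := S.space.presheaf.obj
                  (op ((Opens.map (TopCat.ofHom (ContinuousMap.const S.space p))).obj
                    U.unop))) _ _ } })
    contMDiff_const
    (fun U k f hf => constApp_parity S p U k f hf)

/-! ### Superderivations -/

/-- A superderivation of parity `k` of the algebra of superfunctions: a linear operator of parity
`k` with `X (f h) = X(f) h + (-1)^{k |f|} f X(h)` for homogeneous `f`. -/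
structure IsSuperderivation (k : ZMod 2) (X : Module.End ℝ M.Functions) : Prop where
  parity : ∀ (j : ZMod 2) (f : M.Functions), f ∈ M.parity ⊤ j → X f ∈ M.parity ⊤ (k + j)
  leibniz : ∀ (j : ZMod 2) (f h : M.Functions), f ∈ M.parity ⊤ j →
    X (f * h) = X f * h + (-1 : ℝ) ^ (k.val * j.val) • (f * X h)

variable (M) in
/-- `Der 𝒪(M)`: the sums of even and odd superderivations. -/
def Der : Submodule ℝ (Module.End ℝ M.Functions) :=
  Submodule.span ℝ {X | ∃ k, IsSuperderivation k X}

/-! ### Products -/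

/-- `(s, t) : S ⟶ M ⊗ N`, the morphism with components `s` and `t`. -/
abbrev pair {M N : Supermanifold.{u}} {P : BinaryFan M N} (hP : IsLimit P) {S : Supermanifold.{u}}
    (s : S ⟶ M) (t : S ⟶ N) : S ⟶ P.pt :=
  hP.lift (BinaryFan.mk s t)

/-- `D` is the superderivation `X ⊗ id` of the superfunctions on a product `P = M ⊗ N`: it acts as
`X` on the superfunctions that come from `M` and kills those that come from `N`. -/
structure IsTensorId {M N : Supermanifold.{u}} (P : BinaryFan M N)
    (X : Module.End ℝ M.Functions) (D : Module.End ℝ P.pt.Functions) : Prop where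
  mem_der : D ∈ Der P.pt
  fst : ∀ f : M.Functions, D (pullback P.fst f) = pullback P.fst (X f)
  snd : ∀ f : N.Functions, D (pullback P.snd f) = 0

/-- The superderivation `X ⊗ id` of the superfunctions on a product `M ⊗ N`. For `X ∈ Der 𝒪(M)` it
exists and is unique. -/
def tensorId {M N : Supermanifold.{u}} (P : BinaryFan M N) (X : Module.End ℝ M.Functions) :
    Module.End ℝ P.pt.Functions :=
  Classical.epsilon (IsTensorId P X)

end Supermanifold

open Supermanifold

/-! ### Lie supergroups and their actions -/

/-- A Lie supergroup. The product `G ⊗ G` is the categorical product of supermanifolds, and the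
group laws are written for the components `a, b, c : S ⟶ G` of an arbitrary morphism to
`G ⊗ G ⊗ G` and `G`. -/
structure LieSupergroup where
  G : Supermanifold.{u}
  /-- the product `G ⊗ G` with its two projections -/
  sq : BinaryFan G G
  isLimit : IsLimit sq
  /-- the multiplication `μ` -/
  mul : sq.pt ⟶ G
  /-- the inversion `ν` -/
  inv : G ⟶ G
  /-- the unit point -/
  e : G.space
  inv_inv : inv ≫ inv = 𝟙 G
  mul_assoc : ∀ {S : Supermanifold.{u}} (a b c : S ⟶ G),
    pair isLimit a (pair isLimit b c ≫ mul) ≫ mul = pair isLimit (pair isLimit a b ≫ mul) c ≫ mul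
  mul_one : pair isLimit (𝟙 G) (const G e) ≫ mul = 𝟙 G
  one_mul : pair isLimit (const G e) (𝟙 G) ≫ mul = 𝟙 G
  mul_inv : pair isLimit (𝟙 G) inv ≫ mul = const G e
  inv_mul : pair isLimit inv (𝟙 G) ≫ mul = const G e

/-- The Lie superalgebra `𝔤` of a Lie supergroup: the superderivations `X` of `𝒪(G)` with
`μ^♯ ∘ X = (X ⊗ id) ∘ μ^♯`. -/
def LieSupergroup.lieSuperalgebra (𝒢 : LieSupergroup.{u}) :
    Set (Module.End ℝ 𝒢.G.Functions) :=
  {X | X ∈ Der 𝒢.G ∧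
    ∀ f, pullback 𝒢.mul (X f) = tensorId 𝒢.sq X (pullback 𝒢.mul f)}

/-- An action `Ψ : G ⊗ M ⟶ M` of a Lie supergroup on a supermanifold. -/
structure SuperAction (𝒢 : LieSupergroup.{u}) (M : Supermanifold.{u}) where
  /-- the product `G ⊗ M` with its two projections -/
  prod : BinaryFan 𝒢.G M
  isLimit : IsLimit prod
  /-- the action morphism `Ψ` -/
  act : prod.pt ⟶ M
  mul_act : ∀ {S : Supermanifold.{u}} (a b : S ⟶ 𝒢.G) (m : S ⟶ M),
    pair isLimit a (pair isLimit b m ≫ act) ≫ act =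
      pair isLimit (pair 𝒢.isLimit a b ≫ 𝒢.mul) m ≫ act
  one_act : pair isLimit (const M 𝒢.e) (𝟙 M) ≫ act = 𝟙 M

namespace SuperAction

variable {𝒢 : LieSupergroup.{u}} {M : Supermanifold.{u}} (Ψ : SuperAction 𝒢 M)

/-- `δ_g^♯ ⊗ id : 𝒪(G ⊗ M) → 𝒪(M)`, the pullback along `m ↦ (g, m)`. -/
def evalFst (g : 𝒢.G.space) : Ψ.prod.pt.Functions →ₐ[ℝ] M.Functions :=
  pullback (pair Ψ.isLimit (const M g) (𝟙 M))

/-- `γ(X) = (δ_e^♯ ∘ X ⊗ id) ∘ ψ^♯`. -/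
def gamma (X : Module.End ℝ 𝒢.G.Functions) (f : M.Functions) : M.Functions :=
  Ψ.evalFst 𝒢.e (tensorId Ψ.prod X (pullback Ψ.act f))

/-- The superfunction `f` is `G`-invariant: `ψ^♯(f) = 1 ⊗ f`. -/
def InvariantFunction (f : M.Functions) : Prop :=
  pullback Ψ.act f =
    pullback (M := Ψ.prod.pt) Ψ.prod.fst 1 * pullback (M := Ψ.prod.pt) Ψ.prod.snd f

/-- The superfunction `f` is invariant under the underlying Lie group `G₀`, every point `g` of
which acts on superfunctions by `(δ_g^♯ ⊗ id) ∘ ψ^♯`. -/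
def BodyInvariantFunction (f : M.Functions) : Prop :=
  ∀ g : 𝒢.G.space, Ψ.evalFst g (pullback Ψ.act f) = f

variable {V : Type w} [AddCommGroup V] [Module ℝ V] (T : M.Functions →ₗ[ℝ] V)

/-- `(id ⊗ T) F` for a superfunction `F` on `G ⊗ M`, as a superfunction on `G` with values in `V`:
it is given by its derivatives at the points `g` of `G`, namely by the vectors
`(δ_g^♯ ∘ Z ⊗ T) F` for the differential operators `Z = X₁ ⋯ Xₖ` on `G`, `k ≥ 0`. -/
def idTensor (F : Ψ.prod.pt.Functions) (g : 𝒢.G.space) (Z : List (Der 𝒢.G)) : V :=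
  T (Ψ.evalFst g ((Z.map fun X => tensorId Ψ.prod X.1).prod F))

/-- The superfunction `1 ⊗ v` on `G` with values in `V`, given by its derivatives
`(δ_g^♯ ∘ Z)(1) v` in the same way. -/
def oneTensor (𝒢 : LieSupergroup.{u}) (v : V) (g : 𝒢.G.space) (Z : List (Der 𝒢.G)) : V :=
  𝒢.G.evalAt g ((Z.map fun X => X.1).prod 1) • v

/-- The linear map `T` is `G`-invariant: `(id ⊗ T) ∘ ψ^♯ = 1 ⊗ T`. -/
def InvariantMap : Prop :=
  ∀ f : M.Functions, Ψ.idTensor T (pullback Ψ.act f) = oneTensor 𝒢 (T f)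

/-- The linear map `T` is invariant under the underlying Lie group `G₀`:
`(δ_g^♯ ⊗ T) ∘ ψ^♯ = T` for every point `g`. -/
def BodyInvariantMap : Prop :=
  ∀ (g : 𝒢.G.space) (f : M.Functions), T (Ψ.evalFst g (pullback Ψ.act f)) = T f

end SuperAction

end Supergeometry

end

noncomputable section

namespace Supergeometry

/-! ### Parity involutions of `ℤ/2`-graded algebras -/

/-! The structure sheaf of G ⊗ M is known only through the universal property of the product, so
every statement about it is obtained from morphisms. An odd superderivation Y along φ : S → N is the
same as a morphism φ + ξY : S × ℝ^{0|1} → N (`IsDerivationAlong.exists_hom`,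
`isDerivationAlong_oddPart`), and an even one becomes odd after multiplication by ξ
(`isDerivationAlong_xi_iff`). Hence a derivation along a morphism to a product is a pair of
derivations (`exists_isLift`, `IsLift.unique`). So X ⊗ id exists and is unique, and the group and
action laws can be differentiated (`SuperAction.assoc`). The morphisms needed for this come from
`exists_hom`: an even homomorphism of global superfunctions compatible with evaluation over a smooth
map is a pullback.

Differentiating associativity at the unit along a point derivation v gives a member X_v of 𝔤 with
value v at e, together with (X_v ⊗ id) ∘ ψ^♯ = ψ^♯ ∘ γ(X_v) (`tensorId_act`). The cotangent space at
e is finite dimensional with a homogeneous basis (`exists_cotangentFrame`, from Hadamard's lemma).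
Translating a derivation along φ : S → G to the unit by φ⁻¹ then writes it as a finite combination
of the φ^♯ ∘ X_i, where X_i = X_{v_i}, with coefficients in 𝒪(S) (`exists_eq_sum_invariantDer`).

For superfunctions, the forward direction is immediate. Conversely, H = ψ^♯(f) - 1 ⊗ f is killed by
all X_i ⊗ id and vanishes on every {g} ⊗ M. Superfunctions are detected by superpoints S × ℝ^{0|n} →
G ⊗ M. The odd variables can be removed from the group component one at a time: removing ξ changes
the pullback of H by ξ times a combination of pullbacks of the (X_i ⊗ id) H, which are zero. In the
end the group component is a constant g, and H restricted to {g} ⊗ M is zero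
(`eq_zero_of_tensorId_of_evalFst`).

For linear maps, the forward direction is the cases k = 0 and k = 1, since derivations kill 1.
Conversely, the frame turns (Y ⊗ id) ψ^♯(f) into Σ a_i ψ^♯(γ(X_i) f) for each homogeneous
superderivation Y. So the span of the pairs (b ψ^♯(f), b) and (b ψ^♯(γ(X_i) f'), 0) is stable under
(Y ⊗ id, Y) for every Y in Der 𝒪(G), and it contains all the pairs (Zψ^♯(f), Z1)
(`prod_mem_orbitSpan`). The hypotheses on T settle the generators. -/

/-- The sign `(-1)^k`. -/
def sgn (k : ZMod 2) : ℝ := (-1) ^ k.val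

@[simp] lemma sgn_zero : sgn 0 = 1 := rfl

@[simp] lemma sgn_one : sgn 1 = -1 := by
  have : (1 : ZMod 2).val = 1 := rfl
  simp [sgn, this]

lemma zmod_two_cases (k : ZMod 2) : k = 0 ∨ k = 1 := by
  revert k; decide

lemma sgn_add (k l : ZMod 2) : sgn (k + l) = sgn k * sgn l := by
  have h : (1 : ZMod 2) + 1 = 0 := rfl
  rcases zmod_two_cases k with rfl | rfl <;> rcases zmod_two_cases l with rfl | rfl <;> simp [h]

@[simp] lemma sgn_mul_self (k : ZMod 2) : sgn k * sgn k = 1 := by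
  rcases zmod_two_cases k with rfl | rfl <;> simp

lemma neg_one_pow_val_mul_val (k l : ZMod 2) :
    (-1 : ℝ) ^ (k.val * l.val) = sgn l ^ k.val := by
  rw [sgn, ← pow_mul, mul_comm]

lemma zmod_two_add_self (k : ZMod 2) : k + k = 0 := by
  revert k; decide

section Parity

variable {R : Type*} [AddCommGroup R] [Module ℝ R]

/-- The linear involution `s` is `(-1)^k` on the part of parity `k`, and the parts of parity `k`
are the eigenspaces. -/
structure IsParityInvolution (s : R →ₗ[ℝ] R) (A : ZMod 2 → Submodule ℝ R) : Prop where
  involutive : ∀ f, s (s f) = f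
  mem_iff : ∀ k f, f ∈ A k ↔ s f = sgn k • f

namespace IsParityInvolution

variable {s : R →ₗ[ℝ] R} {A : ZMod 2 → Submodule ℝ R}

lemma part_mem (h : IsParityInvolution s A) (k : ZMod 2) (f : R) :
    (2⁻¹ : ℝ) • (f + sgn k • s f) ∈ A k := by
  rw [h.mem_iff, map_smul, map_add, map_smul, h.involutive, smul_comm (sgn k), smul_add (sgn k),
    smul_smul (sgn k), sgn_mul_self, one_smul, add_comm]

lemma part_add_part (f : R) :
    (2⁻¹ : ℝ) • (f + sgn 0 • s f) + (2⁻¹ : ℝ) • (f + sgn 1 • s f) = f := by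
  simp only [sgn_zero, sgn_one]
  module

lemma exists_add (h : IsParityInvolution s A) (f : R) :
    ∃ f₀ ∈ A 0, ∃ f₁ ∈ A 1, f₀ + f₁ = f :=
  ⟨_, h.part_mem 0 f, _, h.part_mem 1 f, part_add_part f⟩

lemma isInternal (h : IsParityInvolution s A) : DirectSum.IsInternal A := by
  rw [DirectSum.isInternal_submodule_iff_isCompl A (i := 0) (j := 1) (by decide)
    (by ext k; simpa using zmod_two_cases k)]
  constructor
  · rw [Submodule.disjoint_def]
    intro f h0 h1
    rw [h.mem_iff] at h0 h1
    rw [h0] at h1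
    rw [sgn_zero, sgn_one, one_smul, neg_one_smul] at h1
    have : (2 : ℝ) • f = 0 := by
      rw [two_smul]
      nth_rw 1 [h1]
      simp
    simpa using this
  · rw [codisjoint_iff, Submodule.eq_top_iff']
    intro f
    obtain ⟨f₀, h0, f₁, h1, rfl⟩ := h.exists_add f
    exact Submodule.add_mem_sup h0 h1

/-- A condition on homogeneous elements becomes one identity between linear maps, valid for all `f`.
This is how pullbacks and derivations are handled below without splitting into parities. -/
lemma comm_of_parity {R' : Type*} [AddCommGroup R'] [Module ℝ R'] {s' : R' →ₗ[ℝ] R'}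
    {A' : ZMod 2 → Submodule ℝ R'} (h : IsParityInvolution s A) (h' : IsParityInvolution s' A')
    {T : R →ₗ[ℝ] R'} {k : ZMod 2} (hT : ∀ l, ∀ f ∈ A l, T f ∈ A' (k + l)) (f : R) :
    s' (T f) = sgn k • T (s f) := by
  obtain ⟨f₀, h0, f₁, h1, rfl⟩ := h.exists_add f
  have e : ∀ l, ∀ f ∈ A l, s' (T f) = sgn k • T (s f) := by
    intro l f hf
    rw [(h'.mem_iff _ _).1 (hT l f hf), (h.mem_iff _ _).1 hf, map_smul, sgn_add, smul_smul]
  simp only [map_add, smul_add, e _ _ h0, e _ _ h1]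

lemma ext_parity (h : IsParityInvolution s A) {R' : Type*} [AddCommGroup R'] [Module ℝ R']
    {T T' : R →ₗ[ℝ] R'} (hT : ∀ l, ∀ f ∈ A l, T f = T' f) : T = T' := by
  ext f
  obtain ⟨f₀, h0, f₁, h1, rfl⟩ := h.exists_add f
  rw [map_add, map_add, hT _ _ h0, hT _ _ h1]

end IsParityInvolution

end Parity

section ParityAlgebra

variable {R : Type*} [Ring R] [Algebra ℝ R] (A : ZMod 2 → Submodule ℝ R)

/-- The linear involution of a `ℤ/2`-graded module, `(-1)^k` on the part of parity `k`. -/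
def gradingInvolution (hA : DirectSum.IsInternal A) : R →ₗ[ℝ] R :=
  LinearMap.ofIsCompl (hA.isCompl (i := 0) (j := 1) (by decide)
    (by ext k; simpa using zmod_two_cases k)) (A 0).subtype (-(A 1).subtype)

lemma isParityInvolution_gradingInvolution (hA : DirectSum.IsInternal A) :
    IsParityInvolution (gradingInvolution A hA) A := by
  have hc : IsCompl (A 0) (A 1) := hA.isCompl (i := 0) (j := 1) (by decide)
    (by ext k; simpa using zmod_two_cases k)
  have h0 : ∀ f ∈ A 0, gradingInvolution A hA f = f := fun f hf =>
    LinearMap.ofIsCompl_apply_left hc (⟨f, hf⟩ : A 0)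
  have h1 : ∀ f ∈ A 1, gradingInvolution A hA f = -f := fun f hf =>
    LinearMap.ofIsCompl_apply_right hc (⟨f, hf⟩ : A 1)
  have hd : ∀ f, ∃ f₀ ∈ A 0, ∃ f₁ ∈ A 1, f₀ + f₁ = f := fun f =>
    Submodule.mem_sup.1 (hc.sup_eq_top ▸ Submodule.mem_top)
  constructor
  · intro f
    obtain ⟨f₀, m0, f₁, m1, rfl⟩ := hd f
    simp only [map_add, map_neg, h0 _ m0, h1 _ m1, neg_neg]
  · intro k f
    rcases zmod_two_cases k with rfl | rfl
    · refine ⟨fun hf => by simp [h0 f hf], fun hf => ?_⟩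
      obtain ⟨f₀, m0, f₁, m1, rfl⟩ := hd f
      simp only [map_add, h0 _ m0, h1 _ m1, sgn_zero, one_smul] at hf
      have : (2 : ℝ) • f₁ = 0 := by
        rw [two_smul]
        nth_rw 1 [← add_left_cancel hf]
        simp
      have : f₁ = 0 := by simpa using this
      rwa [this, add_zero]
    · refine ⟨fun hf => by simp [h1 f hf], fun hf => ?_⟩
      obtain ⟨f₀, m0, f₁, m1, rfl⟩ := hd f
      simp only [map_add, h0 _ m0, h1 _ m1, sgn_one] at hf
      have : (2 : ℝ) • f₀ = 0 := by
        rw [neg_one_smul, neg_add] at hf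
        rw [two_smul]
        nth_rw 1 [add_right_cancel hf]
        simp
      have : f₀ = 0 := by simpa using this
      rwa [this, zero_add]

/-- The parity involution of a `ℤ/2`-graded algebra. -/
def parityInvolution [SetLike.GradedMonoid A] (hA : DirectSum.IsInternal A) : R →ₐ[ℝ] R :=
  AlgHom.ofLinearMap (gradingInvolution A hA)
    (by
      have h := isParityInvolution_gradingInvolution A hA
      rw [(h.mem_iff 0 1).1 SetLike.GradedOne.one_mem, sgn_zero, one_smul])
    (by
      have h := isParityInvolution_gradingInvolution A hA
      have e : ∀ k l, ∀ f ∈ A k, ∀ g ∈ A l, gradingInvolution A hA (f * g) =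
          gradingInvolution A hA f * gradingInvolution A hA g := by
        intro k l f hf g hg
        rw [(h.mem_iff _ _).1 hf, (h.mem_iff _ _).1 hg,
          (h.mem_iff _ _).1 (SetLike.GradedMul.mul_mem hf hg), sgn_add, smul_mul_smul_comm]
      intro f g
      obtain ⟨f₀, m0, f₁, m1, rfl⟩ := h.exists_add f
      obtain ⟨g₀, n0, g₁, n1, rfl⟩ := h.exists_add g
      simp only [mul_add, add_mul, map_add, e _ _ _ m0 _ n0, e _ _ _ m0 _ n1, e _ _ _ m1 _ n0,
        e _ _ _ m1 _ n1])

lemma isParityInvolution_parityInvolution [SetLike.GradedMonoid A]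
    (hA : DirectSum.IsInternal A) :
    IsParityInvolution (parityInvolution A hA).toLinearMap A :=
  isParityInvolution_gradingInvolution A hA

end ParityAlgebra

/-! ### Adjoining an odd variable -/

/-- The algebra `A[ξ]` with `ξ² = 0` and `a ξ = ξ σ(a)`. Its elements `a + ξ b` are written as pairs
`(a, b)`. -/
def OddExt {A : Type*} [Ring A] [Algebra ℝ A] (_σ : A →ₐ[ℝ] A) : Type _ := A × A

namespace OddExt

variable {A B : Type*} [Ring A] [Algebra ℝ A] [Ring B] [Algebra ℝ B] {σ : A →ₐ[ℝ] A}
  {τ : B →ₐ[ℝ] B}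

instance : AddCommGroup (OddExt σ) := inferInstanceAs (AddCommGroup (A × A))
instance : Module ℝ (OddExt σ) := inferInstanceAs (Module ℝ (A × A))
instance : Mul (OddExt σ) := ⟨fun x y => (x.1 * y.1, σ x.1 * y.2 + x.2 * y.1)⟩
instance : One (OddExt σ) := ⟨(1, 0)⟩

@[ext] lemma ext {x y : OddExt σ} (h1 : x.1 = y.1) (h2 : x.2 = y.2) : x = y := Prod.ext h1 h2

@[simp] lemma add_fst (x y : OddExt σ) : (x + y).1 = x.1 + y.1 := rfl
@[simp] lemma add_snd (x y : OddExt σ) : (x + y).2 = x.2 + y.2 := rfl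
@[simp] lemma zero_fst : (0 : OddExt σ).1 = 0 := rfl
@[simp] lemma zero_snd : (0 : OddExt σ).2 = 0 := rfl
@[simp] lemma smul_fst (c : ℝ) (x : OddExt σ) : (c • x).1 = c • x.1 := rfl
@[simp] lemma smul_snd (c : ℝ) (x : OddExt σ) : (c • x).2 = c • x.2 := rfl
@[simp] lemma mul_fst (x y : OddExt σ) : (x * y).1 = x.1 * y.1 := rfl
@[simp] lemma mul_snd (x y : OddExt σ) : (x * y).2 = σ x.1 * y.2 + x.2 * y.1 := rfl
@[simp] lemma one_fst : (1 : OddExt σ).1 = 1 := rfl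
@[simp] lemma one_snd : (1 : OddExt σ).2 = 0 := rfl

instance : Ring (OddExt σ) :=
  { (inferInstance : AddCommGroup (OddExt σ)), (inferInstance : Mul (OddExt σ)),
    (inferInstance : One (OddExt σ)) with
    left_distrib := fun x y z => by
      ext <;> simp [mul_add]; abel
    right_distrib := fun x y z => by
      ext <;> simp [add_mul]; abel
    zero_mul := fun x => by ext <;> simp
    mul_zero := fun x => by ext <;> simp
    mul_assoc := fun x y z => by
      ext <;> simp [mul_assoc, mul_add, add_mul, add_assoc]
    one_mul := fun x => by ext <;> simp
    mul_one := fun x => by ext <;> simp }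

instance : Algebra ℝ (OddExt σ) :=
  Algebra.ofModule (fun r x y => by ext <;> simp) (fun r x y => by ext <;> simp)

/-- The quotient map `ξ ↦ 0`. -/
def fstHom (σ : A →ₐ[ℝ] A) : OddExt σ →ₐ[ℝ] A :=
  AlgHom.ofLinearMap (LinearMap.fst ℝ A A) rfl (fun _ _ => rfl)

@[simp] lemma fstHom_apply (x : OddExt σ) : fstHom σ x = x.1 := rfl

/-- The algebra homomorphism `a ↦ φ(a) + ξ Y(a)`, for a twisted derivation `Y` along `φ`. -/
def lift (φ : B →ₐ[ℝ] A) (Y : B →ₗ[ℝ] A) (hY : ∀ a b, Y (a * b) = σ (φ a) * Y b + Y a * φ b) :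
    B →ₐ[ℝ] OddExt σ :=
  AlgHom.ofLinearMap (φ.toLinearMap.prod Y)
    (by
      refine ext (map_one φ) ?_
      have := hY 1 1
      simp only [mul_one, map_one, one_mul] at this
      exact left_eq_add.1 this)
    (fun a b => ext (map_mul φ a b) (hY a b))

@[simp] lemma lift_fst (φ : B →ₐ[ℝ] A) (Y : B →ₗ[ℝ] A) (hY) (b : B) :
    (lift (σ := σ) φ Y hY b).1 = φ b := rfl
@[simp] lemma lift_snd (φ : B →ₐ[ℝ] A) (Y : B →ₗ[ℝ] A) (hY) (b : B) :
    (lift (σ := σ) φ Y hY b).2 = Y b := rfl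

/-- The inclusion of `A` into `A[ξ]`. -/
def inlHom (σ : A →ₐ[ℝ] A) : A →ₐ[ℝ] OddExt σ := lift (AlgHom.id ℝ A) 0 (by simp)

@[simp] lemma inlHom_fst (a : A) : (inlHom σ a).1 = a := rfl
@[simp] lemma inlHom_snd (a : A) : (inlHom σ a).2 = 0 := rfl

/-- The homomorphism `A[ξ] → B[ξ]` given by `φ : A → B` on the coefficients. -/
def map (φ : A →ₐ[ℝ] B) (h : ∀ a, φ (σ a) = τ (φ a)) : OddExt σ →ₐ[ℝ] OddExt τ :=
  AlgHom.ofLinearMap (φ.toLinearMap.prodMap φ.toLinearMap)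
    (ext (map_one φ) (map_zero φ))
    (fun x y => ext (map_mul φ x.1 y.1) (by
      change φ (σ x.1 * y.2 + x.2 * y.1) = τ (φ x.1) * φ y.2 + φ x.2 * φ y.1
      simp [h]))

@[simp] lemma map_fst (φ : A →ₐ[ℝ] B) (h : ∀ a, φ (σ a) = τ (φ a)) (x : OddExt σ) :
    (map φ h x).1 = φ x.1 := rfl
@[simp] lemma map_snd (φ : A →ₐ[ℝ] B) (h : ∀ a, φ (σ a) = τ (φ a)) (x : OddExt σ) :
    (map φ h x).2 = φ x.2 := rfl

/-- The substitution `ξ ↦ η`. -/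
def subst (σ : A →ₐ[ℝ] A) (η : A) (hη : η * η = 0)
    (hc : ∀ a, a * η = η * σ a) : OddExt σ →ₐ[ℝ] A :=
  AlgHom.ofLinearMap { toFun := fun x => x.1 + η * x.2
                       map_add' := fun x y => by simp only [add_fst, add_snd, mul_add]; abel
                       map_smul' := fun c x => by simp }
    (by simp)
    (fun x y => by
      have e1 : x.1 * (η * y.2) = η * (σ x.1 * y.2) := by rw [← mul_assoc, hc, mul_assoc]
      have e2 : η * x.2 * (η * y.2) = 0 := by
        rw [mul_assoc, ← mul_assoc x.2, hc, mul_assoc, ← mul_assoc, hη, zero_mul]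
      simp only [LinearMap.coe_mk, AddHom.coe_mk, mul_fst, mul_snd, mul_add, add_mul, e1, e2,
        add_zero, mul_assoc]
      abel)

@[simp] lemma subst_apply (η : A) (hη : η * η = 0)
    (hc : ∀ a, a * η = η * σ a) (x : OddExt σ) : subst σ η hη hc x = x.1 + η * x.2 := rfl

/-- The parity involution of `A[ξ]`, for which `ξ` is odd. -/
def sigma (σ : A →ₐ[ℝ] A) : OddExt σ →ₗ[ℝ] OddExt σ :=
  LinearMap.prodMap σ.toLinearMap (-σ.toLinearMap)

@[simp] lemma sigma_fst (x : OddExt σ) : (sigma σ x).1 = σ x.1 := rfl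
@[simp] lemma sigma_snd (x : OddExt σ) : (sigma σ x).2 = -σ x.2 := rfl

/-- The elements `a + ξ b` of parity `k`: `a` has parity `k`, and `b` has parity `k + 1`. -/
def parity (σ : A →ₐ[ℝ] A) (P : ZMod 2 → Submodule ℝ A) (k : ZMod 2) : Submodule ℝ (OddExt σ) :=
  (P k).prod (P (k + 1))

lemma mem_parity {P : ZMod 2 → Submodule ℝ A} {k : ZMod 2} {x : OddExt σ} :
    x ∈ parity σ P k ↔ x.1 ∈ P k ∧ x.2 ∈ P (k + 1) := Iff.rfl

lemma isParityInvolution {P : ZMod 2 → Submodule ℝ A}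
    (h : IsParityInvolution σ.toLinearMap P) : IsParityInvolution (sigma σ) (parity σ P) where
  involutive x := by
    have := h.involutive
    simp only [AlgHom.toLinearMap_apply] at this
    ext <;> simp [this]
  mem_iff k x := by
    rw [mem_parity, h.mem_iff, h.mem_iff, OddExt.ext_iff]
    simp [sgn_add, neg_eq_iff_eq_neg]

lemma gradedMonoid {P : ZMod 2 → Submodule ℝ A} [SetLike.GradedMonoid P]
    (h : IsParityInvolution σ.toLinearMap P) : SetLike.GradedMonoid (parity σ P) where
  one_mem := ⟨SetLike.GradedOne.one_mem, zero_mem _⟩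
  mul_mem k l x y hx hy := by
    have hs : σ x.1 ∈ P k := by
      have := (h.mem_iff k x.1).1 hx.1
      rw [AlgHom.toLinearMap_apply] at this
      rw [this]
      exact Submodule.smul_mem _ _ hx.1
    refine ⟨SetLike.GradedMul.mul_mem hx.1 hy.1, Submodule.add_mem _ ?_ ?_⟩
    · rw [add_assoc]
      exact SetLike.GradedMul.mul_mem hs hy.2
    · rw [add_right_comm]
      exact SetLike.GradedMul.mul_mem hx.2 hy.1

end OddExt


/-! ### Grassmann algebras -/

section Grassmann

variable {N : ℕ}

/-- The parity involution of the Grassmann algebra. -/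
abbrev grassmannSigma (N : ℕ) : Grassmann N →ₐ[ℝ] Grassmann N := CliffordAlgebra.involute

lemma isParityInvolution_grassmannSigma :
    IsParityInvolution (grassmannSigma N).toLinearMap (grassmannParity N) where
  involutive := CliffordAlgebra.involute_involute
  mem_iff k f := by
    have hc := CliffordAlgebra.evenOdd_isCompl (0 : QuadraticForm ℝ (Fin N → ℝ))
    obtain ⟨f₀, m0, f₁, m1, rfl⟩ : ∃ f₀ ∈ grassmannParity N 0, ∃ f₁ ∈ grassmannParity N 1,
      f₀ + f₁ = f := Submodule.mem_sup.1 (hc.sup_eq_top ▸ Submodule.mem_top)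
    have e0 := CliffordAlgebra.involute_eq_of_mem_even m0
    have e1 := CliffordAlgebra.involute_eq_of_mem_odd m1
    rcases zmod_two_cases k with rfl | rfl
    · refine ⟨fun h => by simp [CliffordAlgebra.involute_eq_of_mem_even h], fun h => ?_⟩
      rw [AlgHom.toLinearMap_apply, map_add, e0, e1, sgn_zero, one_smul] at h
      have h2 : (2 : ℝ) • f₁ = 0 := by
        rw [two_smul]
        nth_rw 1 [← add_left_cancel h]
        simp
      have : f₁ = 0 := by simpa using h2
      rwa [this, add_zero]
    · refine ⟨fun h => by
        rw [AlgHom.toLinearMap_apply, CliffordAlgebra.involute_eq_of_mem_odd h, sgn_one, neg_one_smul],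
        fun h => ?_⟩
      rw [AlgHom.toLinearMap_apply, map_add, e0, e1, sgn_one, neg_one_smul, neg_add] at h
      have h2 : (2 : ℝ) • f₀ = 0 := by
        rw [two_smul]
        nth_rw 1 [add_right_cancel h]
        simp
      have : f₀ = 0 := by simpa using h2
      rwa [this, zero_add]

/-- The relation `a ξ = ξ σ(a)` that is built into `OddExt`, checked on generators. It permits the
substitution of a generator for ξ. -/
lemma mul_ι_eq (a : Grassmann N) (m : Fin N → ℝ) :
    a * ExteriorAlgebra.ι ℝ m = ExteriorAlgebra.ι ℝ m * grassmannSigma N a := by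
  induction a using ExteriorAlgebra.induction with
  | algebraMap r => rw [AlgHom.commutes, Algebra.commutes]
  | ι x =>
    have h := ExteriorAlgebra.ι_add_mul_swap (R := ℝ) x m
    rw [show grassmannSigma N (ExteriorAlgebra.ι ℝ x) = -ExteriorAlgebra.ι ℝ x from
      CliffordAlgebra.involute_ι x, mul_neg, eq_neg_iff_add_eq_zero]
    exact h
  | mul a b ha hb => rw [mul_assoc, hb, ← mul_assoc, ha, mul_assoc, map_mul]
  | add a b ha hb => rw [add_mul, ha, hb, map_add, mul_add]

lemma mul_ι_mul_ι_eq (a : Grassmann N) (m₁ m₂ : Fin N → ℝ) :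
    a * (ExteriorAlgebra.ι ℝ m₁ * ExteriorAlgebra.ι ℝ m₂) =
      ExteriorAlgebra.ι ℝ m₁ * ExteriorAlgebra.ι ℝ m₂ * a := by
  rw [← mul_assoc, mul_ι_eq a m₁, mul_assoc, mul_ι_eq (grassmannSigma N a),
    CliffordAlgebra.involute_involute, mul_assoc]

/-- Supercommutativity of the Grassmann algebra. -/
lemma grassmann_supercomm {k : ZMod 2} {b : Grassmann N} (hb : b ∈ grassmannParity N k)
    (a : Grassmann N) : a * b = b * (grassmannSigma N ^ k.val) a := by
  have key : ∀ (k : ZMod 2) (b : Grassmann N) (_ : b ∈ grassmannParity N k) (a : Grassmann N),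
      a * b = b * (grassmannSigma N ^ k.val) a := by
    have hone : (1 : ZMod 2).val = 1 := rfl
    have h0 : ∀ (b : Grassmann N) (_ : b ∈ grassmannParity N 0) (a : Grassmann N),
        a * b = b * a := by
      intro b hb
      induction b, hb using CliffordAlgebra.even_induction with
      | algebraMap r => intro a; exact (Algebra.commutes r a).symm
      | add x y hx hy ihx ihy => intro a; rw [mul_add, add_mul, ihx, ihy]
      | ι_mul_ι_mul m₁ m₂ x hx ih =>
        intro a
        change a * (ExteriorAlgebra.ι ℝ m₁ * ExteriorAlgebra.ι ℝ m₂ * x) =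
          ExteriorAlgebra.ι ℝ m₁ * ExteriorAlgebra.ι ℝ m₂ * x * a
        rw [← mul_assoc, mul_ι_mul_ι_eq, mul_assoc, ih, mul_assoc _ x]
    intro k b hb
    rcases zmod_two_cases k with rfl | rfl
    · simpa using h0 b hb
    · rw [hone, pow_one]
      induction b, hb using CliffordAlgebra.odd_induction with
      | ι m => intro a; exact mul_ι_eq a m
      | add x y hx hy ihx ihy => intro a; rw [mul_add, add_mul, ihx, ihy]
      | ι_mul_ι_mul m₁ m₂ x hx ih =>
        intro a
        change a * (ExteriorAlgebra.ι ℝ m₁ * ExteriorAlgebra.ι ℝ m₂ * x) =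
          ExteriorAlgebra.ι ℝ m₁ * ExteriorAlgebra.ι ℝ m₂ * x * _
        rw [← mul_assoc, mul_ι_mul_ι_eq, mul_assoc, ih, mul_assoc _ x]
  exact key k b hb a

lemma map_grassmannSigma {N' : ℕ} (L : (Fin N → ℝ) →ₗ[ℝ] (Fin N' → ℝ)) (a : Grassmann N) :
    ExteriorAlgebra.map L (grassmannSigma N a) = grassmannSigma N' (ExteriorAlgebra.map L a) := by
  have : (ExteriorAlgebra.map L).comp (grassmannSigma N) =
      (grassmannSigma N').comp (ExteriorAlgebra.map L) := by
    apply ExteriorAlgebra.hom_ext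
    refine LinearMap.ext fun m => ?_
    change ExteriorAlgebra.map L (CliffordAlgebra.involute (CliffordAlgebra.ι 0 m)) =
      CliffordAlgebra.involute (ExteriorAlgebra.map L (ExteriorAlgebra.ι ℝ m))
    rw [CliffordAlgebra.involute_ι, map_neg]
    change -(ExteriorAlgebra.map L (ExteriorAlgebra.ι ℝ m)) = _
    rw [ExteriorAlgebra.map_apply_ι]
    exact (CliffordAlgebra.involute_ι (L m)).symm
  exact DFunLike.congr_fun this a

/-- The inclusion of coordinate spaces that prepends a zero. -/
def consZero (N : ℕ) : (Fin N → ℝ) →ₗ[ℝ] (Fin (N + 1) → ℝ) where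
  toFun m := Fin.cons 0 m
  map_add' a b := by ext i; refine Fin.cases ?_ (fun j => ?_) i <;> simp
  map_smul' a b := by ext i; refine Fin.cases ?_ (fun j => ?_) i <;> simp

/-- The generator of `Λ_{N+1}` that is added to those of `Λ_N`. -/
def newGen (N : ℕ) : Grassmann (N + 1) := ExteriorAlgebra.ι ℝ (Fin.cons 1 0 : Fin (N + 1) → ℝ)

def ofOddExtGrassmann (N : ℕ) : OddExt (grassmannSigma N) →ₐ[ℝ] Grassmann (N + 1) :=
  (OddExt.subst (grassmannSigma (N + 1)) (newGen N)
    (ExteriorAlgebra.ι_sq_zero _) (fun a => mul_ι_eq a _)).comp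
    (OddExt.map (ExteriorAlgebra.map (consZero N)) (map_grassmannSigma _))

def toOddExtGrassmannLin (N : ℕ) : (Fin (N + 1) → ℝ) →ₗ[ℝ] OddExt (grassmannSigma N) :=
  ((ExteriorAlgebra.ι ℝ) ∘ₗ LinearMap.funLeft ℝ ℝ Fin.succ).prod
    ((Algebra.linearMap ℝ (Grassmann N)) ∘ₗ LinearMap.proj 0)

def toOddExtGrassmann (N : ℕ) : Grassmann (N + 1) →ₐ[ℝ] OddExt (grassmannSigma N) :=
  ExteriorAlgebra.lift ℝ ⟨toOddExtGrassmannLin N, fun m => by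
    have h1 : (toOddExtGrassmannLin N m).1 = ExteriorAlgebra.ι ℝ (m ∘ Fin.succ) := rfl
    have h2 : (toOddExtGrassmannLin N m).2 = algebraMap ℝ _ (m 0) := rfl
    have h3 : grassmannSigma N (ExteriorAlgebra.ι ℝ (m ∘ Fin.succ)) =
        -ExteriorAlgebra.ι ℝ (m ∘ Fin.succ) := CliffordAlgebra.involute_ι _
    ext
    · simp [h1]
    · simp only [OddExt.mul_snd, h1, h2, h3, OddExt.zero_snd]
      rw [Algebra.commutes, neg_mul, neg_add_cancel]⟩

lemma toOddExtGrassmann_ι (m : Fin (N + 1) → ℝ) :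
    toOddExtGrassmann N (ExteriorAlgebra.ι ℝ m) = toOddExtGrassmannLin N m :=
  ExteriorAlgebra.lift_ι_apply ..

lemma toOddExtGrassmann_map (a : Grassmann N) :
    toOddExtGrassmann N (ExteriorAlgebra.map (consZero N) a) = OddExt.inlHom _ a := by
  have : (toOddExtGrassmann N).comp (ExteriorAlgebra.map (consZero N)) = OddExt.inlHom _ := by
    apply ExteriorAlgebra.hom_ext
    refine LinearMap.ext fun m => ?_
    change toOddExtGrassmann N (ExteriorAlgebra.map (consZero N) (ExteriorAlgebra.ι ℝ m)) =
      OddExt.inlHom _ (ExteriorAlgebra.ι ℝ m)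
    rw [ExteriorAlgebra.map_apply_ι, toOddExtGrassmann_ι]
    refine OddExt.ext rfl ?_
    exact map_zero (algebraMap ℝ (Grassmann N))
  exact DFunLike.congr_fun this a

lemma toOddExtGrassmann_newGen :
    toOddExtGrassmann N (newGen N) = ((0, 1) : Grassmann N × Grassmann N) := by
  rw [newGen, toOddExtGrassmann_ι]
  refine OddExt.ext ?_ (map_one (algebraMap ℝ (Grassmann N)))
  exact map_zero (ExteriorAlgebra.ι ℝ)

lemma toOddExtGrassmann_ofOddExtGrassmann (x : OddExt (grassmannSigma N)) :
    toOddExtGrassmann N (ofOddExtGrassmann N x) = x := by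
  change toOddExtGrassmann N (ExteriorAlgebra.map (consZero N) x.1 +
    newGen N * ExteriorAlgebra.map (consZero N) x.2) = x
  rw [map_add, map_mul, toOddExtGrassmann_map, toOddExtGrassmann_map, toOddExtGrassmann_newGen]
  ext
  · change x.1 + 0 * x.2 = x.1
    simp
  · change 0 + (grassmannSigma N 0 * 0 + 1 * x.2) = x.2
    simp

lemma ofOddExtGrassmann_toOddExtGrassmann (a : Grassmann (N + 1)) :
    ofOddExtGrassmann N (toOddExtGrassmann N a) = a := by
  have : (ofOddExtGrassmann N).comp (toOddExtGrassmann N) = AlgHom.id ℝ _ := by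
    apply ExteriorAlgebra.hom_ext
    refine LinearMap.ext fun m => ?_
    change ofOddExtGrassmann N (toOddExtGrassmann N (ExteriorAlgebra.ι ℝ m)) =
      ExteriorAlgebra.ι ℝ m
    rw [toOddExtGrassmann_ι]
    change ExteriorAlgebra.map (consZero N) (ExteriorAlgebra.ι ℝ (m ∘ Fin.succ)) +
      newGen N * ExteriorAlgebra.map (consZero N) (algebraMap ℝ _ (m 0)) = _
    rw [ExteriorAlgebra.map_apply_ι, AlgHom.commutes, ← Algebra.commutes,
      ← Algebra.smul_def, newGen, ← map_smul, ← map_add]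
    congr 1
    ext i
    refine Fin.cases ?_ (fun j => ?_) i <;> simp [consZero]
  exact DFunLike.congr_fun this a

/-- `Λ_{N+1} = Λ_N[ξ]`. -/
def grassmannSuccEquiv (N : ℕ) : Grassmann (N + 1) ≃ₐ[ℝ] OddExt (grassmannSigma N) :=
  AlgEquiv.ofAlgHom (toOddExtGrassmann N) (ofOddExtGrassmann N)
    (AlgHom.ext toOddExtGrassmann_ofOddExtGrassmann)
    (AlgHom.ext ofOddExtGrassmann_toOddExtGrassmann)

lemma grassmannSuccEquiv_sigma (a : Grassmann (N + 1)) :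
    grassmannSuccEquiv N (grassmannSigma (N + 1) a) =
      OddExt.sigma (grassmannSigma N) (grassmannSuccEquiv N a) := by
  obtain ⟨x, rfl⟩ := (grassmannSuccEquiv N).symm.surjective a
  rw [AlgEquiv.apply_symm_apply, ← AlgEquiv.eq_symm_apply]
  change grassmannSigma (N + 1) (ExteriorAlgebra.map (consZero N) x.1 +
    newGen N * ExteriorAlgebra.map (consZero N) x.2) =
    ExteriorAlgebra.map (consZero N) (grassmannSigma N x.1) +
    newGen N * ExteriorAlgebra.map (consZero N) (-grassmannSigma N x.2)
  have : grassmannSigma (N + 1) (newGen N) = -newGen N := CliffordAlgebra.involute_ι _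
  rw [map_neg, map_add, map_mul, map_grassmannSigma, map_grassmannSigma, this, mul_neg, neg_mul]

lemma augmentation_sigma (a : Grassmann N) :
    augmentation N (grassmannSigma N a) = augmentation N a := by
  have h : (augmentation N).comp CliffordAlgebra.involute = augmentation N := by
    apply CliffordAlgebra.hom_ext
    ext m
    simp [augmentation, ExteriorAlgebra.algebraMapInv, ExteriorAlgebra.lift]
  exact DFunLike.congr_fun h a

lemma augmentation_succ (a : Grassmann (N + 1)) :
    augmentation N (grassmannSuccEquiv N a).1 = augmentation (N + 1) a := by
  have : ((augmentation N).comp (OddExt.fstHom _)).comp (toOddExtGrassmann N) =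
      augmentation (N + 1) := by
    apply ExteriorAlgebra.hom_ext
    refine LinearMap.ext fun m => ?_
    change augmentation N (toOddExtGrassmann N (ExteriorAlgebra.ι ℝ m)).1 =
      augmentation (N + 1) (ExteriorAlgebra.ι ℝ m)
    rw [toOddExtGrassmann_ι]
    change augmentation N (ExteriorAlgebra.ι ℝ (m ∘ Fin.succ)) = _
    simp [augmentation, ExteriorAlgebra.algebraMapInv]
  exact DFunLike.congr_fun this a

end Grassmann


/-! ### The local model -/

/-- `C ⊗ A[ξ] = (C ⊗ A)[ξ]`. -/
def OddExt.tensorEquiv (C : Type*) [CommRing C] [Algebra ℝ C] {A : Type*} [Ring A] [Algebra ℝ A]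
    (σ : A →ₐ[ℝ] A) :
    C ⊗[ℝ] OddExt σ ≃ₐ[ℝ] OddExt (Algebra.TensorProduct.map (AlgHom.id ℝ C) σ) :=
  have htmul : ∀ (a : C) (x : OddExt σ), TensorProduct.prodRight ℝ ℝ C A A (a ⊗ₜ x) =
    (a ⊗ₜ x.1, a ⊗ₜ x.2) := fun _ _ => rfl
  AlgEquiv.ofLinearEquiv
    (show C ⊗[ℝ] OddExt σ ≃ₗ[ℝ] OddExt (Algebra.TensorProduct.map (AlgHom.id ℝ C) σ) from
      TensorProduct.prodRight ℝ ℝ C A A)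
    (OddExt.ext rfl (TensorProduct.tmul_zero _ _))
    (fun x y => by
      induction x using TensorProduct.induction_on with
      | zero => rw [zero_mul, map_zero, zero_mul]
      | add a b ha hb => rw [add_mul, map_add, map_add, add_mul, ha, hb]
      | tmul a x =>
        induction y using TensorProduct.induction_on with
        | zero => rw [mul_zero, map_zero, mul_zero]
        | add a b ha hb => rw [mul_add, map_add, map_add, mul_add, ha, hb]
        | tmul b y =>
          rw [Algebra.TensorProduct.tmul_mul_tmul]
          refine OddExt.ext ?_ ?_
          · exact (Algebra.TensorProduct.tmul_mul_tmul a b x.1 y.1).symm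
          · change (a * b) ⊗ₜ (σ x.1 * y.2 + x.2 * y.1) =
              (a ⊗ₜ σ x.1) * (b ⊗ₜ y.2) + (a ⊗ₜ x.2) * (b ⊗ₜ y.1)
            rw [Algebra.TensorProduct.tmul_mul_tmul, Algebra.TensorProduct.tmul_mul_tmul,
              TensorProduct.tmul_add])

section LocalModel

variable {D : ℕ} {X : Type u} [TopologicalSpace X] [ChartedSpace (EuclideanSpace ℝ (Fin D)) X]
  {N : ℕ} {V W : Opens X}

/-- The parity involution of the local model. -/
def modelSigma (N : ℕ) (V : Opens X) : Model (D := D) N V →ₐ[ℝ] Model (D := D) N V :=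
  Algebra.TensorProduct.map (AlgHom.id ℝ _) (grassmannSigma N)

@[simp] lemma modelSigma_tmul (h : Smooth (D := D) V) (a : Grassmann N) :
    modelSigma N V (h ⊗ₜ a) = h ⊗ₜ grassmannSigma N a := rfl

@[simp] lemma modelRes_tmul (i : W ≤ V) (h : Smooth (D := D) V) (a : Grassmann N) :
    modelRes N i (h ⊗ₜ a) = smoothRes i h ⊗ₜ a := rfl

lemma isParityInvolution_modelSigma :
    IsParityInvolution (modelSigma (D := D) N V).toLinearMap (modelParity N V) := by
  have inv : ∀ f, modelSigma (D := D) N V (modelSigma N V f) = f := by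
    intro f
    induction f using TensorProduct.induction_on with
    | zero => simp
    | add a b ha hb => rw [map_add, map_add, ha, hb]
    | tmul a b => rw [modelSigma_tmul, modelSigma_tmul, CliffordAlgebra.involute_involute]
  refine ⟨inv, fun k f => ⟨?_, fun hf => ?_⟩⟩
  · rintro ⟨t, rfl⟩
    induction t using TensorProduct.induction_on with
    | zero => simp
    | add a b ha hb => rw [map_add, map_add, ha, hb, smul_add]
    | tmul a b =>
      change a ⊗ₜ grassmannSigma N b = sgn k • (a ⊗ₜ (b : Grassmann N))
      have := (isParityInvolution_grassmannSigma.mem_iff k (b : Grassmann N)).1 b.2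
      rw [AlgHom.toLinearMap_apply] at this
      rw [this, TensorProduct.tmul_smul]
  -- The projection onto parity `k` lands in `modelParity`, as pure tensors show, and it fixes every
  -- eigenvector for the sign `(-1)^k`.
  · have key : ∀ f : Model (D := D) N V,
        (2⁻¹ : ℝ) • (f + sgn k • modelSigma N V f) ∈ modelParity N V k := by
      intro f
      induction f using TensorProduct.induction_on with
      | zero => simp
      | add a b ha hb =>
        convert! Submodule.add_mem _ ha hb using 1
        rw [map_add]
        module
      | tmul a b =>
        refine ⟨a ⊗ₜ ⟨_, isParityInvolution_grassmannSigma.part_mem k b⟩, ?_⟩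
        simp [TensorProduct.tmul_add]
    have := key f
    rw [AlgHom.toLinearMap_apply] at hf
    rw [hf, smul_smul, sgn_mul_self, one_smul, ← two_smul ℝ f, smul_smul] at this
    simpa using this

lemma modelRes_modelSigma (i : W ≤ V) (f : Model (D := D) N V) :
    modelRes N i (modelSigma N V f) = modelSigma N W (modelRes N i f) := by
  induction f using TensorProduct.induction_on with
  | zero => simp
  | add a b ha hb => simp only [map_add, ha, hb]
  | tmul a b => rfl

/-- Supercommutativity of the local model. -/
lemma model_supercomm {k : ZMod 2} {g : Model (D := D) N V} (hg : g ∈ modelParity N V k)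
    (f : Model (D := D) N V) : f * g = g * (modelSigma N V ^ k.val) f := by
  have hp : ∀ (a : Smooth (D := D) V) (b : Grassmann N),
      (modelSigma N V ^ k.val) (a ⊗ₜ b) = a ⊗ₜ (grassmannSigma N ^ k.val) b := by
    intro a b
    have hone : (1 : ZMod 2).val = 1 := rfl
    rcases zmod_two_cases k with rfl | rfl
    · simp
    · rw [hone, pow_one, pow_one, modelSigma_tmul]
  obtain ⟨t, rfl⟩ := hg
  induction t using TensorProduct.induction_on with
  | zero => simp
  | add a b ha hb => rw [map_add, mul_add, add_mul, ha, hb]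
  | tmul a b =>
    induction f using TensorProduct.induction_on with
    | zero => simp
    | add a b ha hb => rw [map_add, mul_add, add_mul, ha, hb]
    | tmul a' b' =>
      rw [hp, LinearMap.lTensor_tmul, Algebra.TensorProduct.tmul_mul_tmul,
        Algebra.TensorProduct.tmul_mul_tmul, mul_comm a a', Submodule.subtype_apply,
        grassmann_supercomm b.2]

/-- Drop the anticommuting variables. -/
def modelBody (N : ℕ) (V : Opens X) : Model (D := D) N V →ₐ[ℝ] Smooth (D := D) V :=
  Algebra.TensorProduct.lift (AlgHom.id ℝ _) ((Algebra.ofId ℝ _).comp (augmentation N))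
    (fun _ _ => mul_comm _ _)

lemma modelBody_tmul (a : Smooth (D := D) V) (b : Grassmann N) :
    modelBody N V (a ⊗ₜ b) = a * algebraMap ℝ _ (augmentation N b) := rfl

lemma modelEval_eq_body (p : X) (hp : p ∈ V) (f : Model (D := D) N V) :
    modelEval N p hp f = modelBody N V f ⟨p, hp⟩ := by
  induction f using TensorProduct.induction_on with
  | zero => rw [map_zero, map_zero]; rfl
  | add a b ha hb => rw [map_add, map_add, ha, hb]; rfl
  | tmul a b => rfl

/-- `C^∞(V) ⊗ Λ_{N+1} = (C^∞(V) ⊗ Λ_N)[ξ]`. -/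
def modelSuccEquiv (N : ℕ) (V : Opens X) :
    Model (D := D) (N + 1) V ≃ₐ[ℝ] OddExt (modelSigma (D := D) N V) :=
  (Algebra.TensorProduct.congr AlgEquiv.refl (grassmannSuccEquiv N)).trans
    (OddExt.tensorEquiv (Smooth (D := D) V) (grassmannSigma N))

lemma modelSuccEquiv_tmul (a : Smooth (D := D) V) (b : Grassmann (N + 1)) :
    modelSuccEquiv N V (a ⊗ₜ b) = ((a ⊗ₜ (grassmannSuccEquiv N b).1,
      a ⊗ₜ (grassmannSuccEquiv N b).2) : Model (D := D) N V × Model (D := D) N V) := rfl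

lemma modelSuccEquiv_sigma (f : Model (D := D) (N + 1) V) :
    modelSuccEquiv N V (modelSigma (N + 1) V f) =
      OddExt.sigma (modelSigma N V) (modelSuccEquiv N V f) := by
  induction f using TensorProduct.induction_on with
  | zero => simp
  | add a b ha hb => simp only [map_add, ha, hb]
  | tmul a b =>
    have h := grassmannSuccEquiv_sigma b
    have h1 : (grassmannSuccEquiv N (grassmannSigma (N + 1) b)).1 =
      grassmannSigma N (grassmannSuccEquiv N b).1 := congrArg Prod.fst h
    have h2 : (grassmannSuccEquiv N (grassmannSigma (N + 1) b)).2 =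
      -grassmannSigma N (grassmannSuccEquiv N b).2 := congrArg Prod.snd h
    rw [modelSigma_tmul, modelSuccEquiv_tmul, modelSuccEquiv_tmul, h1, h2]
    refine OddExt.ext rfl ?_
    exact TensorProduct.tmul_neg _ _

lemma modelSuccEquiv_res (i : W ≤ V) (f : Model (D := D) (N + 1) V) :
    modelSuccEquiv N W (modelRes (N + 1) i f) =
      OddExt.map (modelRes N i) (modelRes_modelSigma i) (modelSuccEquiv N V f) := by
  induction f using TensorProduct.induction_on with
  | zero => simp
  | add a b ha hb => simp only [map_add, ha, hb]
  | tmul a b =>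
    rw [modelRes_tmul, modelSuccEquiv_tmul, modelSuccEquiv_tmul]
    rfl

lemma modelBody_succ (f : Model (D := D) (N + 1) V) :
    modelBody N V (modelSuccEquiv N V f).1 = modelBody (N + 1) V f := by
  induction f using TensorProduct.induction_on with
  | zero => simp
  | add a b ha hb => simp only [map_add, OddExt.add_fst, ha, hb]
  | tmul a b =>
    rw [modelSuccEquiv_tmul, modelBody_tmul, modelBody_tmul, ← augmentation_succ b]

lemma grassmann_zero_eq (a : Grassmann 0) : a = algebraMap ℝ _ (augmentation 0 a) := by
  have : (AlgHom.id ℝ (Grassmann 0)) = (Algebra.ofId ℝ _).comp (augmentation 0) := by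
    apply ExteriorAlgebra.hom_ext
    refine LinearMap.ext fun m => ?_
    rw [Subsingleton.elim m 0, map_zero, map_zero]
  exact DFunLike.congr_fun this a

/-- Induction on the number of odd generators: by the case `N`, some power of an element of `A[ξ]`
has the form `ξ b`, and the square of `ξ b` is zero. -/
lemma isNilpotent_of_modelBody_eq_zero (f : Model (D := D) N V) (hf : modelBody N V f = 0) :
    IsNilpotent f := by
  induction N with
  | zero =>
    have : ∀ f : Model (D := D) 0 V, f = modelBody 0 V f ⊗ₜ 1 := by
      intro f
      induction f using TensorProduct.induction_on with
      | zero => simp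
      | add a b ha hb => rw [map_add, TensorProduct.add_tmul, ← ha, ← hb]
      | tmul a b =>
        conv_lhs => rw [grassmann_zero_eq b]
        rw [modelBody_tmul, mul_comm, ← Algebra.smul_def, TensorProduct.smul_tmul,
          Algebra.algebraMap_eq_smul_one]
    rw [this f, hf, TensorProduct.zero_tmul]
    exact IsNilpotent.zero
  | succ N ih =>
    rw [← modelBody_succ] at hf
    obtain ⟨k, hk⟩ := ih _ hf
    set x := modelSuccEquiv N V f with hx
    have h1 : (x ^ k).1 = 0 := by
      have := map_pow (OddExt.fstHom (modelSigma (D := D) N V)) x k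
      exact this.trans hk
    have h2 : x ^ k * x ^ k = 0 := by
      ext
      · simp [h1]
      · simp [h1]
    refine ⟨k + k, ?_⟩
    rw [← map_eq_zero_iff (modelSuccEquiv N V) (modelSuccEquiv N V).injective, map_pow, pow_add,
      ← hx, h2]

/-- The difference between `f` and its body is nilpotent, and the body is a central unit. -/
lemma isUnit_of_isUnit_modelBody (f : Model (D := D) N V) (hf : IsUnit (modelBody N V f)) :
    IsUnit f := by
  set u : Model (D := D) N V := modelBody N V f ⊗ₜ 1
  have hu : IsUnit u := hf.map (Algebra.TensorProduct.includeLeft (R := ℝ) (S := ℝ)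
    (A := Smooth (D := D) V) (B := Grassmann N))
  have hn : IsNilpotent (f - u) := by
    apply isNilpotent_of_modelBody_eq_zero
    rw [map_sub, modelBody_tmul, map_one, map_one, mul_one, sub_self]
  have hc : Commute (f - u) u := by
    have : ∀ g : Model (D := D) N V, Commute g u := by
      intro g
      induction g using TensorProduct.induction_on with
      | zero => exact Commute.zero_left _
      | add a b ha hb => exact ha.add_left hb
      | tmul a b =>
        rw [commute_iff_eq, Algebra.TensorProduct.tmul_mul_tmul,
          Algebra.TensorProduct.tmul_mul_tmul, mul_comm, mul_one, one_mul]
    exact this _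
  have := hn.isUnit_add_left_of_commute hu hc
  rwa [add_sub_cancel] at this

lemma modelBody_res (i : W ≤ V) (f : Model (D := D) N V) :
    modelBody N W (modelRes N i f) = smoothRes i (modelBody N V f) := by
  induction f using TensorProduct.induction_on with
  | zero => simp
  | add a b ha hb => simp only [map_add, ha, hb]
  | tmul a b => rfl

lemma exists_isUnit_modelRes (f : Model (D := D) N V) (p : X) (hp : p ∈ V)
    (hf : modelEval N p hp f ≠ 0) :
    ∃ (W : Opens X) (i : W ≤ V), p ∈ W ∧ IsUnit (modelRes N i f) := by
  have hcont : Continuous (modelBody N V f) := (modelBody N V f).contMDiff.continuous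
  have ho : IsOpen {x : V | modelBody N V f x ≠ 0} := isOpen_ne_fun hcont continuous_const
  let W : Opens X := ⟨Subtype.val '' {x : V | modelBody N V f x ≠ 0}, V.2.isOpenMap_subtype_val _ ho⟩
  have hWV : W ≤ V := by
    rintro _ ⟨x, -, rfl⟩
    exact x.2
  refine ⟨W, hWV, ⟨⟨p, hp⟩, by rwa [modelEval_eq_body] at hf, rfl⟩, ?_⟩
  apply isUnit_of_isUnit_modelBody
  rw [modelBody_res]
  set g := smoothRes hWV (modelBody N V f) with hg
  have hne : ∀ x : W, g x ≠ 0 := by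
    rintro ⟨_, x, hx, rfl⟩
    exact hx
  have hsm : ContMDiff (𝓡 D) 𝓘(ℝ, ℝ) ∞ (fun x : W => (g x)⁻¹) := by
    intro x
    exact (g.contMDiff x).inv₀ (hne x)
  refine IsUnit.of_mul_eq_one ⟨_, hsm⟩ ?_
  ext x
  exact mul_inv_cancel₀ (hne x)

/-- The coefficients of an element of `C^∞(V) ⊗ Λ_N`, evaluated at a point. -/
def modelCoeff (N : ℕ) (p : X) (hp : p ∈ V) : Model (D := D) N V →ₐ[ℝ] Grassmann N :=
  Algebra.TensorProduct.lift ((Algebra.ofId ℝ _).comp (smoothEval p hp)) (AlgHom.id ℝ _)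
    (fun a b => Algebra.commute_algebraMap_left (smoothEval p hp a) (b : Grassmann N))

lemma modelCoeff_tmul (p : X) (hp : p ∈ V) (a : Smooth (D := D) V) (b : Grassmann N) :
    modelCoeff N p hp (a ⊗ₜ b) = a ⟨p, hp⟩ • b :=
  (Algebra.smul_def (a ⟨p, hp⟩) b).symm

lemma augmentation_modelCoeff (p : X) (hp : p ∈ V) (f : Model (D := D) N V) :
    augmentation N (modelCoeff N p hp f) = modelEval N p hp f := by
  induction f using TensorProduct.induction_on with
  | zero => simp
  | add a b ha hb => simp only [map_add, ha, hb]
  | tmul a b =>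
    rw [modelCoeff_tmul, map_smul]
    rfl

lemma modelCoeff_sigma (p : X) (hp : p ∈ V) (f : Model (D := D) N V) :
    modelCoeff N p hp (modelSigma N V f) = grassmannSigma N (modelCoeff N p hp f) := by
  induction f using TensorProduct.induction_on with
  | zero => simp
  | add a b ha hb => simp only [map_add, ha, hb]
  | tmul a b => rw [modelSigma_tmul, modelCoeff_tmul, modelCoeff_tmul, map_smul]

/-- In a basis of the Grassmann algebra `f` has finitely many coefficient functions, and linear
independence makes each of them vanish pointwise. -/
lemma model_eq_zero_of_modelCoeff (f : Model (D := D) N V)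
    (hf : ∀ p (hp : p ∈ V), modelCoeff N p hp f = 0) : f = 0 := by
  classical
  let b := Module.Basis.ofVectorSpace ℝ (Grassmann N)
  obtain ⟨c, rfl⟩ := TensorProduct.eq_repr_basis_right b f
  suffices h : c = 0 by simp [h]
  ext i x
  have h := hf x x.2
  rw [Finsupp.sum, map_sum] at h
  simp only [modelCoeff_tmul] at h
  by_cases hi : i ∈ c.support
  · exact linearIndependent_iff'.1 b.linearIndependent c.support (fun i => c i x) h i hi
  · rw [Finsupp.notMem_support_iff.1 hi]
    rfl

end LocalModel


/-! ### Sections -/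

section Sheaf

variable {X : SheafedSpace.{u + 1, u, u} (AlgCat.{u} ℝ)}

lemma section_ext {U : Opens X} {f g : Sections X U}
    (h : ∀ p ∈ U, ∃ (W : Opens X) (i : W ≤ U), p ∈ W ∧ sectionRes X i f = sectionRes X i g) :
    f = g := by
  choose W i hW e using h
  refine X.sheaf.eq_of_locally_eq' (fun p : U => W p p.2) U (fun p => homOfLE (i p p.2)) ?_ f g
    (fun p => e p p.2)
  intro p hp
  exact Opens.mem_iSup.2 ⟨⟨p, hp⟩, hW p hp⟩

lemma section_glue {ι : Type*} {U : ι → Opens X} {V : Opens X} (hU : ∀ i, U i ≤ V)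
    (hV : V ≤ iSup U) (s : ∀ i, Sections X (U i))
    (h : ∀ i j, sectionRes X (inf_le_left : U i ⊓ U j ≤ U i) (s i) =
      sectionRes X (inf_le_right : U i ⊓ U j ≤ U j) (s j)) :
    ∃ t : Sections X V, ∀ i, sectionRes X (hU i) t = s i :=
  (X.sheaf.existsUnique_gluing' U V (fun i => homOfLE (hU i)) hV s h).exists

lemma sectionRes_self {U : Opens X} (h : U ≤ U) (f : Sections X U) : sectionRes X h f = f := by
  have := X.presheaf.map_id (op U)
  exact ConcreteCategory.congr_hom this f

end Sheaf

namespace Supermanifold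

/-- The parity involution of the structure sheaf. -/
def sigma (M : Supermanifold.{u}) (U : Opens M.space) :
    Sections M.space U →ₐ[ℝ] Sections M.space U :=
  parityInvolution (M.parity U) (M.isInternal U)

variable {M N : Supermanifold.{u}}

lemma isParityInvolution_sigma (U : Opens M.space) :
    IsParityInvolution (M.sigma U).toLinearMap (M.parity U) :=
  isParityInvolution_parityInvolution _ _

@[simp] lemma sigma_sigma (U : Opens M.space) (f : Sections M.space U) :
    M.sigma U (M.sigma U f) = f := (isParityInvolution_sigma U).involutive f

lemma mem_parity_iff {U : Opens M.space} {k : ZMod 2} {f : Sections M.space U} :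
    f ∈ M.parity U k ↔ M.sigma U f = sgn k • f := (isParityInvolution_sigma U).mem_iff k f

lemma sigma_res {U V : Opens M.space} (h : U ≤ V) (f : Sections M.space V) :
    sectionRes M.space h (M.sigma V f) = M.sigma U (sectionRes M.space h f) := by
  have := (isParityInvolution_sigma V).comm_of_parity (isParityInvolution_sigma U)
    (T := (sectionRes M.space h).toLinearMap) (k := 0)
    (fun l f hf => by rw [zero_add]; exact M.res_parity h l f hf) f
  rw [sgn_zero, one_smul] at this
  exact this.symm

lemma comorphism_sigma (φ : M ⟶ N) (U : Opens N.space) (f : Sections N.space U) :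
    comorphism (Hom.map φ) U (N.sigma U f) = M.sigma _ (comorphism (Hom.map φ) U f) := by
  have := (isParityInvolution_sigma U).comm_of_parity (isParityInvolution_sigma _)
    (T := (comorphism (Hom.map φ) U).toLinearMap) (k := 0)
    (fun l f hf => by rw [zero_add]; exact φ.parity U l f hf) f
  rw [sgn_zero, one_smul] at this
  exact this.symm

lemma pullback_sigma (φ : M ⟶ N) (f : N.Functions) :
    pullback φ (N.sigma ⊤ f) = M.sigma ⊤ (pullback φ f) := comorphism_sigma φ ⊤ f

end Supermanifold

lemma Trivialization.equiv_sigma {M : Supermanifold.{u}} {U : Opens M.space}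
    (t : Trivialization (D := M.evenDim) M.space M.parity M.oddDim U) (V : Opens M.space)
    (hV : V ≤ U) (f : Sections M.space V) :
    t.equiv V hV (M.sigma V f) = modelSigma M.oddDim V (t.equiv V hV f) := by
  have := (Supermanifold.isParityInvolution_sigma V).comm_of_parity isParityInvolution_modelSigma
    (T := (t.equiv V hV).toLinearMap) (k := 0)
    (fun l f hf => by rw [zero_add]; exact (t.equiv_parity V hV l f).1 hf) f
  rw [sgn_zero, one_smul] at this
  exact this.symm

/-! ### Supercommutativity of the structure sheaf, and uniqueness of values at points -/

namespace Supermanifold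

variable {M N : Supermanifold.{u}}

/-- Supercommutativity is not an axiom of `Supermanifold`; it is inherited from the Grassmann
algebra through the local trivializations. The power of σ expresses both parities in one formula. -/
lemma mul_eq_mul_sigma {U : Opens M.space} {k : ZMod 2} {g : Sections M.space U}
    (hg : g ∈ M.parity U k) (f : Sections M.space U) : f * g = g * (M.sigma U ^ k.val) f := by
  apply section_ext
  intro p hp
  refine ⟨U ⊓ M.trivDomain p, inf_le_left, ⟨hp, M.mem_trivDomain p⟩, ?_⟩
  apply ((M.triv p).equiv _ inf_le_right).injective
  have hg' := ((M.triv p).equiv_parity (U ⊓ M.trivDomain p) inf_le_right k _).1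
    (M.res_parity inf_le_left _ _ hg)
  have hs : ∀ f : Sections M.space U,
      (M.triv p).equiv (U ⊓ M.trivDomain p) inf_le_right
        (sectionRes M.space inf_le_left ((M.sigma U ^ k.val) f)) =
      (modelSigma _ _ ^ k.val) ((M.triv p).equiv (U ⊓ M.trivDomain p) inf_le_right
        (sectionRes M.space inf_le_left f)) := by
    have hone : (1 : ZMod 2).val = 1 := rfl
    intro f
    rcases zmod_two_cases k with rfl | rfl
    · simp
    · rw [hone, pow_one, pow_one, sigma_res, Trivialization.equiv_sigma]
  rw [map_mul, map_mul, map_mul, map_mul, hs, model_supercomm hg']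

lemma exists_isUnit_res {U : Opens M.space} (f : Sections M.space U) (p : M.space) (hp : p ∈ U)
    (hf : M.value p U hp f ≠ 0) :
    ∃ (W : Opens M.space) (i : W ≤ U), p ∈ W ∧ IsUnit (sectionRes M.space i f) := by
  obtain ⟨W, i, hpW, hu⟩ := exists_isUnit_modelRes (D := M.evenDim) _ p
    (show p ∈ U ⊓ M.trivDomain p from ⟨hp, M.mem_trivDomain p⟩) hf
  refine ⟨W, i.trans inf_le_left, hpW, ?_⟩
  have h := (M.triv p).equiv_res _ _ inf_le_right i (sectionRes M.space inf_le_left f)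
  rw [sectionRes_sectionRes] at h
  have hu' : IsUnit ((M.triv p).equiv W (i.trans inf_le_right)
      (sectionRes M.space (i.trans inf_le_left) f)) := by
    rw [h]; exact hu
  exact (MulEquiv.isUnit_map ((M.triv p).equiv W (i.trans inf_le_right))).1 hu'

/-- An algebra homomorphism to `ℝ` which does not vanish on the sections without zero at `p` is the
evaluation at `p`. -/
lemma eq_value {p : M.space} {U : Opens M.space} (hp : p ∈ U) (χ : Sections M.space U →ₐ[ℝ] ℝ)
    (h : ∀ (f : Sections M.space U) (W : Opens M.space) (i : W ≤ U), p ∈ W →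
      IsUnit (sectionRes M.space i f) → χ f ≠ 0) (f : Sections M.space U) :
    χ f = M.value p U hp f := by
  by_contra hne
  -- If the two values differed, `f - χ(f)` would be invertible near `p`, although `χ` kills it.
  obtain ⟨W, i, hW, hu⟩ := exists_isUnit_res (f - algebraMap ℝ _ (χ f)) p hp (by
    rw [map_sub, AlgHom.commutes]
    exact sub_ne_zero.2 (Ne.symm hne))
  refine h _ W i hW hu ?_
  rw [map_sub, AlgHom.commutes]
  exact sub_self _

lemma value_ne_zero_of_isUnit_res {p : M.space} {U W : Opens M.space} (i : W ≤ U) (hp : p ∈ W)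
    {f : Sections M.space U} (hu : IsUnit (sectionRes M.space i f)) :
    M.value p U (i hp) f ≠ 0 := by
  rw [← M.value_res p i hp]
  exact (hu.map (M.value p W hp)).ne_zero

lemma comorphism_res {X Y : SheafedSpace.{u + 1, u, u} (AlgCat.{u} ℝ)} (φ : X ⟶ Y)
    {U V : Opens Y} (h : U ≤ V) (f : Sections Y V) :
    comorphism φ U (sectionRes Y h f) =
      sectionRes X (fun _ hx => h hx : (Opens.map φ.hom.base).obj U ≤
        (Opens.map φ.hom.base).obj V) (comorphism φ V f) :=
  ConcreteCategory.congr_hom (φ.hom.c.naturality (homOfLE h).op) f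

/-- Comorphisms commute with restriction, so the composite is nonzero on sections invertible near
the image point, and `eq_value` identifies it. Compatibility with values therefore need not be
demanded of a morphism. -/
lemma value_comorphism (φ : M ⟶ N) (p : M.space) {U : Opens N.space}
    (hp : (Hom.map φ).hom.base p ∈ U) (f : Sections N.space U) :
    M.value p ((Opens.map (Hom.map φ).hom.base).obj U) hp (comorphism (Hom.map φ) U f) =
      N.value ((Hom.map φ).hom.base p) U hp f := by
  refine eq_value hp ((M.value p ((Opens.map (Hom.map φ).hom.base).obj U) hp).comp
    (comorphism (Hom.map φ) U)) ?_ f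
  intro f W i hW hu
  have hu' := hu.map (comorphism (Hom.map φ) W)
  rw [comorphism_res] at hu'
  exact value_ne_zero_of_isUnit_res (M := M)
    (U := (Opens.map (Hom.map φ).hom.base).obj U) (W := (Opens.map (Hom.map φ).hom.base).obj W)
    _ hW hu'

lemma evalAt_pullback (φ : M ⟶ N) (p : M.space) (f : N.Functions) :
    M.evalAt p (pullback φ f) = N.evalAt ((Hom.map φ).hom.base p) f :=
  value_comorphism φ p (U := ⊤) trivial f

lemma evalAt_sigma (p : M.space) (f : M.Functions) : M.evalAt p (M.sigma ⊤ f) = M.evalAt p f := by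
  refine eq_value (U := ⊤) trivial ((M.evalAt p).comp (M.sigma ⊤)) ?_ f
  intro f W i hW hu
  have hu' := hu.map (M.sigma W)
  rw [← sigma_res] at hu'
  exact value_ne_zero_of_isUnit_res _ hW hu'

/-- The value can be computed in any trivialization. -/
lemma value_eq_modelEval {U : Opens M.space}
    (t : Trivialization (D := M.evenDim) M.space M.parity M.oddDim U) {V : Opens M.space}
    (hV : V ≤ U) (p : M.space) (hp : p ∈ V) (f : Sections M.space V) :
    modelEval M.oddDim p hp (t.equiv V hV f) = M.value p V hp f := by
  refine eq_value hp ((modelEval M.oddDim p hp).comp (t.equiv V hV).toAlgHom) ?_ f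
  intro f W i hW hu
  have h := t.equiv_res V W hV i f
  have h2 := modelEval_modelRes M.oddDim i p hW (t.equiv V hV f)
  change modelEval M.oddDim p hp (t.equiv V hV f) ≠ 0
  rw [← h2, ← h]
  exact ((hu.map (t.equiv W (i.trans hV))).map (modelEval M.oddDim p hW)).ne_zero

/-! ### Cut-off functions -/

/-- The vanishing set is given as an open `W'` that covers the space together with `U`, since
extension by zero will be gluing over these two sets. -/
lemma exists_smooth_cutoff (p : M.space) (U : Opens M.space) (hp : p ∈ U) :
    ∃ χ : C^∞⟮𝓡 M.evenDim, M.space; 𝓘(ℝ, ℝ), ℝ⟯,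
      (∃ W : Opens M.space, p ∈ W ∧ ∀ x ∈ W, χ x = 1) ∧
      (∃ W' : Opens M.space, U ⊔ W' = ⊤ ∧ ∀ x ∈ W', χ x = 0) := by
  obtain ⟨B, -, hB⟩ := (SmoothBumpFunction.nhds_basis_tsupport (I := 𝓡 M.evenDim) p).mem_iff.1
    (U.2.mem_nhds hp)
  refine ⟨⟨B, B.contMDiff⟩, ?_, ⟨(tsupport B)ᶜ, (isClosed_tsupport B).isOpen_compl⟩, ?_, ?_⟩
  · obtain ⟨W, hW, ho, hpW⟩ := eventually_nhds_iff.1 B.eventuallyEq_one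
    exact ⟨⟨W, ho⟩, hpW, fun x hx => hW x hx⟩
  · rw [eq_top_iff]
    intro x _
    by_cases hx : x ∈ tsupport B
    · exact Or.inl (hB hx)
    · exact Or.inr hx
  · intro x hx
    exact image_eq_zero_of_notMem_tsupport hx

lemma section_glue₂ {U V : Opens M.space} (hUV : U ⊔ V = ⊤) (s : Sections M.space U)
    (t : Sections M.space V)
    (h : sectionRes M.space (inf_le_left : U ⊓ V ≤ U) s =
      sectionRes M.space (inf_le_right : U ⊓ V ≤ V) t) :
    ∃ f : M.Functions, sectionRes M.space le_top f = s ∧ sectionRes M.space le_top f = t := by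
  obtain ⟨f, hf⟩ := section_glue (X := M.space) (U := fun b : Bool => if b then U else V) (V := ⊤)
    (fun _ => le_top) (by
      rw [← hUV]
      exact sup_le (le_iSup (fun b : Bool => if b then U else V) true)
        (le_iSup (fun b : Bool => if b then U else V) false))
    (fun b => match b with
      | true => s
      | false => t) (by
      rintro (_ | _) (_ | _)
      · rfl
      · have h2 := congrArg (sectionRes M.space (le_of_eq (inf_comm V U))) h
        rw [sectionRes_sectionRes, sectionRes_sectionRes] at h2
        exact h2.symm
      · exact h
      · rfl)
  exact ⟨f, hf true, hf false⟩

/-- Cut-off superfunctions. -/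
lemma exists_cutoff (p : M.space) (U : Opens M.space) (hp : p ∈ U) :
    ∃ b : M.Functions, M.sigma ⊤ b = b ∧
      (∃ W : Opens M.space, p ∈ W ∧ sectionRes M.space (le_top : W ≤ ⊤) b = 1) ∧
      (∃ W' : Opens M.space, U ⊔ W' = ⊤ ∧ sectionRes M.space (le_top : W' ≤ ⊤) b = 0) := by
  obtain ⟨χ, ⟨W, hpW, hW⟩, W', hW', hW0⟩ := exists_smooth_cutoff p (U ⊓ M.trivDomain p)
    ⟨hp, M.mem_trivDomain p⟩
  set U₀ := U ⊓ M.trivDomain p with hU₀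
  let χ₀ : ∀ V : Opens M.space, Smooth (D := M.evenDim) V := fun V =>
    ⟨fun x => χ x, χ.contMDiff.comp contMDiff_subtype_val⟩
  let s := ((M.triv p).equiv U₀ inf_le_right).symm (χ₀ U₀ ⊗ₜ 1)
  have hs : ∀ (V : Opens M.space) (h : V ≤ U₀),
      (M.triv p).equiv V (h.trans inf_le_right) (sectionRes M.space h s) = χ₀ V ⊗ₜ 1 := by
    intro V h
    have := (M.triv p).equiv_res U₀ V inf_le_right h s
    rw [this, AlgEquiv.apply_symm_apply, modelRes_tmul]
    rfl
  obtain ⟨b, hb1, hb2⟩ := section_glue₂ hW' s 0 (by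
    apply ((M.triv p).equiv (U₀ ⊓ W') (inf_le_left.trans inf_le_right)).injective
    rw [hs, map_zero, map_zero]
    have : χ₀ (U₀ ⊓ W') = 0 := by
      ext x
      exact hW0 x x.2.2
    rw [this, TensorProduct.zero_tmul])
  refine ⟨b, ?_, ⟨W ⊓ U₀, ⟨hpW, hp, M.mem_trivDomain p⟩, ?_⟩, W', ?_, hb2⟩
  · apply section_ext
    intro x _
    have hx : x ∈ U₀ ⊔ W' := by rw [hW']; trivial
    rcases hx with hx | hx
    · refine ⟨U₀, le_top, hx, ?_⟩
      rw [sigma_res, hb1]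
      apply ((M.triv p).equiv U₀ inf_le_right).injective
      rw [Trivialization.equiv_sigma, AlgEquiv.apply_symm_apply, modelSigma_tmul, map_one]
    · refine ⟨W', le_top, hx, ?_⟩
      rw [sigma_res, hb2, map_zero]
  · apply ((M.triv p).equiv (W ⊓ U₀) (inf_le_right.trans inf_le_right)).injective
    have h1 := hs (W ⊓ U₀) inf_le_right
    rw [← hb1, sectionRes_sectionRes] at h1
    rw [h1, map_one]
    have : χ₀ (W ⊓ U₀) = 1 := by
      ext x
      exact hW x x.2.1
    rw [this]
    rfl
  · rw [eq_top_iff, ← hW']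
    exact sup_le_sup_right inf_le_left _

/-- Every section agrees near a given point with a global superfunction. -/
lemma exists_extension {U : Opens M.space} (s : Sections M.space U) (p : M.space) (hp : p ∈ U) :
    ∃ (f : M.Functions) (W : Opens M.space) (i : W ≤ U), p ∈ W ∧
      sectionRes M.space le_top f = sectionRes M.space i s := by
  obtain ⟨b, -, ⟨W, hpW, hW⟩, W', hUW', hW'⟩ := exists_cutoff p U hp
  -- The product `b s`, extended by zero; it agrees with `s` where `b = 1`.
  obtain ⟨f, hf, -⟩ := section_glue₂ hUW' (sectionRes M.space le_top b * s) 0 (by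
    have h0 := congrArg (sectionRes M.space (inf_le_right : U ⊓ W' ≤ W')) hW'
    rw [sectionRes_sectionRes, map_zero] at h0
    rw [map_mul, sectionRes_sectionRes, h0, zero_mul, map_zero])
  refine ⟨f, W ⊓ U, inf_le_right, ⟨hpW, hp⟩, ?_⟩
  have h1 := congrArg (sectionRes M.space (inf_le_left : W ⊓ U ≤ W)) hW
  rw [sectionRes_sectionRes, map_one] at h1
  have h2 := congrArg (sectionRes M.space (inf_le_right : W ⊓ U ≤ U)) hf
  rw [sectionRes_sectionRes, map_mul, sectionRes_sectionRes, h1, one_mul] at h2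
  exact h2

/-- Every section of parity `k` agrees near a given point with a global superfunction of
parity `k`. -/
lemma exists_extension_parity {U : Opens M.space} {k : ZMod 2} (s : Sections M.space U)
    (hs : s ∈ M.parity U k) (p : M.space) (hp : p ∈ U) :
    ∃ f ∈ M.parity ⊤ k, ∃ (W : Opens M.space) (i : W ≤ U), p ∈ W ∧
      sectionRes M.space le_top f = sectionRes M.space i s := by
  obtain ⟨f, W, i, hpW, hf⟩ := exists_extension s p hp
  -- Projecting an arbitrary extension onto parity `k` does not change its restriction to `W`,
  -- because `s` already has that parity.
  refine ⟨_, (isParityInvolution_sigma ⊤).part_mem k f, W, i, hpW, ?_⟩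
  rw [AlgHom.toLinearMap_apply, map_smul, map_add, map_smul, sigma_res, hf, ← sigma_res,
    mem_parity_iff.1 hs, map_smul, smul_smul, sgn_mul_self, one_smul, ← two_smul ℝ, smul_smul]
  norm_num

end Supermanifold


namespace Supermanifold

variable {M N : Supermanifold.{u}}

/-! ### Morphisms and their pullbacks of superfunctions -/

@[simp] lemma pullback_id (f : M.Functions) : pullback (𝟙 M) f = f := rfl

@[simp] lemma pullback_comp {L : Supermanifold.{u}} (φ : L ⟶ M) (ψ : M ⟶ N) (f : N.Functions) :
    pullback (φ ≫ ψ) f = pullback φ (pullback ψ f) := rfl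

lemma evalAt_eq_of_res {p : M.space} {W : Opens M.space} (hp : p ∈ W) {f g : M.Functions}
    (h : sectionRes M.space (le_top : W ≤ ⊤) f = sectionRes M.space (le_top : W ≤ ⊤) g) :
    M.evalAt p f = M.evalAt p g := by
  have h2 := congrArg (M.value p W hp) h
  rwa [M.value_res, M.value_res] at h2

lemma exists_evalAt_ne {p q : M.space} (hpq : p ≠ q) :
    ∃ f : M.Functions, M.evalAt p f ≠ M.evalAt q f := by
  obtain ⟨b, -, ⟨W, hpW, hW⟩, W', hUW, hW'⟩ :=
    exists_cutoff p ⟨{q}ᶜ, isOpen_compl_singleton⟩ (by simpa using hpq)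
  have hq : q ∈ W' := by
    have : q ∈ (⟨{q}ᶜ, isOpen_compl_singleton⟩ : Opens M.space) ⊔ W' := by rw [hUW]; trivial
    rcases this with h | h
    · exact absurd rfl h
    · exact h
  refine ⟨b, ?_⟩
  rw [evalAt_eq_of_res hpW (hW.trans (map_one _).symm),
    evalAt_eq_of_res hq (hW'.trans (map_zero _).symm), map_one, map_zero]
  exact one_ne_zero

/-- A morphism is determined by the pullback of global superfunctions. -/
lemma hom_ext_pullback {φ ψ : M ⟶ N} (h : ∀ f, pullback φ f = pullback ψ f) : φ = ψ := by
  -- Superfunctions separate points, so their pullbacks determine the underlying map.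
  have hb : (Hom.map φ).hom.base = (Hom.map ψ).hom.base := by
    ext x
    by_contra hne
    obtain ⟨f, hf⟩ := exists_evalAt_ne hne
    rw [← evalAt_pullback, ← evalAt_pullback, h] at hf
    exact hf rfl
  obtain ⟨⟨⟨b, c⟩⟩, h1, h2⟩ := φ
  obtain ⟨⟨⟨b', c'⟩⟩, h1', h2'⟩ := ψ
  obtain rfl : b = b' := hb
  -- A section agrees near each point with a global superfunction, on which both pullbacks coincide.
  have hc : c = c' := by
    apply NatTrans.ext
    funext U
    apply AlgCat.hom_ext
    apply AlgHom.ext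
    intro s
    refine section_ext (X := M.space) fun x hx => ?_
    obtain ⟨t, W, i, hW, ht⟩ := exists_extension (U := U.unop) s (b x) hx
    refine ⟨(Opens.map b).obj W, fun y hy => i hy, hW, ?_⟩
    have e1 := comorphism_res (X := M.space) (Y := N.space) (InducedCategory.homMk ⟨b, c⟩) i s
    have e2 := comorphism_res (X := M.space) (Y := N.space) (InducedCategory.homMk ⟨b, c'⟩) i s
    have e3 := comorphism_res (X := M.space) (Y := N.space) (InducedCategory.homMk ⟨b, c⟩)
      (le_top : W ≤ ⊤) t
    have e4 := comorphism_res (X := M.space) (Y := N.space) (InducedCategory.homMk ⟨b, c'⟩)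
      (le_top : W ≤ ⊤) t
    refine e1.symm.trans (Eq.trans ?_ e2)
    rw [← ht]
    refine e3.trans (Eq.trans ?_ e4.symm)
    exact congrArg _ (h t)
  subst hc
  rfl

/-! ### Morphisms from homomorphisms of superfunctions -/

section OfAlgHom

variable (φ : M.space → N.space) (α : N.Functions →ₐ[ℝ] M.Functions)
  (hα : ∀ p f, M.evalAt p (α f) = N.evalAt (φ p) f)

-- Such a homomorphism is automatically local: a cut-off `b` with `b = 1` near `φ p` gives `b (t -
-- t') = 0`, and `α b` is invertible near `p` because its value there is 1.
include hα in
lemma algHom_local {W : Opens N.space} {t t' : N.Functions}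
    (h : sectionRes N.space (le_top : W ≤ ⊤) t = sectionRes N.space (le_top : W ≤ ⊤) t')
    {W' : Opens M.space} (hW' : ∀ x ∈ W', φ x ∈ W) :
    sectionRes M.space (le_top : W' ≤ ⊤) (α t) = sectionRes M.space (le_top : W' ≤ ⊤) (α t') := by
  refine section_ext fun p hp => ?_
  obtain ⟨b, -, ⟨B, hpB, hB⟩, B', hUB, hB'⟩ := exists_cutoff (φ p) W (hW' p hp)
  have hb : b * (t - t') = 0 := by
    refine section_ext fun q _ => ?_
    have hq : q ∈ W ⊔ B' := by rw [hUB]; trivial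
    rcases hq with hq | hq
    · refine ⟨W, le_top, hq, ?_⟩
      rw [map_mul, map_sub, h, sub_self, mul_zero, map_zero]
    · refine ⟨B', le_top, hq, ?_⟩
      rw [map_mul, hB', zero_mul, map_zero]
  have hv : M.value p ⊤ trivial (α b) ≠ 0 := by
    have h1 : N.evalAt (φ p) b = 1 := by
      rw [evalAt_eq_of_res hpB (hB.trans (map_one _).symm), map_one]
    have := hα p b
    rw [h1] at this
    exact this.symm ▸ one_ne_zero
  obtain ⟨V, i, hpV, hu⟩ := exists_isUnit_res (α b) p trivial hv
  refine ⟨V ⊓ W', inf_le_right, ⟨hpV, hp⟩, ?_⟩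
  rw [sectionRes_sectionRes, sectionRes_sectionRes, ← sub_eq_zero, ← map_sub, ← map_sub]
  have hu' := hu.map (sectionRes M.space (inf_le_left : V ⊓ W' ≤ V))
  rw [sectionRes_sectionRes] at hu'
  rw [← hu'.mul_right_eq_zero, ← map_mul, ← map_mul, hb, map_zero, map_zero]

variable (hφ : Continuous φ)

/-- The preimage of an open set. -/
def preimage (U : Opens N.space) : Opens M.space := ⟨φ ⁻¹' U, U.2.preimage hφ⟩

lemma preimage_mono {U V : Opens N.space} (h : U ≤ V) : preimage φ hφ U ≤ preimage φ hφ V :=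
  fun _ hx => h hx

-- The sections `α t` are glued over the preimages of the sets `W` on which a global `t` represents
-- `s`. Indexing by all such pairs `(t, W)` makes the required property immediate; `algHom_local`
-- gives the compatibility.
include hα in
lemma exists_sheafMap (U : Opens N.space) (s : Sections N.space U) :
    ∃ r : Sections M.space (preimage φ hφ U), ∀ (t : N.Functions) (W : Opens N.space) (i : W ≤ U),
      sectionRes N.space le_top t = sectionRes N.space i s →
      sectionRes M.space (preimage_mono φ hφ i) r =
        sectionRes M.space le_top (α t) := by
  let ι := {x : N.Functions × Opens N.space // ∃ i : x.2 ≤ U,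
    sectionRes N.space le_top x.1 = sectionRes N.space i s}
  obtain ⟨r, hr⟩ := section_glue (X := M.space) (ι := ι) (U := fun x => preimage φ hφ x.1.2)
    (V := preimage φ hφ U) (fun x _ hy => x.2.1 hy)
    (by
      intro p hp
      obtain ⟨t, W, i, hW, h⟩ := exists_extension s (φ p) hp
      exact Opens.mem_iSup.2 ⟨⟨(t, W), i, h⟩, hW⟩)
    (fun x => sectionRes M.space le_top (α x.1.1))
    (by
      rintro ⟨⟨t, W⟩, i, h⟩ ⟨⟨t', W'⟩, i', h'⟩
      rw [sectionRes_sectionRes, sectionRes_sectionRes]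
      refine algHom_local φ α hα (W := W ⊓ W') ?_ fun x hx => hx
      have h2 := congrArg (sectionRes N.space (inf_le_left : W ⊓ W' ≤ W)) h
      have h2' := congrArg (sectionRes N.space (inf_le_right : W ⊓ W' ≤ W')) h'
      rw [sectionRes_sectionRes, sectionRes_sectionRes] at h2 h2'
      exact h2.trans h2'.symm)
  exact ⟨r, fun t W i h => hr ⟨(t, W), i, h⟩⟩

/-- The map of sections that extends a homomorphism of superfunctions. -/
def sheafMap (U : Opens N.space) (s : Sections N.space U) : Sections M.space (preimage φ hφ U) :=
  (exists_sheafMap φ α hα hφ U s).choose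

lemma sheafMap_res {U : Opens N.space} (s : Sections N.space U) (t : N.Functions)
    (W : Opens N.space) (i : W ≤ U)
    (h : sectionRes N.space le_top t = sectionRes N.space i s) :
    sectionRes M.space (preimage_mono φ hφ i)
      (sheafMap φ α hα hφ U s) = sectionRes M.space le_top (α t) :=
  (exists_sheafMap φ α hα hφ U s).choose_spec t W i h

/-- The glued section can be recognized by testing representatives over small open sets only, so
that several sections may be represented over a common neighbourhood. -/
lemma eq_sheafMap {U : Opens N.space} (s : Sections N.space U)
    (r : Sections M.space (preimage φ hφ U))
    (h : ∀ p ∈ U, ∃ (V : Opens N.space) (j : V ≤ U), p ∈ V ∧ ∀ (t : N.Functions)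
      (W : Opens N.space) (i : W ≤ V),
      sectionRes N.space le_top t = sectionRes N.space (i.trans j) s →
      sectionRes M.space (preimage_mono φ hφ (i.trans j)) r =
        sectionRes M.space le_top (α t)) :
    sheafMap φ α hα hφ U s = r := by
  refine section_ext fun p hp => ?_
  obtain ⟨V, j, hpV, hV⟩ := h (φ p) hp
  obtain ⟨t, W, i, hW, ht⟩ := exists_extension (sectionRes N.space j s) (φ p) hpV
  rw [sectionRes_sectionRes] at ht
  refine ⟨preimage φ hφ W, preimage_mono φ hφ (i.trans j), hW, ?_⟩
  rw [hV t W i ht]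
  exact sheafMap_res φ α hα hφ s t W (i.trans j) ht

lemma sheafMap_spec {U : Opens N.space} (s : Sections N.space U) (p : N.space) (hp : p ∈ U) :
    ∃ (t : N.Functions) (V : Opens N.space) (j : V ≤ U), p ∈ V ∧
      sectionRes N.space le_top t = sectionRes N.space j s ∧
      ∀ (W : Opens N.space) (i : W ≤ V),
        sectionRes M.space (preimage_mono φ hφ (i.trans j))
          (sheafMap φ α hα hφ U s) = sectionRes M.space le_top (α t) := by
  obtain ⟨t, V, j, hV, ht⟩ := exists_extension s p hp
  refine ⟨t, V, j, hV, ht, fun W i => ?_⟩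
  refine sheafMap_res φ α hα hφ s t W (i.trans j) ?_
  have := congrArg (sectionRes N.space i) ht
  rwa [sectionRes_sectionRes, sectionRes_sectionRes] at this

lemma sheafMap_top (f : N.Functions) :
    sheafMap φ α hα hφ ⊤ f = α f := by
  have h := sheafMap_res φ α hα hφ f f ⊤ le_rfl rfl
  exact (sectionRes_self _ _).symm.trans (h.trans (sectionRes_self _ _))

lemma sheafMap_sectionRes {U V : Opens N.space} (h : U ≤ V) (s : Sections N.space V) :
    sheafMap φ α hα hφ U (sectionRes N.space h s) =
      sectionRes M.space (preimage_mono φ hφ h)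
        (sheafMap φ α hα hφ V s) := by
  refine eq_sheafMap φ α hα hφ _ _ fun p hp => ⟨U, le_rfl, hp, fun t W i ht => ?_⟩
  rw [sectionRes_sectionRes] at ht ⊢
  exact sheafMap_res φ α hα hφ s t W _ ht

/-- One argument for addition, multiplication and the parity involution; the last is treated as a
binary operation that ignores its second argument. -/
lemma sheafMap_op₂ {U : Opens N.space} (s s' : Sections N.space U)
    (F : ∀ V : Opens N.space, Sections N.space V → Sections N.space V → Sections N.space V)
    (F' : ∀ V : Opens M.space, Sections M.space V → Sections M.space V → Sections M.space V)
    (hF : ∀ {V W : Opens N.space} (i : W ≤ V) (a b : Sections N.space V),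
      sectionRes N.space i (F V a b) = F W (sectionRes N.space i a) (sectionRes N.space i b))
    (hF' : ∀ {V W : Opens M.space} (i : W ≤ V) (a b : Sections M.space V),
      sectionRes M.space i (F' V a b) = F' W (sectionRes M.space i a) (sectionRes M.space i b))
    (hFF' : ∀ a b, α (F ⊤ a b) = F' ⊤ (α a) (α b)) :
    sheafMap φ α hα hφ U (F U s s') =
      F' _ (sheafMap φ α hα hφ U s) (sheafMap φ α hα hφ U s') := by
  refine eq_sheafMap φ α hα hφ _ _ fun p hp => ?_
  obtain ⟨t, V, j, hV, ht, h⟩ := sheafMap_spec φ α hα hφ s p hp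
  obtain ⟨t', V', j', hV', ht', h'⟩ := sheafMap_spec φ α hα hφ s' p hp
  refine ⟨V ⊓ V', inf_le_left.trans j, ⟨hV, hV'⟩, fun r W i hr => ?_⟩
  rw [hF', h W (i.trans inf_le_left)]
  have h2 := h' W (i.trans inf_le_right)
  refine (congrArg (F' _ _) h2).trans ?_
  rw [← hF', ← hFF']
  refine algHom_local φ α hα (W := W) ?_ fun x hx => hx
  have e := congrArg (sectionRes N.space (i.trans inf_le_left)) ht
  have e' := congrArg (sectionRes N.space (i.trans inf_le_right)) ht'
  rw [sectionRes_sectionRes, sectionRes_sectionRes] at e e'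
  rw [hr, hF, hF, e, e']

/-- The map of sections that extends a homomorphism of superfunctions, as a homomorphism. -/
def sheafHom (U : Opens N.space) : Sections N.space U →ₐ[ℝ] Sections M.space (preimage φ hφ U) where
  toFun := sheafMap φ α hα hφ U
  map_one' := by
    have h := sheafMap_sectionRes φ α hα hφ (le_top : U ≤ ⊤) 1
    rw [map_one, sheafMap_top, map_one] at h
    exact h.trans (map_one _)
  map_zero' := by
    have h := sheafMap_sectionRes φ α hα hφ (le_top : U ≤ ⊤) 0
    rw [map_zero, sheafMap_top, map_zero] at h
    exact h.trans (map_zero _)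
  map_mul' s s' := sheafMap_op₂ φ α hα hφ s s' (fun _ a b => a * b) (fun _ a b => a * b)
    (fun _ _ _ => map_mul _ _ _) (fun _ _ _ => map_mul _ _ _) (fun _ _ => map_mul _ _ _)
  map_add' s s' := sheafMap_op₂ φ α hα hφ s s' (fun _ a b => a + b) (fun _ a b => a + b)
    (fun _ _ _ => map_add _ _ _) (fun _ _ _ => map_add _ _ _) (fun _ _ => map_add _ _ _)
  commutes' r := by
    have h := sheafMap_sectionRes φ α hα hφ (le_top : U ≤ ⊤) (algebraMap ℝ _ r)
    rw [AlgHom.commutes, sheafMap_top, AlgHom.commutes] at h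
    exact h.trans (AlgHom.commutes _ _)

/-- A homomorphism of superfunctions over a smooth map is the pullback along a morphism. -/
lemma exists_hom (hφ : ContMDiff (𝓡 M.evenDim) (𝓡 N.evenDim) ∞ φ)
    (hα : ∀ p f, M.evalAt p (α f) = N.evalAt (φ p) f)
    (hσ : ∀ f, α (N.sigma ⊤ f) = M.sigma ⊤ (α f)) :
    ∃ Φ : M ⟶ N, ∀ f, pullback Φ f = α f := by
  refine ⟨Hom.mk (InducedCategory.homMk (F := SheafedSpace.toPresheafedSpace)
    { base := TopCat.ofHom ⟨φ, hφ.continuous⟩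
      c :=
        { app := fun U => AlgCat.ofHom (sheafHom φ α hα hφ.continuous U.unop)
          naturality := ?_ } }) hφ ?_, ?_⟩
  · intro V U i
    apply AlgCat.hom_ext
    apply AlgHom.ext
    intro f
    exact sheafMap_sectionRes φ α hα hφ.continuous (leOfHom i.unop) f
  · intro U k f hf
    change sheafMap φ α hα hφ.continuous U f ∈ M.parity _ k
    rw [mem_parity_iff] at hf ⊢
    have h1 := sheafMap_op₂ φ α hα hφ.continuous f f (fun V a _ => N.sigma V a)
      (fun V a _ => M.sigma V a) (fun i a _ => sigma_res i a) (fun i a _ => sigma_res i a)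
      (fun a _ => hσ a)
    refine h1.symm.trans ?_
    rw [hf]
    exact map_smul (sheafHom φ α hα hφ.continuous U) _ _
  · exact sheafMap_top φ α hα hφ.continuous

end OfAlgHom

end Supermanifold


lemma IsParityInvolution.unique {R : Type*} [AddCommGroup R] [Module ℝ R] {s s' : R →ₗ[ℝ] R}
    {A : ZMod 2 → Submodule ℝ R} (h : IsParityInvolution s A) (h' : IsParityInvolution s' A) :
    s = s' :=
  h.ext_parity fun l f hf => by rw [(h.mem_iff l f).1 hf, (h'.mem_iff l f).1 hf]

lemma OddExt.map_sigma {A B : Type*} [Ring A] [Algebra ℝ A] [Ring B] [Algebra ℝ B]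
    {σ : A →ₐ[ℝ] A} {τ : B →ₐ[ℝ] B} (φ : A →ₐ[ℝ] B) (h : ∀ a, φ (σ a) = τ (φ a))
    (x : OddExt σ) : OddExt.map φ h (OddExt.sigma σ x) = OddExt.sigma τ (OddExt.map φ h x) := by
  ext <;> simp [h]

lemma Trivialization.equiv_symm_sigma {M : Supermanifold.{u}} {U : Opens M.space}
    (t : Trivialization (D := M.evenDim) M.space M.parity M.oddDim U) (V : Opens M.space)
    (hV : V ≤ U) (a : Model (D := M.evenDim) M.oddDim V) :
    (t.equiv V hV).symm (modelSigma M.oddDim V a) = M.sigma V ((t.equiv V hV).symm a) := by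
  rw [AlgEquiv.symm_apply_eq, equiv_sigma, AlgEquiv.apply_symm_apply]

namespace Supermanifold

variable (M : Supermanifold.{u})

/-! ### The supermanifold `M × ℝ^{0|1}` -/

/-- The sheaf `𝒪_M[ξ]` with an additional odd variable `ξ`. -/
def extPresheaf : TopCat.Presheaf (AlgCat.{u} ℝ) M.space.carrier where
  obj U := AlgCat.of ℝ (OddExt (M.sigma U.unop))
  map {V U} i := AlgCat.ofHom (OddExt.map (sectionRes M.space (leOfHom i.unop))
    (sigma_res (leOfHom i.unop)))
  map_id U := by
    apply AlgCat.hom_ext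
    apply AlgHom.ext
    intro f
    exact OddExt.ext (σ := M.sigma U.unop) (sectionRes_self _ _) (sectionRes_self _ _)
  map_comp {U V W} i j := by
    apply AlgCat.hom_ext
    apply AlgHom.ext
    intro f
    exact OddExt.ext (σ := M.sigma W.unop) (sectionRes_sectionRes _ _ _).symm
      (sectionRes_sectionRes _ _ _).symm

lemma extPresheaf_isSheaf : M.extPresheaf.IsSheaf := by
  rw [TopCat.Presheaf.isSheaf_iff_isSheafUniqueGluing]
  intro ι U s hs
  obtain ⟨a, ha⟩ := section_glue (X := M.space) (U := U) (V := iSup U) (fun i => le_iSup U i)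
    le_rfl (fun i => (show OddExt (M.sigma (U i)) from s i).1)
    (fun i j => congrArg (fun x : OddExt (M.sigma (U i ⊓ U j)) => x.1) (hs i j))
  obtain ⟨b, hb⟩ := section_glue (X := M.space) (U := U) (V := iSup U) (fun i => le_iSup U i)
    le_rfl (fun i => (show OddExt (M.sigma (U i)) from s i).2)
    (fun i j => congrArg (fun x : OddExt (M.sigma (U i ⊓ U j)) => x.2) (hs i j))
  refine ⟨((a, b) : OddExt (M.sigma (iSup U))), fun i => OddExt.ext (σ := M.sigma (U i)) (ha i) (hb i), ?_⟩
  intro t ht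
  refine OddExt.ext (σ := M.sigma (iSup U)) ?_ ?_
  · refine section_ext (X := M.space) fun p hp => ?_
    obtain ⟨i, hi⟩ := Opens.mem_iSup.1 hp
    refine ⟨U i, le_iSup U i, hi, Eq.trans ?_ (ha i).symm⟩
    exact congrArg (fun x : OddExt (M.sigma (U i)) => x.1) (ht i)
  · refine section_ext (X := M.space) fun p hp => ?_
    obtain ⟨i, hi⟩ := Opens.mem_iSup.1 hp
    refine ⟨U i, le_iSup U i, hi, Eq.trans ?_ (hb i).symm⟩
    exact congrArg (fun x : OddExt (M.sigma (U i)) => x.2) (ht i)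

/-- The space underlying `M × ℝ^{0|1}`. -/
def extSpace : SheafedSpace.{u + 1, u, u} (AlgCat.{u} ℝ) where
  carrier := M.space.carrier
  presheaf := M.extPresheaf
  IsSheaf := M.extPresheaf_isSheaf

/-- The parts of parity `k` of `𝒪_M[ξ]`. -/
def extParity (U : Opens M.space) (k : ZMod 2) : Submodule ℝ (OddExt (M.sigma U)) :=
  OddExt.parity (M.sigma U) (M.parity U) k

lemma isParityInvolution_extSigma (U : Opens M.space) :
    IsParityInvolution (OddExt.sigma (M.sigma U)) (M.extParity U) :=
  OddExt.isParityInvolution (isParityInvolution_sigma U)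

instance : T2Space M.extSpace := inferInstanceAs (T2Space M.space)
instance : SecondCountableTopology M.extSpace :=
  inferInstanceAs (SecondCountableTopology M.space)
instance : ChartedSpace (EuclideanSpace ℝ (Fin M.evenDim)) M.extSpace :=
  inferInstanceAs (ChartedSpace (EuclideanSpace ℝ (Fin M.evenDim)) M.space)
instance : IsManifold (𝓡 M.evenDim) ∞ M.extSpace :=
  inferInstanceAs (IsManifold (𝓡 M.evenDim) ∞ M.space)

variable {M} in
/-- A trivialization of `𝒪_M[ξ]`. -/
def extTriv {U : Opens M.space} (t : Trivialization (D := M.evenDim) M.space M.parity M.oddDim U) :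
    Trivialization (D := M.evenDim) M.extSpace M.extParity (M.oddDim + 1) U where
  equiv V hV :=
    (AlgEquiv.ofAlgHom
      (OddExt.map (σ := M.sigma V) (τ := modelSigma (D := M.evenDim) M.oddDim V)
        (t.equiv V hV).toAlgHom (t.equiv_sigma V hV))
      (OddExt.map (τ := M.sigma V) (σ := modelSigma (D := M.evenDim) M.oddDim V)
        (t.equiv V hV).symm.toAlgHom (t.equiv_symm_sigma V hV))
      (AlgHom.ext fun x => OddExt.ext ((t.equiv V hV).apply_symm_apply _)
        ((t.equiv V hV).apply_symm_apply _))
      (AlgHom.ext fun x => OddExt.ext ((t.equiv V hV).symm_apply_apply _)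
        ((t.equiv V hV).symm_apply_apply _)) :
      OddExt (M.sigma V) ≃ₐ[ℝ] OddExt (modelSigma (D := M.evenDim) M.oddDim V)).trans
    (modelSuccEquiv M.oddDim V).symm
  equiv_res V W hV hW f := by
    apply (modelSuccEquiv M.oddDim W).injective
    rw [modelSuccEquiv_res]
    change modelSuccEquiv M.oddDim W ((modelSuccEquiv M.oddDim W).symm _) =
      OddExt.map _ _ (modelSuccEquiv M.oddDim V ((modelSuccEquiv M.oddDim V).symm _))
    rw [AlgEquiv.apply_symm_apply, AlgEquiv.apply_symm_apply]
    exact OddExt.ext (t.equiv_res V W hV hW _) (t.equiv_res V W hV hW _)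
  equiv_parity V hV k f := by
    rw [isParityInvolution_modelSigma.mem_iff, AlgHom.toLinearMap_apply]
    rw [← (modelSuccEquiv M.oddDim V).injective.eq_iff, modelSuccEquiv_sigma, map_smul]
    change _ ↔ OddExt.sigma _ (modelSuccEquiv M.oddDim V ((modelSuccEquiv M.oddDim V).symm _)) =
      sgn k • modelSuccEquiv M.oddDim V ((modelSuccEquiv M.oddDim V).symm _)
    rw [AlgEquiv.apply_symm_apply]
    have h1 := t.equiv_parity V hV k (show OddExt (M.sigma V) from f).1
    have h2 := t.equiv_parity V hV (k + 1) (show OddExt (M.sigma V) from f).2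
    refine (and_congr h1 h2).trans ?_
    exact (OddExt.isParityInvolution isParityInvolution_modelSigma).mem_iff k
      ((t.equiv V hV (show OddExt (M.sigma V) from f).1,
        t.equiv V hV (show OddExt (M.sigma V) from f).2) : OddExt (modelSigma _ V))

/-- The supermanifold `M × ℝ^{0|1}`. -/
def ext : Supermanifold.{u} where
  space := M.extSpace
  evenDim := M.evenDim
  oddDim := M.oddDim + 1
  parity := M.extParity
  gradedMonoid U :=
    have : SetLike.GradedMonoid (M.parity U) := M.gradedMonoid U
    OddExt.gradedMonoid (isParityInvolution_sigma (M := M) U)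
  isInternal U := (M.isParityInvolution_extSigma U).isInternal
  res_parity {U V} h k f hf := ⟨M.res_parity h _ _ hf.1, M.res_parity h _ _ hf.2⟩
  locallyTrivial p := by
    obtain ⟨U, hp, ⟨t⟩⟩ := M.locallyTrivial p
    exact ⟨U, hp, ⟨extTriv t⟩⟩

/-- The superfunctions on `M × ℝ^{0|1}`. -/
def extEquiv : M.ext.Functions ≃ₐ[ℝ] OddExt (M.sigma ⊤) := AlgEquiv.refl

variable {M} {N : Supermanifold.{u}}

lemma extEquiv_sigma (f : M.ext.Functions) :
    M.extEquiv (M.ext.sigma ⊤ f) = OddExt.sigma _ (M.extEquiv f) :=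
  DFunLike.congr_fun ((isParityInvolution_sigma (M := M.ext) ⊤).unique
    (M.isParityInvolution_extSigma ⊤)) f

lemma ext_evalAt (p : M.space) (f : M.ext.Functions) :
    M.ext.evalAt p f = M.evalAt p (M.extEquiv f).1 := by
  refine (eq_value (M := M.ext) (p := p) (U := ⊤) trivial
    ((M.evalAt p).comp ((OddExt.fstHom _).comp M.extEquiv.toAlgHom)) ?_ f).symm
  intro f W i hW hu
  refine value_ne_zero_of_isUnit_res (M := M) i hW ?_
  exact hu.map (OddExt.fstHom (M.sigma W))

/-- An odd variable does not change the underlying manifold, so `φ` serves only to supply the smooth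
map. -/
lemma exists_hom_to_ext (φ : M ⟶ N) (α : OddExt (N.sigma ⊤) →ₐ[ℝ] M.Functions)
    (hα : ∀ p x, M.evalAt p (α x) = N.evalAt ((Hom.map φ).hom.base p) x.1)
    (hσ : ∀ x, α (OddExt.sigma _ x) = M.sigma ⊤ (α x)) :
    ∃ Φ : M ⟶ N.ext, ∀ f, pullback Φ f = α (N.extEquiv f) :=
  exists_hom (M := M) (N := N.ext) (Hom.map φ).hom.base (α.comp N.extEquiv.toAlgHom) φ.contMDiff
    (fun p f => (hα p _).trans (ext_evalAt (M := N) _ f).symm)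
    (fun f => (congrArg α (extEquiv_sigma f)).trans (hσ _))

lemma exists_hom_of_ext (φ : M ⟶ N) (α : N.Functions →ₐ[ℝ] OddExt (M.sigma ⊤))
    (hα : ∀ p x, M.evalAt p (α x).1 = N.evalAt ((Hom.map φ).hom.base p) x)
    (hσ : ∀ x, α (N.sigma ⊤ x) = OddExt.sigma _ (α x)) :
    ∃ Φ : M.ext ⟶ N, ∀ f, M.extEquiv (pullback Φ f) = α f := by
  obtain ⟨Φ, h⟩ := exists_hom (M := M.ext) (N := N) (Hom.map φ).hom.base
    (M.extEquiv.symm.toAlgHom.comp α) φ.contMDiff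
    (fun p f => (ext_evalAt (M := M) p _).trans (hα p f))
    (fun f => (hσ f).trans (extEquiv_sigma (M.extEquiv.symm (α f))).symm)
  exact ⟨Φ, h⟩

variable (M) in
/-- The projection `M × ℝ^{0|1} → M`. -/
def extProj : M.ext ⟶ M :=
  (exists_hom_of_ext (𝟙 M) (OddExt.inlHom (M.sigma ⊤)) (fun _ _ => rfl)
    (fun _ => OddExt.ext rfl (by simp))).choose

@[simp] lemma extEquiv_pullback_extProj (f : M.Functions) :
    M.extEquiv (pullback M.extProj f) = OddExt.inlHom _ f :=
  (exists_hom_of_ext (𝟙 M) (OddExt.inlHom (M.sigma ⊤)) (fun _ _ => rfl)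
    (fun _ => OddExt.ext rfl (by simp))).choose_spec f

variable (M) in
/-- The zero section `M → M × ℝ^{0|1}`. -/
def extZero : M ⟶ M.ext :=
  (exists_hom_to_ext (𝟙 M) (OddExt.fstHom (M.sigma ⊤)) (fun _ _ => rfl) (fun _ => rfl)).choose

@[simp] lemma pullback_extZero (f : M.ext.Functions) :
    pullback M.extZero f = (M.extEquiv f).1 :=
  (exists_hom_to_ext (𝟙 M) (OddExt.fstHom (M.sigma ⊤)) (fun _ _ => rfl)
    (fun _ => rfl)).choose_spec f

lemma extZero_extProj : M.extZero ≫ M.extProj = 𝟙 M :=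
  hom_ext_pullback fun f => by simp

lemma odd_mul_self {U : Opens M.space} {η : Sections M.space U} (hη : η ∈ M.parity U 1) :
    η * η = 0 := by
  have hone : (1 : ZMod 2).val = 1 := rfl
  have h := mul_eq_mul_sigma hη η
  rw [hone, pow_one, mem_parity_iff.1 hη, sgn_one, neg_one_smul, mul_neg] at h
  have h2 : (2 : ℝ) • (η * η) = 0 := by
    rw [two_smul]
    nth_rw 1 [h]
    simp
  simpa using h2

/-- The section `M → M × ℝ^{0|1}` given by `ξ ↦ η`, for an odd superfunction `η`. -/
lemma exists_extGraph {η : M.Functions} (hη : η ∈ M.parity ⊤ 1) :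
    ∃ Φ : M ⟶ M.ext, ∀ f, pullback Φ f = (M.extEquiv f).1 + η * (M.extEquiv f).2 := by
  have hone : (1 : ZMod 2).val = 1 := rfl
  refine exists_hom_to_ext (𝟙 M) (OddExt.subst (M.sigma ⊤) η (odd_mul_self hη) (fun a => by
    have := mul_eq_mul_sigma hη a
    rwa [hone, pow_one] at this)) ?_ ?_
  · intro p x
    have h0 : M.evalAt p η = 0 := M.value_odd (U := ⊤) p trivial hη
    rw [OddExt.subst_apply, map_add, map_mul, h0, zero_mul, add_zero]
    rfl
  · intro x
    rw [OddExt.subst_apply, OddExt.subst_apply, map_add, map_mul, mem_parity_iff.1 hη]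
    simp

/-! ### Derivations along a morphism -/

/-- A superderivation `Y` of parity `k` along the morphism `φ`. -/
structure IsDerivationAlong (φ : M ⟶ N) (k : ZMod 2) (Y : N.Functions →ₗ[ℝ] M.Functions) :
    Prop where
  sigma : ∀ f, M.sigma ⊤ (Y f) = sgn k • Y (N.sigma ⊤ f)
  leibniz : ∀ f h, Y (f * h) = Y f * pullback φ h + (M.sigma ⊤ ^ k.val) (pullback φ f) * Y h

namespace IsDerivationAlong

/-- The morphism `φ + ξ Y : M × ℝ^{0|1} → N`, for an odd superderivation `Y` along `φ`. -/
lemma exists_hom {φ : M ⟶ N} {Y : N.Functions →ₗ[ℝ] M.Functions}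
    (hY : IsDerivationAlong φ 1 Y) : ∃ Φ : M.ext ⟶ N, ∀ f,
      M.extEquiv (pullback Φ f) = ((pullback φ f, Y f) : M.Functions × M.Functions) := by
  have hone : (1 : ZMod 2).val = 1 := rfl
  refine exists_hom_of_ext φ (OddExt.lift (pullback φ) Y fun a b => ?_)
    (fun p x => evalAt_pullback φ p x) (fun x => OddExt.ext (pullback_sigma φ x) ?_)
  · have := hY.leibniz a b
    rw [hone, pow_one] at this
    rw [this, add_comm]
  · have := hY.sigma x
    rw [sgn_one, neg_one_smul] at this
    change Y _ = -M.sigma ⊤ (Y x)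
    rw [this, neg_neg]

end IsDerivationAlong

end Supermanifold


namespace Supermanifold

variable {M N L S S' : Supermanifold.{u}}

lemma sigma_pow_add (k l : ZMod 2) (U : Opens M.space) (f : Sections M.space U) :
    (M.sigma U ^ (k + l).val) f = (M.sigma U ^ k.val) ((M.sigma U ^ l.val) f) := by
  have h0 : (0 : ZMod 2).val = 0 := rfl
  have h1 : (1 : ZMod 2).val = 1 := rfl
  have h2 : (1 : ZMod 2) + 1 = 0 := rfl
  rcases zmod_two_cases k with rfl | rfl <;> rcases zmod_two_cases l with rfl | rfl <;>
    simp [h0, h1, h2]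

lemma sigma_pow_of_mem {k l : ZMod 2} {U : Opens M.space} {f : Sections M.space U}
    (hf : f ∈ M.parity U l) : (M.sigma U ^ k.val) f = sgn l ^ k.val • f := by
  have h1 : (1 : ZMod 2).val = 1 := rfl
  rcases zmod_two_cases k with rfl | rfl
  · simp
  · rw [h1, pow_one, pow_one, mem_parity_iff.1 hf]

lemma pullback_sigma_pow (φ : M ⟶ N) (k : ZMod 2) (f : N.Functions) :
    pullback φ ((N.sigma ⊤ ^ k.val) f) = (M.sigma ⊤ ^ k.val) (pullback φ f) := by
  have h1 : (1 : ZMod 2).val = 1 := rfl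
  rcases zmod_two_cases k with rfl | rfl
  · simp
  · rw [h1, pow_one, pow_one, pullback_sigma]

lemma pullback_mem_parity (φ : M ⟶ N) {k : ZMod 2} {f : N.Functions} (hf : f ∈ N.parity ⊤ k) :
    pullback φ f ∈ M.parity ⊤ k := φ.parity ⊤ k f hf

/-! ### Calculus of derivations along morphisms -/

namespace IsDerivationAlong

variable {φ : S ⟶ N} {k l : ZMod 2} {Y Y' : N.Functions →ₗ[ℝ] S.Functions}

lemma zero (φ : S ⟶ N) (k : ZMod 2) : IsDerivationAlong φ k 0 :=
  ⟨fun _ => by simp, fun _ _ => by simp⟩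

lemma add (hY : IsDerivationAlong φ k Y) (hY' : IsDerivationAlong φ k Y') :
    IsDerivationAlong φ k (Y + Y') where
  sigma f := by simp [hY.sigma, hY'.sigma]
  leibniz f h := by
    simp only [LinearMap.add_apply, hY.leibniz, hY'.leibniz, add_mul, mul_add]
    abel

lemma sum {ι : Type*} (s : Finset ι) {Y : ι → N.Functions →ₗ[ℝ] S.Functions}
    (hY : ∀ i ∈ s, IsDerivationAlong φ k (Y i)) : IsDerivationAlong φ k (∑ i ∈ s, Y i) := by
  classical
  induction s using Finset.induction_on with
  | empty => simpa using zero φ k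
  | insert i s hi ih =>
    rw [Finset.sum_insert hi]
    exact (hY i (Finset.mem_insert_self i s)).add
      (ih fun j hj => hY j (Finset.mem_insert_of_mem hj))

lemma mulLeft (hY : IsDerivationAlong φ k Y) {a : S.Functions} (ha : a ∈ S.parity ⊤ l) :
    IsDerivationAlong φ (l + k) (LinearMap.mulLeft ℝ a ∘ₗ Y) where
  sigma f := by
    simp only [LinearMap.comp_apply, LinearMap.mulLeft_apply, map_mul, mem_parity_iff.1 ha,
      hY.sigma, sgn_add, smul_mul_smul_comm]
  leibniz f h := by
    simp only [LinearMap.comp_apply, LinearMap.mulLeft_apply, hY.leibniz, mul_add,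
      sigma_pow_add, ← mul_assoc]
    -- Moving `a` to the left past the coefficient applies `σ^l` a second time, which cancels the
    -- first.
    rw [mul_eq_mul_sigma ha ((S.sigma ⊤ ^ l.val) ((S.sigma ⊤ ^ k.val) (pullback φ f)))]
    rw [← sigma_pow_add, zmod_two_add_self]
    simp

lemma comp (hY : IsDerivationAlong φ k Y) (ψ : N ⟶ L) :
    IsDerivationAlong (φ ≫ ψ) k (Y ∘ₗ (pullback ψ).toLinearMap) where
  sigma f := by simp [hY.sigma, pullback_sigma]
  leibniz f h := by simp [hY.leibniz]

lemma precomp (hY : IsDerivationAlong φ k Y) (χ : S' ⟶ S) :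
    IsDerivationAlong (χ ≫ φ) k ((pullback χ).toLinearMap ∘ₗ Y) where
  sigma f := by simp [← pullback_sigma, hY.sigma]
  leibniz f h := by
    simp only [LinearMap.comp_apply, AlgHom.toLinearMap_apply, hY.leibniz, map_add, map_mul,
      pullback_comp, pullback_sigma_pow]

lemma map_one (hY : IsDerivationAlong φ k Y) : Y 1 = 0 := by
  have := hY.leibniz 1 1
  simpa using this

lemma congr {ψ : S ⟶ N} (hY : IsDerivationAlong φ k Y) (h : φ = ψ) : IsDerivationAlong ψ k Y :=
  h ▸ hY

lemma map_mem (hY : IsDerivationAlong φ k Y) {f : N.Functions} (hf : f ∈ N.parity ⊤ l) :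
    Y f ∈ S.parity ⊤ (k + l) := by
  rw [mem_parity_iff, hY.sigma, mem_parity_iff.1 hf, map_smul, sgn_add, smul_smul]

end IsDerivationAlong

/-- On a homogeneous `f` the signed factor `(-1)^{k|f|} f` is `σ^k(f)`, and the resulting rule is
linear in `f`. It therefore makes sense along a morphism, with no reference to homogeneous elements.
-/
lemma isSuperderivation_iff {k : ZMod 2} {X : Module.End ℝ M.Functions} :
    IsSuperderivation k X ↔ IsDerivationAlong (𝟙 M) k X := by
  constructor
  · intro hX
    refine ⟨fun f => (isParityInvolution_sigma ⊤).comm_of_parity (isParityInvolution_sigma ⊤)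
      (T := X) hX.parity f, fun f h => ?_⟩
    obtain ⟨f₀, h0, f₁, h1, rfl⟩ := (isParityInvolution_sigma (M := M) ⊤).exists_add f
    have e : ∀ l, ∀ f ∈ M.parity ⊤ l, X (f * h) = X f * h + (M.sigma ⊤ ^ k.val) f * X h := by
      intro l f hf
      rw [hX.leibniz l f h hf, neg_one_pow_val_mul_val, sigma_pow_of_mem hf, smul_mul_assoc]
    simp only [pullback_id, add_mul, map_add, e _ _ h0, e _ _ h1]
    abel
  · intro hX
    refine ⟨fun j f hf => hX.map_mem hf, fun j f h hf => ?_⟩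
    rw [hX.leibniz f h, pullback_id, pullback_id, sigma_pow_of_mem hf, neg_one_pow_val_mul_val,
      smul_mul_assoc]

/-! ### The odd part of a morphism from `M × ℝ^{0|1}` -/

variable (M) in
/-- Multiplication by the odd variable `ξ`. -/
def xi : M.Functions →ₗ[ℝ] M.ext.Functions :=
  M.extEquiv.symm.toLinearMap ∘ₗ LinearMap.inr ℝ M.Functions M.Functions

lemma extEquiv_xi (f : M.Functions) :
    M.extEquiv (xi M f) = ((0, f) : M.Functions × M.Functions) := rfl

lemma xi_injective : Function.Injective (xi M) := fun _ _ h =>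
  congrArg Prod.snd (congrArg M.extEquiv h)

/-- The coefficient of `ξ` in the pullback of superfunctions. -/
def oddPart (Φ : M.ext ⟶ N) : N.Functions →ₗ[ℝ] M.Functions :=
  LinearMap.snd ℝ M.Functions M.Functions ∘ₗ M.extEquiv.toLinearMap ∘ₗ (pullback Φ).toLinearMap

lemma extEquiv_pullback (Φ : M.ext ⟶ N) (f : N.Functions) :
    M.extEquiv (pullback Φ f) =
      ((pullback (M.extZero ≫ Φ) f, oddPart Φ f) : M.Functions × M.Functions) :=
  OddExt.ext (by rw [pullback_comp, pullback_extZero]) rfl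

/-- Converse of `IsDerivationAlong.exists_hom`: the coefficient of ξ in the multiplicativity of the
pullback is the Leibniz rule, and in its parity it is the sign rule. -/
lemma isDerivationAlong_oddPart (Φ : M.ext ⟶ N) :
    IsDerivationAlong (M.extZero ≫ Φ) 1 (oddPart Φ) where
  sigma f := by
    have h := congrArg Prod.snd (congrArg M.extEquiv (pullback_sigma Φ f))
    rw [extEquiv_sigma, extEquiv_pullback, extEquiv_pullback] at h
    change oddPart Φ (N.sigma ⊤ f) = -M.sigma ⊤ (oddPart Φ f) at h
    rw [h, sgn_one, neg_one_smul, neg_neg]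
  leibniz f h := by
    have hone : (1 : ZMod 2).val = 1 := rfl
    have e := (congrArg M.extEquiv (map_mul (pullback Φ) f h)).trans (map_mul M.extEquiv _ _)
    rw [extEquiv_pullback, extEquiv_pullback, extEquiv_pullback] at e
    rw [hone, pow_one, add_comm]
    exact congrArg Prod.snd e

/-- Moving a coefficient past ξ costs one σ, which cancels the σ in the odd Leibniz rule. Thus even
derivations can also be treated with a single odd parameter. -/
lemma isDerivationAlong_xi_iff {φ : S ⟶ N} {Y : N.Functions →ₗ[ℝ] S.Functions} :
    IsDerivationAlong (S.extProj ≫ φ) 1 (xi S ∘ₗ Y) ↔ IsDerivationAlong φ 0 Y := by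
  have h0 : (0 : ZMod 2).val = 0 := rfl
  have h1 : (1 : ZMod 2).val = 1 := rfl
  have hs : ∀ f, S.extEquiv (S.ext.sigma ⊤ (xi S f)) =
      ((0, -S.sigma ⊤ f) : S.Functions × S.Functions) := by
    intro f
    rw [extEquiv_sigma, extEquiv_xi]
    exact OddExt.ext (map_zero (S.sigma ⊤)) rfl
  have hl : ∀ a b c : S.Functions, ∀ d : S.Functions,
      S.extEquiv (xi S a * pullback S.extProj b + S.ext.sigma ⊤ (pullback S.extProj c) * xi S d) =
        ((0, a * b + c * d) : S.Functions × S.Functions) := by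
    intro a b c d
    rw [map_add, map_mul, map_mul, extEquiv_sigma, extEquiv_pullback_extProj,
      extEquiv_pullback_extProj, extEquiv_xi, extEquiv_xi]
    refine OddExt.ext ?_ ?_
    · change 0 * b + S.sigma ⊤ c * 0 = 0
      simp
    · change (S.sigma ⊤ 0 * 0 + a * b) + (S.sigma ⊤ (S.sigma ⊤ c) * d + -S.sigma ⊤ 0 * 0) =
        a * b + c * d
      simp
  constructor
  · intro h
    refine ⟨fun f => ?_, fun f g => ?_⟩
    · have e := congrArg S.extEquiv (h.sigma f)
      rw [LinearMap.comp_apply, hs, sgn_one, neg_one_smul, LinearMap.comp_apply, map_neg,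
        extEquiv_xi] at e
      rw [sgn_zero, one_smul]
      exact neg_injective (congrArg Prod.snd e)
    · have e := congrArg S.extEquiv (h.leibniz f g)
      rw [h1, pow_one, LinearMap.comp_apply, LinearMap.comp_apply, LinearMap.comp_apply,
        pullback_comp, pullback_comp, hl, extEquiv_xi] at e
      rw [h0, pow_zero]
      exact congrArg Prod.snd e
  · intro h
    refine ⟨fun f => S.extEquiv.injective ?_, fun f g => S.extEquiv.injective ?_⟩
    · have e := h.sigma f
      rw [sgn_zero, one_smul] at e
      rw [LinearMap.comp_apply, hs, sgn_one, neg_one_smul, LinearMap.comp_apply, map_neg,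
        extEquiv_xi, e]
      exact OddExt.ext (σ := S.sigma ⊤) neg_zero.symm rfl
    · have e := h.leibniz f g
      rw [h0, pow_zero] at e
      rw [h1, pow_one, LinearMap.comp_apply, LinearMap.comp_apply, LinearMap.comp_apply,
        pullback_comp, pullback_comp, hl, extEquiv_xi, e]
      rfl

/-! ### Derivations along morphisms to a product -/

section Product

variable (P : BinaryFan M N)

/-- The first projection of a product. -/
abbrev prFst : P.pt ⟶ M := P.fst

/-- The second projection of a product. -/
abbrev prSnd : P.pt ⟶ N := P.snd

variable {P} (hP : IsLimit P)

@[simp] lemma pair_prFst (s : S ⟶ M) (t : S ⟶ N) : pair hP s t ≫ prFst P = s :=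
  hP.fac _ ⟨WalkingPair.left⟩

@[simp] lemma pair_prSnd (s : S ⟶ M) (t : S ⟶ N) : pair hP s t ≫ prSnd P = t :=
  hP.fac _ ⟨WalkingPair.right⟩

include hP in
lemma prod_hom_ext {φ ψ : S ⟶ P.pt} (h1 : φ ≫ prFst P = ψ ≫ prFst P)
    (h2 : φ ≫ prSnd P = ψ ≫ prSnd P) : φ = ψ :=
  BinaryFan.IsLimit.hom_ext hP h1 h2

@[simp] lemma pullback_pair_fst (s : S ⟶ M) (t : S ⟶ N) (f : M.Functions) :
    pullback (pair hP s t) (pullback (prFst P) f) = pullback s f := by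
  rw [← pullback_comp, pair_prFst]

@[simp] lemma pullback_pair_snd (s : S ⟶ M) (t : S ⟶ N) (f : N.Functions) :
    pullback (pair hP s t) (pullback (prSnd P) f) = pullback t f := by
  rw [← pullback_comp, pair_prSnd]

lemma comp_pair (χ : S' ⟶ S) (s : S ⟶ M) (t : S ⟶ N) :
    χ ≫ pair hP s t = pair hP (χ ≫ s) (χ ≫ t) :=
  prod_hom_ext hP (by rw [Category.assoc, pair_prFst, pair_prFst])
    (by rw [Category.assoc, pair_prSnd, pair_prSnd])

lemma pair_prFst_prSnd : pair hP (prFst P) (prSnd P) = 𝟙 P.pt :=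
  prod_hom_ext hP (by rw [pair_prFst, Category.id_comp]) (by rw [pair_prSnd, Category.id_comp])

variable (P) in
/-- `Y` is a derivation along a morphism to a product, with components `Y₁` and `Y₂`. -/
structure IsLift (φ : S ⟶ P.pt) (k : ZMod 2) (Y₁ : M.Functions →ₗ[ℝ] S.Functions)
    (Y₂ : N.Functions →ₗ[ℝ] S.Functions) (Y : P.pt.Functions →ₗ[ℝ] S.Functions) : Prop where
  isDerivationAlong : IsDerivationAlong φ k Y
  fst : ∀ f, Y (pullback (prFst P) f) = Y₁ f
  snd : ∀ f, Y (pullback (prSnd P) f) = Y₂ f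

variable {φ : S ⟶ P.pt} {k : ZMod 2} {Y₁ : M.Functions →ₗ[ℝ] S.Functions}
  {Y₂ : N.Functions →ₗ[ℝ] S.Functions} {Y Y' : P.pt.Functions →ₗ[ℝ] S.Functions}

namespace IsLift

lemma isDer_fst (h : IsLift P φ k Y₁ Y₂ Y) : IsDerivationAlong (φ ≫ prFst P) k Y₁ := by
  have := h.isDerivationAlong.comp (prFst P)
  rwa [show Y ∘ₗ (pullback (prFst P)).toLinearMap = Y₁ from LinearMap.ext h.fst] at this

lemma isDer_snd (h : IsLift P φ k Y₁ Y₂ Y) : IsDerivationAlong (φ ≫ prSnd P) k Y₂ := by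
  have := h.isDerivationAlong.comp (prSnd P)
  rwa [show Y ∘ₗ (pullback (prSnd P)).toLinearMap = Y₂ from LinearMap.ext h.snd] at this

lemma precomp (h : IsLift P φ k Y₁ Y₂ Y) (χ : S' ⟶ S) :
    IsLift P (χ ≫ φ) k ((pullback χ).toLinearMap ∘ₗ Y₁) ((pullback χ).toLinearMap ∘ₗ Y₂)
      ((pullback χ).toLinearMap ∘ₗ Y) where
  isDerivationAlong := h.isDerivationAlong.precomp χ
  fst f := congrArg (pullback χ) (h.fst f)
  snd f := congrArg (pullback χ) (h.snd f)

lemma congr {ψ : S ⟶ P.pt} (h : IsLift P φ k Y₁ Y₂ Y) (e : φ = ψ) : IsLift P ψ k Y₁ Y₂ Y :=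
  e ▸ h

lemma xi (h : IsLift P φ 0 Y₁ Y₂ Y) :
    IsLift P (S.extProj ≫ φ) 1 (xi S ∘ₗ Y₁) (Supermanifold.xi S ∘ₗ Y₂)
      (Supermanifold.xi S ∘ₗ Y) where
  isDerivationAlong := isDerivationAlong_xi_iff.2 h.isDerivationAlong
  fst f := congrArg (Supermanifold.xi S) (h.fst f)
  snd f := congrArg (Supermanifold.xi S) (h.snd f)

/-- The morphism with components `s + ξ Y₁` and `t + ξ Y₂`. -/
lemma extEquiv_pullback_pair {s : S ⟶ M} {t : S ⟶ N} (h : IsLift P (pair hP s t) 1 Y₁ Y₂ Y)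
    {Φ₁ : S.ext ⟶ M} {Φ₂ : S.ext ⟶ N}
    (h1 : ∀ f, S.extEquiv (pullback Φ₁ f) = ((pullback s f, Y₁ f) : S.Functions × S.Functions))
    (h2 : ∀ f, S.extEquiv (pullback Φ₂ f) = ((pullback t f, Y₂ f) : S.Functions × S.Functions))
    (F : P.pt.Functions) : S.extEquiv (pullback (pair hP Φ₁ Φ₂) F) =
      ((pullback (pair hP s t) F, Y F) : S.Functions × S.Functions) := by
  -- The derivation `Y` is itself a morphism to the product; its components are `Φ₁` and `Φ₂`, so it
  -- is the pair of these.
  obtain ⟨Φ, hΦ⟩ := h.isDerivationAlong.exists_hom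
  have : pair hP Φ₁ Φ₂ = Φ := by
    apply prod_hom_ext hP
    · rw [pair_prFst]
      refine hom_ext_pullback fun f => S.extEquiv.injective ?_
      rw [pullback_comp, hΦ, h1, pullback_pair_fst, h.fst]
    · rw [pair_prSnd]
      refine hom_ext_pullback fun f => S.extEquiv.injective ?_
      rw [pullback_comp, hΦ, h2, pullback_pair_snd, h.snd]
  rw [this, hΦ]

-- Both derivations are the ξ-coefficient of the one morphism whose components are given by `Y₁` and
-- `Y₂`.
include hP in
lemma unique_odd (h : IsLift P φ 1 Y₁ Y₂ Y) (h' : IsLift P φ 1 Y₁ Y₂ Y') : Y = Y' := by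
  have e : φ = pair hP (φ ≫ prFst P) (φ ≫ prSnd P) :=
    prod_hom_ext hP (by rw [pair_prFst]) (by rw [pair_prSnd])
  obtain ⟨Φ₁, h1⟩ := h.isDer_fst.exists_hom
  obtain ⟨Φ₂, h2⟩ := h.isDer_snd.exists_hom
  ext F
  have a := (h.congr e).extEquiv_pullback_pair hP h1 h2 F
  have b := (h'.congr e).extEquiv_pullback_pair hP h1 h2 F
  exact congrArg Prod.snd (a.symm.trans b)

include hP in
/-- A derivation along a morphism to a product is determined by its components. -/
lemma unique (h : IsLift P φ k Y₁ Y₂ Y) (h' : IsLift P φ k Y₁ Y₂ Y') : Y = Y' := by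
  rcases zmod_two_cases k with rfl | rfl
  · have := h.xi.unique_odd hP h'.xi
    ext F
    exact xi_injective (DFunLike.congr_fun this F)
  · exact h.unique_odd hP h'

end IsLift

-- The derivation is the ξ-coefficient of the morphism to the product whose components are `φ₁ +
-- ξY₁` and `φ₂ + ξY₂`, where `φ₁` and `φ₂` are the components of `φ`.
include hP in
lemma exists_isLift_odd (h1 : IsDerivationAlong (φ ≫ prFst P) 1 Y₁)
    (h2 : IsDerivationAlong (φ ≫ prSnd P) 1 Y₂) : ∃ Y, IsLift P φ 1 Y₁ Y₂ Y := by
  obtain ⟨Φ₁, e1⟩ := h1.exists_hom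
  obtain ⟨Φ₂, e2⟩ := h2.exists_hom
  have hz : S.extZero ≫ pair hP Φ₁ Φ₂ = φ := by
    apply prod_hom_ext hP
    · rw [Category.assoc, pair_prFst]
      refine hom_ext_pullback fun f => ?_
      rw [pullback_comp, pullback_extZero, e1]
    · rw [Category.assoc, pair_prSnd]
      refine hom_ext_pullback fun f => ?_
      rw [pullback_comp, pullback_extZero, e2]
  refine ⟨oddPart (pair hP Φ₁ Φ₂), (isDerivationAlong_oddPart _).congr hz, fun f => ?_, fun f => ?_⟩
  · change (S.extEquiv (pullback (pair hP Φ₁ Φ₂) (pullback (prFst P) f))).2 = _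
    rw [pullback_pair_fst, e1]
  · change (S.extEquiv (pullback (pair hP Φ₁ Φ₂) (pullback (prSnd P) f))).2 = _
    rw [pullback_pair_snd, e2]

include hP in
/-- The components of a derivation along a morphism to a product can be prescribed. -/
lemma exists_isLift (h1 : IsDerivationAlong (φ ≫ prFst P) k Y₁)
    (h2 : IsDerivationAlong (φ ≫ prSnd P) k Y₂) : ∃ Y, IsLift P φ k Y₁ Y₂ Y := by
  rcases zmod_two_cases k with rfl | rfl
  · obtain ⟨Z, hZ⟩ := exists_isLift_odd hP (φ := S.extProj ≫ φ)
      ((isDerivationAlong_xi_iff.2 h1).congr (Category.assoc _ _ _).symm)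
      ((isDerivationAlong_xi_iff.2 h2).congr (Category.assoc _ _ _).symm)
    have hz : S.extZero ≫ S.extProj ≫ φ = φ := by
      rw [← Category.assoc, extZero_extProj, Category.id_comp]
    -- At ξ = 0 the lift `Z` of `(ξY₁, ξY₂)` becomes an odd lift of `(0, 0)`, hence zero. So `Z` is
    -- divisible by ξ, and the quotient is the even lift sought.
    have h0 : (pullback S.extZero).toLinearMap ∘ₗ Z = 0 := by
      have a := (hZ.precomp S.extZero).congr hz
      exact a.unique hP ⟨IsDerivationAlong.zero _ _,
        fun f => (pullback_extZero (xi S (Y₁ f))).symm,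
        fun f => (pullback_extZero (xi S (Y₂ f))).symm⟩
    let B : P.pt.Functions →ₗ[ℝ] S.Functions :=
      LinearMap.snd ℝ S.Functions S.Functions ∘ₗ S.extEquiv.toLinearMap ∘ₗ Z
    have hB : Z = xi S ∘ₗ B := by
      ext F
      apply S.extEquiv.injective
      refine OddExt.ext ?_ rfl
      have := DFunLike.congr_fun h0 F
      rw [LinearMap.comp_apply, AlgHom.toLinearMap_apply, pullback_extZero] at this
      exact this
    refine ⟨B, isDerivationAlong_xi_iff.1 (hB ▸ hZ.isDerivationAlong), fun f => ?_, fun f => ?_⟩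
    · exact congrArg Prod.snd (congrArg S.extEquiv (hZ.fst f))
    · exact congrArg Prod.snd (congrArg S.extEquiv (hZ.snd f))
  · exact exists_isLift_odd hP h1 h2

/-! ### `X ⊗ id` -/

lemma exists_add_of_mem_der {X : Module.End ℝ M.Functions} (hX : X ∈ Der M) :
    ∃ X₀ X₁, IsSuperderivation 0 X₀ ∧ IsSuperderivation 1 X₁ ∧ X₀ + X₁ = X := by
  have hsmul : ∀ (k : ZMod 2) (c : ℝ) (X : Module.End ℝ M.Functions),
      IsSuperderivation k X → IsSuperderivation k (c • X) := by
    intro k c X h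
    refine ⟨fun j f hf => Submodule.smul_mem _ _ (h.parity j f hf), fun j f g hf => ?_⟩
    simp only [LinearMap.smul_apply, h.leibniz j f g hf, smul_add, smul_mul_assoc, mul_smul_comm]
    rw [smul_comm]
  have hadd : ∀ (k : ZMod 2) (X Y : Module.End ℝ M.Functions),
      IsSuperderivation k X → IsSuperderivation k Y → IsSuperderivation k (X + Y) := by
    intro k X Y hX hY
    exact isSuperderivation_iff.2 ((isSuperderivation_iff.1 hX).add (isSuperderivation_iff.1 hY))
  have hzero : ∀ k : ZMod 2, IsSuperderivation k (0 : Module.End ℝ M.Functions) := fun k =>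
    isSuperderivation_iff.2 (IsDerivationAlong.zero _ _)
  induction hX using Submodule.span_induction with
  | mem X hX =>
    obtain ⟨k, hX⟩ := hX
    rcases zmod_two_cases k with rfl | rfl
    · exact ⟨X, 0, hX, hzero 1, add_zero X⟩
    · exact ⟨0, X, hzero 0, hX, zero_add X⟩
  | zero => exact ⟨0, 0, hzero 0, hzero 1, add_zero 0⟩
  | add X Y _ _ hX hY =>
    obtain ⟨X₀, X₁, h0, h1, rfl⟩ := hX
    obtain ⟨Y₀, Y₁, k0, k1, rfl⟩ := hY
    exact ⟨X₀ + Y₀, X₁ + Y₁, hadd _ _ _ h0 k0, hadd _ _ _ h1 k1, by abel⟩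
  | smul c X _ hX =>
    obtain ⟨X₀, X₁, h0, h1, rfl⟩ := hX
    exact ⟨c • X₀, c • X₁, hsmul _ _ _ h0, hsmul _ _ _ h1, (smul_add _ _ _).symm⟩

lemma IsSuperderivation.mem_der {k : ZMod 2} {X : Module.End ℝ M.Functions}
    (h : IsSuperderivation k X) : X ∈ Der M := Submodule.subset_span ⟨k, h⟩

include hP in
lemma exists_isLift_tensorId {k : ZMod 2} {X : Module.End ℝ M.Functions}
    (hX : IsSuperderivation k X) :
    ∃ D, IsLift P (𝟙 P.pt) k ((pullback (prFst P)).toLinearMap ∘ₗ X) 0 D := by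
  apply exists_isLift hP
  · have := (isSuperderivation_iff.1 hX).precomp (prFst P)
    rwa [Category.comp_id, ← Category.id_comp (prFst P)] at this
  · exact IsDerivationAlong.zero _ _

-- The difference `E` kills what comes from either factor. Uniqueness of lifts is available for
-- homogeneous derivations only, so the even and odd parts of `E` must first be shown to do the
-- same.
include hP in
lemma isTensorId_unique {X : Module.End ℝ M.Functions} {D D' : Module.End ℝ P.pt.Functions}
    (h : IsTensorId P X D) (h' : IsTensorId P X D') : D = D' := by
  rw [← sub_eq_zero]
  have hm : D - D' ∈ Der P.pt := Submodule.sub_mem _ h.mem_der h'.mem_der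
  have h1 : ∀ f, (D - D') (pullback (prFst P) f) = 0 := fun f => by
    have a := h.fst f
    have b := h'.fst f
    rw [LinearMap.sub_apply, sub_eq_zero]
    exact a.trans b.symm
  have h2 : ∀ f, (D - D') (pullback (prSnd P) f) = 0 := fun f => by
    have a := h.snd f
    have b := h'.snd f
    rw [LinearMap.sub_apply, sub_eq_zero]
    exact a.trans b.symm
  generalize D - D' = E at hm h1 h2
  obtain ⟨E₀, E₁, k0, k1, rfl⟩ := exists_add_of_mem_der hm
  -- The parity involution commutes with `E₀`, anticommutes with `E₁` and preserves pullbacks, so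
  -- both the sum and the difference of the two parts vanish on pullbacks.
  have key : ∀ {L : Supermanifold.{u}} (φ : P.pt ⟶ L), (∀ f, (E₀ + E₁) (pullback φ f) = 0) →
      ∀ f, E₀ (pullback φ f) = 0 ∧ E₁ (pullback φ f) = 0 := by
    intro L φ hE f
    have e0 := (isSuperderivation_iff.1 k0).sigma (pullback φ f)
    have e1 := (isSuperderivation_iff.1 k1).sigma (pullback φ f)
    have a := hE f
    have b := hE (L.sigma ⊤ f)
    rw [pullback_sigma, LinearMap.add_apply] at b
    rw [sgn_zero, one_smul] at e0
    rw [sgn_one, neg_one_smul] at e1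
    rw [LinearMap.add_apply] at a
    rw [← e0, ← neg_neg (E₁ _), ← e1, ← map_neg, ← map_add] at b
    have c : E₀ (pullback φ f) + -E₁ (pullback φ f) = 0 := by
      have := congrArg (P.pt.sigma ⊤) b
      rwa [sigma_sigma, map_zero] at this
    rw [eq_neg_of_add_eq_zero_left a] at c ⊢
    have h2 : (2 : ℝ) • E₁ (pullback φ f) = 0 := by
      rw [two_smul, ← neg_eq_zero, neg_add]
      exact c
    have : E₁ (pullback φ f) = 0 := by simpa using h2
    simp [this]
  have z0 : E₀ = 0 := IsLift.unique hP (k := 0) (φ := 𝟙 P.pt) (Y₁ := 0) (Y₂ := 0)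
    ⟨isSuperderivation_iff.1 k0, fun f => (key _ h1 f).1, fun f => (key _ h2 f).1⟩
    ⟨IsDerivationAlong.zero _ _, fun _ => rfl, fun _ => rfl⟩
  have z1 : E₁ = 0 := IsLift.unique hP (k := 1) (φ := 𝟙 P.pt) (Y₁ := 0) (Y₂ := 0)
    ⟨isSuperderivation_iff.1 k1, fun f => (key _ h1 f).2, fun f => (key _ h2 f).2⟩
    ⟨IsDerivationAlong.zero _ _, fun _ => rfl, fun _ => rfl⟩
  rw [z0, z1, add_zero]

include hP in
/-- `X ⊗ id` exists. -/
lemma isTensorId_tensorId {X : Module.End ℝ M.Functions} (hX : X ∈ Der M) :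
    IsTensorId P X (tensorId P X) := by
  obtain ⟨X₀, X₁, h0, h1, rfl⟩ := exists_add_of_mem_der hX
  obtain ⟨D₀, d0⟩ := exists_isLift_tensorId hP h0
  obtain ⟨D₁, d1⟩ := exists_isLift_tensorId hP h1
  refine Classical.epsilon_spec (p := IsTensorId P (X₀ + X₁)) ⟨D₀ + D₁, ?_, fun f => ?_, fun f => ?_⟩
  · exact Submodule.add_mem _ (isSuperderivation_iff.2 d0.isDerivationAlong).mem_der
      (isSuperderivation_iff.2 d1.isDerivationAlong).mem_der
  · have e := congrArg₂ (· + ·) (d0.fst f) (d1.fst f)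
    refine Eq.trans ?_ (e.trans ?_)
    · rfl
    · exact (map_add (pullback (prFst P)) _ _).symm
  · have e := congrArg₂ (· + ·) (d0.snd f) (d1.snd f)
    exact e.trans (add_zero _)

include hP in
lemma tensorId_eq {X : Module.End ℝ M.Functions} {D : Module.End ℝ P.pt.Functions}
    (hX : X ∈ Der M) (h : IsTensorId P X D) : tensorId P X = D :=
  isTensorId_unique hP (isTensorId_tensorId hP hX) h

include hP in
lemma isLift_tensorId {X : Module.End ℝ M.Functions} (hX : IsSuperderivation k X) :
    IsLift P (𝟙 P.pt) k ((pullback (prFst P)).toLinearMap ∘ₗ X) 0 (tensorId P X) := by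
  obtain ⟨D, hD⟩ := exists_isLift_tensorId hP hX
  rwa [tensorId_eq hP hX.mem_der
    ⟨(isSuperderivation_iff.2 hD.isDerivationAlong).mem_der, hD.fst, hD.snd⟩]

end Product

end Supermanifold


/-! ### Constant morphisms and point derivations -/

namespace Supermanifold

variable {M N S S' : Supermanifold.{u}}

@[simp] lemma pullback_const (p : M.space) (f : M.Functions) :
    pullback (const S p) f = algebraMap ℝ _ (M.evalAt p f) :=
  constApp_of_mem S p ⊤ trivial f

@[simp] lemma comp_const (φ : S' ⟶ S) (p : M.space) : φ ≫ const S p = const S' p :=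
  hom_ext_pullback fun f => by simp

/-- A point derivation of parity `k` at the point `p`. -/
structure IsPointDerivation (p : M.space) (k : ZMod 2) (v : M.Functions →ₗ[ℝ] ℝ) : Prop where
  sigma : ∀ f, v (M.sigma ⊤ f) = sgn k * v f
  leibniz : ∀ f h, v (f * h) = v f * M.evalAt p h + M.evalAt p f * v h

variable (S) in
/-- A linear form, as a linear map to the constant superfunctions on `S`. -/
def constMap (v : M.Functions →ₗ[ℝ] ℝ) : M.Functions →ₗ[ℝ] S.Functions :=
  Algebra.linearMap ℝ S.Functions ∘ₗ v

lemma constMap_apply (v : M.Functions →ₗ[ℝ] ℝ) (f : M.Functions) :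
    constMap S v f = algebraMap ℝ _ (v f) := rfl

lemma pullback_constMap (φ : S' ⟶ S) (v : M.Functions →ₗ[ℝ] ℝ) :
    (pullback φ).toLinearMap ∘ₗ constMap S v = constMap S' v := by
  ext f
  simp [constMap_apply]

lemma sigma_pow_algebraMap (k : ZMod 2) (U : Opens M.space) (c : ℝ) :
    (M.sigma U ^ k.val) (algebraMap ℝ _ c) = algebraMap ℝ _ c := AlgHom.commutes _ c

namespace IsPointDerivation

variable {p : M.space} {k : ZMod 2} {v : M.Functions →ₗ[ℝ] ℝ}

lemma isDerivationAlong (hv : IsPointDerivation p k v) :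
    IsDerivationAlong (const S p) k (constMap S v) where
  sigma f := by
    rw [constMap_apply, constMap_apply, AlgHom.commutes, hv.sigma, Algebra.smul_def, ← map_mul,
      ← mul_assoc, sgn_mul_self, one_mul]
  leibniz f h := by
    rw [pullback_const, pullback_const, sigma_pow_algebraMap]
    simp only [constMap_apply, hv.leibniz, map_add, map_mul]

end IsPointDerivation

end Supermanifold

/-! ### Differentiated action laws and invariant superderivations -/

open Supermanifold

/-- The action of a Lie supergroup on itself by left multiplication. -/
def LieSupergroup.leftMul (𝒢 : LieSupergroup.{u}) : SuperAction 𝒢 𝒢.G where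
  prod := 𝒢.sq
  isLimit := 𝒢.isLimit
  act := 𝒢.mul
  mul_act := 𝒢.mul_assoc
  one_act := 𝒢.one_mul

namespace SuperAction

variable {𝒢 : LieSupergroup.{u}} {M S : Supermanifold.{u}} (Ψ : SuperAction 𝒢 M)

lemma const_act (m : S ⟶ M) : pair Ψ.isLimit (const S 𝒢.e) m ≫ Ψ.act = m := by
  have h : m ≫ pair Ψ.isLimit (const M 𝒢.e) (𝟙 M) = pair Ψ.isLimit (const S 𝒢.e) m := by
    rw [comp_pair, comp_const, Category.comp_id]
  rw [← h, Category.assoc, Ψ.one_act, Category.comp_id]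

section Associativity

variable {a b : S ⟶ 𝒢.G} {m : S ⟶ M} {k : ZMod 2}
  {Ya Yb : 𝒢.G.Functions →ₗ[ℝ] S.Functions} {Ym : M.Functions →ₗ[ℝ] S.Functions}
  {Rbm Q Q' : Ψ.prod.pt.Functions →ₗ[ℝ] S.Functions} {Rab : 𝒢.sq.pt.Functions →ₗ[ℝ] S.Functions}

/-- The associativity law is applied to the points `a + ξYa`, `b + ξYb`, `m + ξYm` with values in S
× ℝ^{0|1}, and the coefficients of ξ are compared. -/
lemma assoc_odd (hRbm : IsLift Ψ.prod (pair Ψ.isLimit b m) 1 Yb Ym Rbm)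
    (hQ : IsLift Ψ.prod (pair Ψ.isLimit a (pair Ψ.isLimit b m ≫ Ψ.act)) 1 Ya
      (Rbm ∘ₗ (Supermanifold.pullback Ψ.act).toLinearMap) Q)
    (hRab : IsLift 𝒢.sq (pair 𝒢.isLimit a b) 1 Ya Yb Rab)
    (hQ' : IsLift Ψ.prod (pair Ψ.isLimit (pair 𝒢.isLimit a b ≫ 𝒢.mul) m) 1
      (Rab ∘ₗ (Supermanifold.pullback 𝒢.mul).toLinearMap) Ym Q') (f : M.Functions) :
    Q (pullback Ψ.act f) = Q' (pullback Ψ.act f) := by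
  obtain ⟨A, hA⟩ := ((pair_prFst 𝒢.isLimit a b) ▸ hRab.isDer_fst).exists_hom
  obtain ⟨B, hB⟩ := ((pair_prSnd 𝒢.isLimit a b) ▸ hRab.isDer_snd).exists_hom
  obtain ⟨C, hC⟩ := ((pair_prSnd Ψ.isLimit b m) ▸ hRbm.isDer_snd).exists_hom
  have h := congrArg (fun Φ => (S.extEquiv (pullback Φ f)).2) (Ψ.mul_act A B C)
  have e1 := hRbm.extEquiv_pullback_pair Ψ.isLimit hB hC
  have e2 := hQ.extEquiv_pullback_pair Ψ.isLimit (Φ₂ := pair Ψ.isLimit B C ≫ Ψ.act) hA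
    (fun f => e1 _)
  have e3 := hRab.extEquiv_pullback_pair 𝒢.isLimit hA hB
  have e4 := hQ'.extEquiv_pullback_pair Ψ.isLimit (Φ₁ := pair 𝒢.isLimit A B ≫ 𝒢.mul)
    (fun f => e3 _) hC
  exact (congrArg Prod.snd (e2 (pullback Ψ.act f))).symm.trans
    (h.trans (congrArg Prod.snd (e4 (pullback Ψ.act f))))

/-- Associativity of an action, for derivations along morphisms. -/
lemma assoc (hRbm : IsLift Ψ.prod (pair Ψ.isLimit b m) k Yb Ym Rbm)
    (hQ : IsLift Ψ.prod (pair Ψ.isLimit a (pair Ψ.isLimit b m ≫ Ψ.act)) k Ya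
      (Rbm ∘ₗ (Supermanifold.pullback Ψ.act).toLinearMap) Q)
    (hRab : IsLift 𝒢.sq (pair 𝒢.isLimit a b) k Ya Yb Rab)
    (hQ' : IsLift Ψ.prod (pair Ψ.isLimit (pair 𝒢.isLimit a b ≫ 𝒢.mul) m) k
      (Rab ∘ₗ (Supermanifold.pullback 𝒢.mul).toLinearMap) Ym Q') (f : M.Functions) :
    Q (pullback Ψ.act f) = Q' (pullback Ψ.act f) := by
  rcases zmod_two_cases k with rfl | rfl
  -- In the even case all derivations are multiplied by ξ over S × ℝ^{0|1}, and injectivity of this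
  -- multiplication recovers the claim.
  · have h1 := hRbm.xi.congr (comp_pair Ψ.isLimit S.extProj b m)
    have h2 := hQ.xi.congr ((comp_pair Ψ.isLimit S.extProj a _).trans (by
      rw [← Category.assoc, comp_pair]))
    have h3 := hRab.xi.congr (comp_pair 𝒢.isLimit S.extProj a b)
    have h4 := hQ'.xi.congr ((comp_pair Ψ.isLimit S.extProj _ m).trans (by
      rw [← Category.assoc, comp_pair]))
    exact xi_injective (Ψ.assoc_odd h1 h2 h3 h4 f)
  · exact Ψ.assoc_odd hRbm hQ hRab hQ' f

end Associativity

section Infinitesimal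

variable {k : ZMod 2} {v : 𝒢.G.Functions →ₗ[ℝ] ℝ}

lemma exists_isLift_point (hv : IsPointDerivation 𝒢.e k v) :
    ∃ R, IsLift Ψ.prod (pair Ψ.isLimit (const M 𝒢.e) (𝟙 M)) k (constMap M v) 0 R := by
  apply exists_isLift Ψ.isLimit
  · rw [pair_prFst]
    exact hv.isDerivationAlong
  · exact IsDerivationAlong.zero _ _

/-- `v ⊗ id : 𝒪(G ⊗ M) → 𝒪(M)` for a point derivation `v` at the unit. -/
def pointTensor (hv : IsPointDerivation 𝒢.e k v) : Ψ.prod.pt.Functions →ₗ[ℝ] M.Functions :=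
  (Ψ.exists_isLift_point hv).choose

lemma isLift_pointTensor (hv : IsPointDerivation 𝒢.e k v) :
    IsLift Ψ.prod (pair Ψ.isLimit (const M 𝒢.e) (𝟙 M)) k (constMap M v) 0 (Ψ.pointTensor hv) :=
  (Ψ.exists_isLift_point hv).choose_spec

lemma isLift_pointTensor_comp (hv : IsPointDerivation 𝒢.e k v) (m : S ⟶ M) :
    IsLift Ψ.prod (pair Ψ.isLimit (const S 𝒢.e) m) k (constMap S v) 0
      ((Supermanifold.pullback m).toLinearMap ∘ₗ Ψ.pointTensor hv) := by
  have h := ((Ψ.isLift_pointTensor hv).precomp m).congr (comp_pair Ψ.isLimit m _ _)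
  rwa [pullback_constMap, LinearMap.comp_zero, comp_const, Category.comp_id] at h

/-- The fundamental vector field `(v ⊗ id) ∘ ψ^♯` of a point derivation `v` at the unit. -/
def fundamental (hv : IsPointDerivation 𝒢.e k v) : Module.End ℝ M.Functions :=
  Ψ.pointTensor hv ∘ₗ (Supermanifold.pullback Ψ.act).toLinearMap

lemma isSuperderivation_fundamental (hv : IsPointDerivation 𝒢.e k v) :
    IsSuperderivation k (Ψ.fundamental hv) := by
  rw [isSuperderivation_iff]
  exact ((Ψ.isLift_pointTensor hv).isDerivationAlong.comp Ψ.act).congr Ψ.one_act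

end Infinitesimal

end SuperAction

namespace LieSupergroup

variable {𝒢 : LieSupergroup.{u}} {S : Supermanifold.{u}} {k : ZMod 2}
  {v : 𝒢.G.Functions →ₗ[ℝ] ℝ}

lemma const_mul (m : S ⟶ 𝒢.G) : pair 𝒢.isLimit (const S 𝒢.e) m ≫ 𝒢.mul = m :=
  𝒢.leftMul.const_act m

lemma mul_inv_comp (m : S ⟶ 𝒢.G) :
    pair 𝒢.isLimit m (m ≫ 𝒢.inv) ≫ 𝒢.mul = const S 𝒢.e := by
  have h : m ≫ pair 𝒢.isLimit (𝟙 𝒢.G) 𝒢.inv = pair 𝒢.isLimit m (m ≫ 𝒢.inv) := by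
    rw [comp_pair, Category.comp_id]
  rw [← h, Category.assoc, 𝒢.mul_inv, comp_const]

lemma inv_mul_comp (m : S ⟶ 𝒢.G) :
    pair 𝒢.isLimit (m ≫ 𝒢.inv) m ≫ 𝒢.mul = const S 𝒢.e := by
  have h : m ≫ pair 𝒢.isLimit 𝒢.inv (𝟙 𝒢.G) = pair 𝒢.isLimit (m ≫ 𝒢.inv) m := by
    rw [comp_pair, Category.comp_id]
  rw [← h, Category.assoc, 𝒢.inv_mul, comp_const]

/-- A derivation `Y` along `m`, extended by zero to a derivation along `(m, e)`. -/
lemma isLift_comp_unit {m : S ⟶ 𝒢.G} {Y : 𝒢.G.Functions →ₗ[ℝ] S.Functions}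
    (hY : IsDerivationAlong m k Y) :
    IsLift 𝒢.sq (pair 𝒢.isLimit m (const S 𝒢.e)) k Y 0
      (Y ∘ₗ (Supermanifold.pullback (pair 𝒢.isLimit (𝟙 𝒢.G) (const 𝒢.G 𝒢.e))).toLinearMap) where
  isDerivationAlong := (hY.comp _).congr (by rw [comp_pair, comp_const, Category.comp_id])
  fst f := by
    rw [LinearMap.comp_apply, AlgHom.toLinearMap_apply, pullback_pair_fst, pullback_id]
  snd f := by
    rw [LinearMap.comp_apply, AlgHom.toLinearMap_apply, pullback_pair_snd, pullback_const,
      Algebra.algebraMap_eq_smul_one, map_smul, hY.map_one, smul_zero, LinearMap.zero_apply]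

/-- The invariant superderivation with a given value at the unit. -/
abbrev invariantDer (hv : IsPointDerivation 𝒢.e k v) : Module.End ℝ 𝒢.G.Functions :=
  𝒢.leftMul.fundamental hv

/-- The pullback of `v ⊗ id` to the unit and the composite of `v` with the pullback along `(id, e)`
both lift `(v, 0)` along `(e, e)`. They are equal by uniqueness, and `e` is a right unit. -/
lemma evalAt_invariantDer (hv : IsPointDerivation 𝒢.e k v) (f : 𝒢.G.Functions) :
    𝒢.G.evalAt 𝒢.e (invariantDer hv f) = v f := by
  have h1 := 𝒢.leftMul.isLift_pointTensor_comp hv (const 𝒢.G 𝒢.e)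
  have h2 := isLift_comp_unit (𝒢 := 𝒢) (hv.isDerivationAlong (S := 𝒢.G))
  have h := DFunLike.congr_fun (h1.unique 𝒢.isLimit h2) (pullback 𝒢.mul f)
  have e : pullback (pair 𝒢.isLimit (𝟙 𝒢.G) (const 𝒢.G 𝒢.e)) (pullback 𝒢.mul f) = f := by
    rw [← pullback_comp, 𝒢.mul_one, pullback_id]
  have h3 : pullback (const 𝒢.G 𝒢.e) (invariantDer hv f) = algebraMap ℝ 𝒢.G.Functions (v f) := by
    refine Eq.trans h ?_
    rw [LinearMap.comp_apply, AlgHom.toLinearMap_apply, e, constMap_apply]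
  rw [pullback_const] at h3
  have := congrArg (𝒢.G.evalAt 𝒢.e) h3
  rwa [AlgHom.commutes, AlgHom.commutes] at this

end LieSupergroup

namespace SuperAction

variable {𝒢 : LieSupergroup.{u}} {M S : Supermanifold.{u}} (Ψ : SuperAction 𝒢 M)
  {k : ZMod 2} {v : 𝒢.G.Functions →ₗ[ℝ] ℝ}

open LieSupergroup

/-- `(X ⊗ id) ∘ ψ^♯ = ψ^♯ ∘ γ(X)`, where `γ(X)` is written as a fundamental vector field. -/
lemma tensorId_act (hv : IsPointDerivation 𝒢.e k v) (f : M.Functions) :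
    tensorId Ψ.prod (invariantDer hv) (pullback Ψ.act f) =
      pullback Ψ.act (Ψ.fundamental hv f) := by
  have e1 : pair Ψ.isLimit (prFst Ψ.prod) (prSnd Ψ.prod) ≫ Ψ.act = Ψ.act := by
    rw [pair_prFst_prSnd, Category.id_comp]
  -- Associativity is differentiated at the triple (e, first projection, second projection), where
  -- only the first entry moves, in the direction `v`.
  have h1 : IsLift Ψ.prod (pair Ψ.isLimit (prFst Ψ.prod) (prSnd Ψ.prod)) k 0 0 0 :=
    ⟨IsDerivationAlong.zero _ _, fun _ => rfl, fun _ => rfl⟩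
  have h2 := (Ψ.isLift_pointTensor_comp hv Ψ.act).congr (congrArg (pair Ψ.isLimit _) e1.symm)
  have h3 := 𝒢.leftMul.isLift_pointTensor_comp hv (prFst Ψ.prod)
  have h4 := (isLift_tensorId Ψ.isLimit (𝒢.leftMul.isSuperderivation_fundamental hv)).congr
    (ψ := pair Ψ.isLimit (pair 𝒢.isLimit (const _ 𝒢.e) (prFst Ψ.prod) ≫ 𝒢.mul) (prSnd Ψ.prod))
    (by rw [const_mul, pair_prFst_prSnd])
  exact (Ψ.assoc h1 h2 h3 h4 f).symm

lemma gamma_invariantDer (hv : IsPointDerivation 𝒢.e k v) (f : M.Functions) :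
    Ψ.gamma (invariantDer hv) f = Ψ.fundamental hv f := by
  rw [gamma, tensorId_act, evalFst, ← pullback_comp, Ψ.one_act, pullback_id]

end SuperAction

namespace LieSupergroup

variable {𝒢 : LieSupergroup.{u}} {S : Supermanifold.{u}} {k : ZMod 2}
  {v : 𝒢.G.Functions →ₗ[ℝ] ℝ}

lemma invariantDer_mem (hv : IsPointDerivation 𝒢.e k v) :
    invariantDer hv ∈ 𝒢.lieSuperalgebra :=
  ⟨(𝒢.leftMul.isSuperderivation_fundamental hv).mem_der,
    fun f => (𝒢.leftMul.tensorId_act hv f).symm⟩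

end LieSupergroup

/-! ### Frames of the cotangent space at a point -/

namespace Supermanifold

/-- The span of the constants and of the products of superfunctions that vanish at `p`. -/
def cotangentKer (M : Supermanifold.{u}) (p : M.space) : Submodule ℝ M.Functions :=
  Submodule.span ℝ (insert 1 {f | ∃ g h, M.evalAt p g = 0 ∧ M.evalAt p h = 0 ∧ f = g * h})

/-- A finite family of homogeneous point derivations at `p` and superfunctions such that
`f - ∑ i, v i f • y i` is a sum of a constant and of products of superfunctions that vanish at
`p`. -/
structure CotangentFrame (M : Supermanifold.{u}) (p : M.space) where
  ι : Type
  [fintype : Fintype ι]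
  deg : ι → ZMod 2
  y : ι → M.Functions
  y_mem : ∀ i, y i ∈ M.parity ⊤ (deg i)
  v : ι → M.Functions →ₗ[ℝ] ℝ
  isPointDerivation : ∀ i, IsPointDerivation p (deg i) (v i)
  expand : ∀ f, f - ∑ i, v i f • y i ∈ cotangentKer M p

attribute [instance] CotangentFrame.fintype

/-- A derivation along a constant morphism kills 1 and all products of two superfunctions vanishing
at `p`, so it sees only the frame part of `f`. -/
lemma CotangentFrame.eq_sum {M S : Supermanifold.{u}} {p : M.space} (B : CotangentFrame M p)
    {k : ZMod 2} {Y : M.Functions →ₗ[ℝ] S.Functions} (hY : IsDerivationAlong (const S p) k Y)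
    (f : M.Functions) : Y f = ∑ i, B.v i f • Y (B.y i) := by
  rw [← sub_eq_zero]
  have h : Y f - ∑ i, B.v i f • Y (B.y i) = Y (f - ∑ i, B.v i f • B.y i) := by
    simp [map_sub, map_sum, map_smul]
  rw [h]
  have hle : cotangentKer M p ≤ LinearMap.ker Y := by
    refine Submodule.span_le.2 ?_
    rintro x (rfl | ⟨g, h, hg, hh, rfl⟩)
    · exact hY.map_one
    · rw [SetLike.mem_coe, LinearMap.mem_ker, hY.leibniz, pullback_const, pullback_const, hg, hh]
      simp
  exact hle (B.expand f)

end Supermanifold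

/-! ### Invariant superderivations as a frame of the tangent sheaf of the supergroup -/

namespace LieSupergroup

variable {𝒢 : LieSupergroup.{u}} {S : Supermanifold.{u}} {k : ZMod 2}

/-- The invariant superderivations are a frame: they span the derivations along any morphism to
the supergroup. -/
lemma exists_eq_sum_invariantDer (B : CotangentFrame 𝒢.G 𝒢.e) {φ : S ⟶ 𝒢.G}
    {Y : 𝒢.G.Functions →ₗ[ℝ] S.Functions} (hY : IsDerivationAlong φ k Y) :
    ∃ a : B.ι → S.Functions, (∀ i, a i ∈ S.parity ⊤ (k + B.deg i)) ∧
      ∀ f, Y f = ∑ i, a i * pullback φ (invariantDer (B.isPointDerivation i) f) := by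
  -- Right translation by φ⁻¹ moves `Y` to the unit: the resulting `w` is a derivation along the
  -- constant morphism `e` and can be expanded in the frame.
  obtain ⟨R, hR⟩ := exists_isLift 𝒢.isLimit (φ := pair 𝒢.isLimit φ (φ ≫ 𝒢.inv)) (k := k)
    (Y₁ := Y) (Y₂ := 0) (by rwa [pair_prFst]) (IsDerivationAlong.zero _ _)
  have hw := (hR.isDerivationAlong.comp 𝒢.mul).congr (mul_inv_comp φ)
  set w := R ∘ₗ (Supermanifold.pullback 𝒢.mul).toLinearMap with hwdef
  refine ⟨fun i => w (B.y i), fun i => hw.map_mem (B.y_mem i), fun f => ?_⟩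
  set q := pair 𝒢.isLimit (const S 𝒢.e) φ with hq
  let D : B.ι → 𝒢.sq.pt.Functions →ₗ[ℝ] S.Functions := fun i =>
    (Supermanifold.pullback q).toLinearMap ∘ₗ tensorId 𝒢.sq (invariantDer (B.isPointDerivation i))
  have hD : ∀ i, IsLift 𝒢.sq q (B.deg i) (constMap S (B.v i)) 0 (D i) := by
    intro i
    have h := ((isLift_tensorId 𝒢.isLimit
      (𝒢.leftMul.isSuperderivation_fundamental (B.isPointDerivation i))).precomp q).congr
      (Category.comp_id q)
    refine ⟨h.isDerivationAlong, fun f => (h.fst f).trans ?_, fun f => (h.snd f).trans ?_⟩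
    · change pullback q (pullback (prFst 𝒢.sq) _) = _
      rw [pullback_pair_fst, pullback_const]
      exact congrArg _ (evalAt_invariantDer (B.isPointDerivation i) f)
    · exact map_zero (Supermanifold.pullback q)
  -- This lifts `(w, 0)` along `(e, φ)`, because the `i`-th term has first component `w(y_i) v_i`.
  let Q' : 𝒢.sq.pt.Functions →ₗ[ℝ] S.Functions :=
    ∑ i, LinearMap.mulLeft ℝ (w (B.y i)) ∘ₗ D i
  have hQ' : IsLift 𝒢.sq (pair 𝒢.isLimit (pair 𝒢.isLimit φ (φ ≫ 𝒢.inv) ≫ 𝒢.mul) φ) k w 0 Q' := by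
    have e : q = pair 𝒢.isLimit (pair 𝒢.isLimit φ (φ ≫ 𝒢.inv) ≫ 𝒢.mul) φ := by
      rw [mul_inv_comp]
    refine IsLift.congr ⟨?_, fun f => ?_, fun f => ?_⟩ e
    · refine IsDerivationAlong.sum _ fun i _ => ?_
      have h := (hD i).isDerivationAlong.mulLeft (hw.map_mem (B.y_mem i))
      rwa [add_assoc, zmod_two_add_self, add_zero] at h
    · rw [B.eq_sum hw f, LinearMap.sum_apply]
      refine Finset.sum_congr rfl fun i _ => ?_
      rw [LinearMap.comp_apply, (hD i).fst, LinearMap.mulLeft_apply, constMap_apply,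
        ← Algebra.commutes, Algebra.smul_def]
    · rw [LinearMap.sum_apply]
      refine Finset.sum_eq_zero fun i _ => ?_
      rw [LinearMap.comp_apply, (hD i).snd, LinearMap.zero_apply, map_zero]
  -- Differentiate φ(φ⁻¹φ) = (φφ⁻¹)φ with only the first factor moving, by `Y`. The left side gives
  -- `Y`, the right side the translate of `w` back to `φ`.
  have h1 : IsLift 𝒢.sq (pair 𝒢.isLimit (φ ≫ 𝒢.inv) φ) k 0 0 0 :=
    ⟨IsDerivationAlong.zero _ _, fun _ => rfl, fun _ => rfl⟩
  have h2 := (isLift_comp_unit hY).congr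
    (congrArg (pair 𝒢.isLimit φ) (inv_mul_comp φ).symm)
  have h := 𝒢.leftMul.assoc (k := k) h1 h2 hR hQ' f
  have e1 : (Y ∘ₗ (Supermanifold.pullback (pair 𝒢.isLimit (𝟙 𝒢.G) (const 𝒢.G 𝒢.e))).toLinearMap)
      (pullback 𝒢.mul f) = Y f := by
    rw [LinearMap.comp_apply, AlgHom.toLinearMap_apply, ← pullback_comp, 𝒢.mul_one, pullback_id]
  refine e1.symm.trans (h.trans ?_)
  change Q' (pullback 𝒢.mul f) = _
  rw [LinearMap.sum_apply]
  refine Finset.sum_congr rfl fun i _ => ?_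
  have e2 : D i (pullback 𝒢.mul f) = pullback φ (invariantDer (B.isPointDerivation i) f) := by
    have := 𝒢.leftMul.tensorId_act (B.isPointDerivation i) f
    refine (congrArg (pullback q) this).trans ?_
    exact (pullback_comp q 𝒢.mul _).symm.trans (by rw [hq, const_mul])
  rw [LinearMap.comp_apply, e2, LinearMap.mulLeft_apply]

end LieSupergroup


/-! ### Finiteness of the cotangent space -/

section Hadamard

variable {E F : Type*} [NormedAddCommGroup E] [NormedSpace ℝ E] [NormedAddCommGroup F]
  [NormedSpace ℝ F]

lemma contDiff_integral_unitInterval (G : E → ℝ → F) (hG : ContDiff ℝ ∞ (Function.uncurry G)) :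
    ContDiff ℝ ∞ fun x => ∫ t in (0 : ℝ)..1, G x t := by
  -- The integral is the value at 0 of the convolution of the indicator of (0, 1] with `t ↦ χ t • G
  -- x (-t)`. The cut-off is 1 on [-1, 1], hence harmless, and supplies the compact support needed
  -- for smoothness in the parameter.
  let χ : ContDiffBump (0 : ℝ) := ⟨1, 2, one_pos, one_lt_two⟩
  have h := MeasureTheory.contDiffOn_convolution_right_with_param (n := ⊤) (μ := MeasureTheory.volume)
    (f := (Set.Ioc (0 : ℝ) 1).indicator fun _ => (1 : ℝ))
    (g := fun (x : E) t => χ t • G x (-t)) (s := Set.univ)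
    (k := Metric.closedBall (0 : ℝ) 2) (ContinuousLinearMap.lsmul ℝ ℝ) isOpen_univ
    (isCompact_closedBall _ _) (fun x t _ ht => by
      have : χ t = 0 := χ.zero_of_le_dist (by
        rw [Metric.mem_closedBall, not_le] at ht
        exact ht.le)
      simp only [this, zero_smul])
    ((MeasureTheory.integrable_indicator_iff measurableSet_Ioc).2
      (by simp)).locallyIntegrable
    (by
      have h1 : ContDiff ℝ ∞ fun q : E × ℝ => χ q.2 • Function.uncurry G (q.1, -q.2) :=
        (χ.contDiff.comp contDiff_snd).smul
          (hG.comp (contDiff_fst.prodMk contDiff_snd.neg))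
      exact h1.contDiffOn)
  rw [Set.univ_prod_univ, contDiffOn_univ] at h
  have h2 := h.comp (contDiff_id.prodMk (contDiff_const (c := (0 : ℝ))) : ContDiff ℝ ∞ _)
  convert h2 using 1
  funext x
  rw [intervalIntegral.integral_of_le zero_le_one, ← MeasureTheory.integral_indicator
    measurableSet_Ioc]
  refine MeasureTheory.integral_congr_ae (Filter.Eventually.of_forall fun t => ?_)
  by_cases ht : t ∈ Set.Ioc (0 : ℝ) 1
  · have : χ (-t) = 1 := χ.one_of_mem_closedBall (by
      rw [Metric.mem_closedBall, dist_zero_right, norm_neg, Real.norm_eq_abs, abs_of_pos ht.1]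
      exact ht.2)
    simp [Set.indicator_of_mem ht, this]
  · simp [Set.indicator_of_notMem ht]

/-- Hadamard's lemma. -/
lemma exists_eq_add_apply_sub (f : E → ℝ) (hf : ContDiff ℝ ∞ f) (c : E) :
    ∃ H : E → E →L[ℝ] ℝ, ContDiff ℝ ∞ H ∧ ∀ x, f x = f c + H x (x - c) := by
  have hline : ContDiff ℝ ∞ fun q : E × ℝ => c + q.2 • (q.1 - c) :=
    contDiff_const.add (contDiff_snd.smul (contDiff_fst.sub contDiff_const))
  have hd : ContDiff ℝ ∞ (fderiv ℝ f) := hf.fderiv_right (by simp)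
  have hG : ContDiff ℝ ∞ (Function.uncurry fun (x : E) (t : ℝ) => fderiv ℝ f (c + t • (x - c))) :=
    hd.comp hline
  refine ⟨_, contDiff_integral_unitInterval _ hG, fun x => ?_⟩
  have hcont : Continuous fun t : ℝ => fderiv ℝ f (c + t • (x - c)) :=
    hG.continuous.comp (by fun_prop : Continuous fun t : ℝ => (x, t))
  rw [ContinuousLinearMap.intervalIntegral_apply (hcont.intervalIntegrable _ _)]
  have hderiv : ∀ t ∈ Set.uIcc (0 : ℝ) 1,
      HasDerivAt (fun t : ℝ => f (c + t • (x - c))) (fderiv ℝ f (c + t • (x - c)) (x - c)) t := by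
    intro t _
    have h1 : HasDerivAt (fun t : ℝ => c + t • (x - c)) (x - c) t := by
      simpa using ((hasDerivAt_id t).smul_const (x - c)).const_add c
    exact ((hf.differentiable (by simp)).differentiableAt.hasFDerivAt).comp_hasDerivAt t h1
  rw [intervalIntegral.integral_eq_sub_of_hasDerivAt hderiv
    ((hcont.clm_apply continuous_const).intervalIntegrable _ _)]
  simp

end Hadamard

/-! ### Germs modulo constants and products of superfunctions vanishing at a point -/

namespace Supermanifold

variable {M : Supermanifold.{u}} {p : M.space}

lemma one_mem_cotangentKer : (1 : M.Functions) ∈ cotangentKer M p := Submodule.subset_span (Or.inl rfl)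

lemma algebraMap_mem_cotangentKer (c : ℝ) : algebraMap ℝ _ c ∈ cotangentKer M p := by
  rw [Algebra.algebraMap_eq_smul_one]
  exact Submodule.smul_mem _ _ one_mem_cotangentKer

lemma mul_mem_cotangentKer {g h : M.Functions} (hg : M.evalAt p g = 0) (hh : M.evalAt p h = 0) :
    g * h ∈ cotangentKer M p := Submodule.subset_span (Or.inr ⟨g, h, hg, hh, rfl⟩)

/-- Expand `(f - f(p)) (h - h(p))`. This is the Leibniz rule for linear forms that vanish on
`cotangentKer`. -/
lemma mul_sub_mem_cotangentKer (f h : M.Functions) :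
    f * h - (M.evalAt p h • f + M.evalAt p f • h) ∈ cotangentKer M p := by
  have h1 : (f - algebraMap ℝ _ (M.evalAt p f)) * (h - algebraMap ℝ _ (M.evalAt p h)) ∈
      cotangentKer M p := mul_mem_cotangentKer (by simp) (by simp)
  have h2 := sub_mem h1 (algebraMap_mem_cotangentKer (M.evalAt p f * M.evalAt p h))
  convert h2 using 1
  rw [sub_mul, mul_sub, mul_sub, ← Algebra.commutes, ← Algebra.smul_def, ← Algebra.smul_def,
    ← map_mul]
  abel

lemma sigma_mem_cotangentKer {f : M.Functions} (hf : f ∈ cotangentKer M p) :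
    M.sigma ⊤ f ∈ cotangentKer M p := by
  have hle : cotangentKer M p ≤ (cotangentKer M p).comap (M.sigma ⊤).toLinearMap := by
    refine Submodule.span_le.2 ?_
    rintro x (rfl | ⟨g, h, hg, hh, rfl⟩)
    · simp only [SetLike.mem_coe, Submodule.mem_comap, AlgHom.toLinearMap_apply, map_one]
      exact one_mem_cotangentKer
    · simp only [SetLike.mem_coe, Submodule.mem_comap, AlgHom.toLinearMap_apply, map_mul]
      exact mul_mem_cotangentKer (by rwa [evalAt_sigma]) (by rwa [evalAt_sigma])
  exact hle hf

/-- If `b` is a cut-off supported in `W` with `b = 1` near `p`, then `f = (1 - b) f`, a product of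
two factors vanishing at `p`. -/
lemma mem_cotangentKer_of_res {W : Opens M.space} (hp : p ∈ W) {f : M.Functions}
    (hf : sectionRes M.space (le_top : W ≤ ⊤) f = 0) : f ∈ cotangentKer M p := by
  obtain ⟨b, -, ⟨B, hpB, hB⟩, B', hUB, hB'⟩ := exists_cutoff p W hp
  have hb : b * f = 0 := by
    refine section_ext fun q _ => ?_
    have hq : q ∈ W ⊔ B' := by rw [hUB]; trivial
    rcases hq with hq | hq
    · exact ⟨W, le_top, hq, by rw [map_mul, hf, mul_zero, map_zero]⟩
    · exact ⟨B', le_top, hq, by rw [map_mul, hB', zero_mul, map_zero]⟩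
  have h1 : (1 - b) * f = f := by rw [sub_mul, one_mul, hb, sub_zero]
  rw [← h1]
  refine mul_mem_cotangentKer ?_ ?_
  · rw [map_sub, evalAt_eq_of_res hpB (hB.trans (map_one _).symm), map_one, sub_self]
  · rw [evalAt_eq_of_res hp (hf.trans (map_zero _).symm), map_zero]

variable {K : Submodule ℝ M.Functions}

lemma mul_mem_of_cotangentKer_le (hK : cotangentKer M p ≤ K) {f h : M.Functions} (hf : f ∈ K)
    (hh : h ∈ K) : f * h ∈ K := by
  have := K.add_mem (hK (mul_sub_mem_cotangentKer (p := p) f h))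
    (K.add_mem (K.smul_mem (M.evalAt p h) hf) (K.smul_mem (M.evalAt p f) hh))
  rwa [sub_add_cancel] at this

/-- The sections with the germ at `p` of an element of `K`. -/
def germSubalgebra (hK : cotangentKer M p ≤ K) {V : Opens M.space} (hp : p ∈ V) :
    Subalgebra ℝ (Sections M.space V) where
  carrier := {s | ∃ g ∈ K, ∃ (W : Opens M.space) (i : W ≤ V), p ∈ W ∧
    sectionRes M.space le_top g = sectionRes M.space i s}
  algebraMap_mem' c := ⟨algebraMap ℝ _ c, hK (algebraMap_mem_cotangentKer c), V, le_rfl, hp, by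
    rw [AlgHom.commutes, AlgHom.commutes]⟩
  add_mem' := by
    rintro s s' ⟨g, hg, W, i, hW, e⟩ ⟨g', hg', W', i', hW', e'⟩
    refine ⟨g + g', K.add_mem hg hg', W ⊓ W', inf_le_left.trans i, ⟨hW, hW'⟩, ?_⟩
    have h1 := congrArg (sectionRes M.space (inf_le_left : W ⊓ W' ≤ W)) e
    have h2 := congrArg (sectionRes M.space (inf_le_right : W ⊓ W' ≤ W')) e'
    rw [sectionRes_sectionRes, sectionRes_sectionRes] at h1 h2
    rw [map_add, map_add, h1, h2]
  mul_mem' := by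
    rintro s s' ⟨g, hg, W, i, hW, e⟩ ⟨g', hg', W', i', hW', e'⟩
    refine ⟨g * g', mul_mem_of_cotangentKer_le hK hg hg', W ⊓ W', inf_le_left.trans i,
      ⟨hW, hW'⟩, ?_⟩
    have h1 := congrArg (sectionRes M.space (inf_le_left : W ⊓ W' ≤ W)) e
    have h2 := congrArg (sectionRes M.space (inf_le_right : W ⊓ W' ≤ W')) e'
    rw [sectionRes_sectionRes, sectionRes_sectionRes] at h1 h2
    rw [map_mul, map_mul, h1, h2]

lemma mem_of_res_mem_germSubalgebra (hK : cotangentKer M p ≤ K) {V : Opens M.space} (hp : p ∈ V)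
    {f : M.Functions} (hf : sectionRes M.space (le_top : V ≤ ⊤) f ∈ germSubalgebra hK hp) :
    f ∈ K := by
  obtain ⟨g, hg, W, i, hW, e⟩ := hf
  rw [sectionRes_sectionRes] at e
  have : f - g ∈ K := hK (mem_cotangentKer_of_res hW (by rw [map_sub, e, sub_self]))
  have := K.add_mem this hg
  rwa [sub_add_cancel] at this

lemma mem_germSubalgebra_of_res (hK : cotangentKer M p ≤ K) {V : Opens M.space} (hp : p ∈ V)
    {s s' : Sections M.space V} (hs : s ∈ germSubalgebra hK hp) {W : Opens M.space} (i : W ≤ V)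
    (hW : p ∈ W) (e : sectionRes M.space i s = sectionRes M.space i s') :
    s' ∈ germSubalgebra hK hp := by
  obtain ⟨g, hg, W', i', hW', e'⟩ := hs
  refine ⟨g, hg, W ⊓ W', inf_le_left.trans i, ⟨hW, hW'⟩, ?_⟩
  have h1 := congrArg (sectionRes M.space (inf_le_left : W ⊓ W' ≤ W)) e
  have h2 := congrArg (sectionRes M.space (inf_le_right : W ⊓ W' ≤ W')) e'
  rw [sectionRes_sectionRes, sectionRes_sectionRes] at h1 h2
  rw [h2, h1]

/-- The second factor is unrestricted: if `g(p) = 0`, then `g h` equals `h(p) g` modulo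
`cotangentKer`. This absorbs the unknown coefficients in Hadamard's lemma. -/
lemma mul_mem_germSubalgebra (hK : cotangentKer M p ≤ K) {V : Opens M.space} (hp : p ∈ V)
    {s s' : Sections M.space V} (hs : s ∈ germSubalgebra hK hp) (h0 : M.value p V hp s = 0) :
    s * s' ∈ germSubalgebra hK hp := by
  obtain ⟨g, hg, W, i, hW, e⟩ := hs
  obtain ⟨h, W', i', hW', e'⟩ := exists_extension s' p hp
  refine ⟨g * h, ?_, W ⊓ W', inf_le_left.trans i, ⟨hW, hW'⟩, ?_⟩
  · have hg0 : M.evalAt p g = 0 := by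
      have := congrArg (M.value p W hW) e
      rw [M.value_res, M.value_res, h0] at this
      exact this
    have := K.add_mem (hK (mul_sub_mem_cotangentKer (p := p) g h))
      (K.smul_mem (M.evalAt p h) hg)
    rwa [hg0, zero_smul, add_zero, sub_add_cancel] at this
  · have h1 := congrArg (sectionRes M.space (inf_le_left : W ⊓ W' ≤ W)) e
    have h2 := congrArg (sectionRes M.space (inf_le_right : W ⊓ W' ≤ W')) e'
    rw [sectionRes_sectionRes, sectionRes_sectionRes] at h1 h2
    rw [map_mul, map_mul, h1, h2]

end Supermanifold


/-! ### Coordinates near a point and existence of a cotangent frame -/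

namespace Supermanifold

variable {M : Supermanifold.{u}}

section Chart

variable (M) in
/-- A neighbourhood of `p` over which `M` has a chart and a trivialization. -/
def chartDomain (p : M.space) : Opens M.space :=
  M.trivDomain p ⊓ ⟨_, (chartAt (EuclideanSpace ℝ (Fin M.evenDim)) p).open_source⟩

variable (p : M.space)

lemma mem_chartDomain : p ∈ M.chartDomain p := ⟨M.mem_trivDomain p, mem_chart_source _ p⟩

lemma chartDomain_le : M.chartDomain p ≤ M.trivDomain p := inf_le_left

/-- A smooth function of the coordinates at `p`. -/
def chartFun (F : EuclideanSpace ℝ (Fin M.evenDim) → ℝ) (hF : ContDiff ℝ ∞ F) :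
    Smooth (D := M.evenDim) (M.chartDomain p) :=
  ⟨fun x => F (chartAt _ p x), fun x =>
    hF.contMDiff.contMDiffAt.comp x (((contMDiffAt_of_mem_maximalAtlas
      (IsManifold.chart_mem_maximalAtlas p) x.2.2)).comp x
      contMDiff_subtype_val.contMDiffAt)⟩

lemma exists_chartFun (a : Smooth (D := M.evenDim) (M.chartDomain p)) :
    ∃ (F : EuclideanSpace ℝ (Fin M.evenDim) → ℝ) (hF : ContDiff ℝ ∞ F) (W : Opens M.space),
      p ∈ W ∧ ∀ x : M.chartDomain p, x.1 ∈ W → a x = chartFun p F hF x := by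
  classical
  set φ := chartAt (EuclideanSpace ℝ (Fin M.evenDim)) p with hφ
  let ã : M.space → ℝ := fun x => if h : x ∈ M.chartDomain p then a ⟨x, h⟩ else 0
  have hã : ∀ x : M.chartDomain p, ã x = a x := fun x => dif_pos x.2
  have hsm : ∀ x ∈ M.chartDomain p, ContMDiffAt (𝓡 M.evenDim) 𝓘(ℝ, ℝ) ∞ ã x := by
    intro x hx
    refine (contMDiffAt_subtype_iff (U := M.chartDomain p) (x := ⟨x, hx⟩)).1 ?_
    exact (a.contMDiff.contMDiffAt).congr_of_eventuallyEq (Filter.Eventually.of_forall hã)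
  have hopen : IsOpen (φ.target ∩ φ.symm ⁻¹' M.chartDomain p) := φ.isOpen_inter_preimage_symm (M.chartDomain p).2
  have hmem : φ p ∈ φ.target ∩ φ.symm ⁻¹' M.chartDomain p :=
    ⟨φ.map_source (mem_chart_source _ p), by
      rw [Set.mem_preimage, φ.left_inv (mem_chart_source _ p)]
      exact mem_chartDomain p⟩
  obtain ⟨r, hr, hball⟩ := Metric.isOpen_iff.1 hopen _ hmem
  -- The function is smooth in coordinates on the ball of radius `r`. The bump is 1 on radius `r /
  -- 4`, where agreement is claimed, and its support, of radius `r / 2`, stays inside.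
  let χ : ContDiffBump (φ p) := ⟨r / 4, r / 2, by positivity, by linarith⟩
  have hF : ContDiff ℝ ∞ fun x => χ x * ã (φ.symm x) := by
    rw [contDiff_iff_contDiffAt]
    intro x
    by_cases hx : x ∈ Metric.ball (φ p) r
    · refine χ.contDiff.contDiffAt.mul ?_
      rw [← contMDiffAt_iff_contDiffAt]
      exact (hsm _ (hball hx).2).comp x (contMDiffAt_symm_of_mem_maximalAtlas
        (IsManifold.chart_mem_maximalAtlas p) (hball hx).1)
    · have hx' : x ∈ (tsupport χ)ᶜ := by
        rw [χ.tsupport_eq]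
        intro h
        refine hx (Metric.closedBall_subset_ball (by change r / 2 < r; linarith) h)
      refine (contDiffAt_const (c := (0 : ℝ))).congr_of_eventuallyEq ?_
      filter_upwards [(isClosed_tsupport χ).isOpen_compl.mem_nhds hx'] with y hy
      rw [image_eq_zero_of_notMem_tsupport hy, zero_mul]
  refine ⟨_, hF, ⟨φ.source ∩ φ ⁻¹' Metric.ball (φ p) (r / 4),
    φ.isOpen_inter_preimage Metric.isOpen_ball⟩, ⟨mem_chart_source _ p,
    Metric.mem_ball_self (by positivity)⟩, fun x hx => ?_⟩
  change a x = χ (φ x) * ã (φ.symm (φ x))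
  rw [φ.left_inv hx.1, hã, χ.one_of_mem_closedBall (Metric.ball_subset_closedBall hx.2), one_mul]

/-- The coordinates that vanish at `p`. -/
def chartCoord (i : Fin M.evenDim) : Smooth (D := M.evenDim) (M.chartDomain p) :=
  chartFun p (fun x => x i - chartAt (EuclideanSpace ℝ (Fin M.evenDim)) p p i) (by fun_prop)

lemma chartFun_eq_sum (F : EuclideanSpace ℝ (Fin M.evenDim) → ℝ) (hF : ContDiff ℝ ∞ F) :
    ∃ (c : ℝ) (h : Fin M.evenDim → Smooth (D := M.evenDim) (M.chartDomain p)),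
      chartFun p F hF = algebraMap ℝ _ c + ∑ i, chartCoord p i * h i := by
  set φ := chartAt (EuclideanSpace ℝ (Fin M.evenDim)) p with hφ
  obtain ⟨H, hH, hFH⟩ := exists_eq_add_apply_sub F hF (φ p)
  refine ⟨F (φ p), fun i => chartFun p (fun x => H x (EuclideanSpace.single i 1))
    (hH.clm_apply contDiff_const), ?_⟩
  ext x
  have hsum : ∀ g : Fin M.evenDim → Smooth (D := M.evenDim) (M.chartDomain p),
      (∑ i, g i) x = ∑ i, g i x := fun g =>
    map_sum (smoothEval (D := M.evenDim) x.1 x.2) g Finset.univ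
  change F (φ x) = F (φ p) + (∑ i, _ : Smooth (D := M.evenDim) (M.chartDomain p)) x
  rw [hFH (φ x), hsum]
  congr 1
  conv_lhs => rw [← (EuclideanSpace.basisFun (Fin M.evenDim) ℝ).sum_repr (φ x - φ p)]
  rw [map_sum]
  refine Finset.sum_congr rfl fun i _ => ?_
  rw [map_smul, EuclideanSpace.basisFun_apply, EuclideanSpace.basisFun_repr]
  rfl

/-- The homogeneous coordinates at `p`. -/
def coordSection : Fin M.evenDim ⊕ Fin M.oddDim → Sections M.space (M.chartDomain p)
  | .inl i => ((M.triv p).equiv _ (chartDomain_le p)).symm (chartCoord p i ⊗ₜ 1)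
  | .inr j => ((M.triv p).equiv _ (chartDomain_le p)).symm
      (1 ⊗ₜ ExteriorAlgebra.ι ℝ (Pi.single j 1))

variable (M) in
/-- The parities of the coordinates. -/
def coordDeg : Fin M.evenDim ⊕ Fin M.oddDim → ZMod 2 := Sum.elim (fun _ => 0) (fun _ => 1)

lemma coordSection_mem (j : Fin M.evenDim ⊕ Fin M.oddDim) :
    coordSection p j ∈ M.parity _ (M.coordDeg j) := by
  rw [mem_parity_iff]
  apply ((M.triv p).equiv _ (chartDomain_le p)).injective
  rw [Trivialization.equiv_sigma, map_smul]
  rcases j with i | j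
  · rw [coordSection, AlgEquiv.apply_symm_apply, modelSigma_tmul, map_one]
    simp [coordDeg]
  · rw [coordSection, AlgEquiv.apply_symm_apply, modelSigma_tmul]
    have : grassmannSigma M.oddDim (ExteriorAlgebra.ι ℝ (Pi.single j 1)) =
      -ExteriorAlgebra.ι ℝ (Pi.single j 1) := CliffordAlgebra.involute_ι _
    rw [this, TensorProduct.tmul_neg]
    change _ = sgn 1 • _
    rw [sgn_one]
    exact (neg_one_smul ℝ _).symm

/-- By Hadamard's lemma a smooth germ is a constant plus a combination of coordinates vanishing at
`p`; the odd coordinates generate the Grassmann factor. Both kinds of generators lie in the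
subalgebra. -/
lemma germSubalgebra_eq_top {K : Submodule ℝ M.Functions} (hK : cotangentKer M p ≤ K)
    (h : ∀ j, coordSection p j ∈ germSubalgebra hK (mem_chartDomain p)) :
    germSubalgebra hK (mem_chartDomain p) = ⊤ := by
  set A := germSubalgebra hK (mem_chartDomain p) with hA
  set e := (M.triv p).equiv _ (chartDomain_le p) with he
  have hsmooth : ∀ a : Smooth (D := M.evenDim) (M.chartDomain p), e.symm (a ⊗ₜ 1) ∈ A := by
    intro a
    obtain ⟨F, hF, W, hpW, hW⟩ := exists_chartFun p a
    refine mem_germSubalgebra_of_res hK (mem_chartDomain p) (s := e.symm (chartFun p F hF ⊗ₜ 1))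
      ?_ (inf_le_left : M.chartDomain p ⊓ W ≤ _) ⟨mem_chartDomain p, hpW⟩ ?_
    · obtain ⟨c, g, hg⟩ := chartFun_eq_sum p F hF
      rw [hg, TensorProduct.add_tmul, TensorProduct.sum_tmul, map_add, map_sum]
      refine A.add_mem ?_ (A.sum_mem fun i _ => ?_)
      · have : e.symm (algebraMap ℝ (Smooth (D := M.evenDim) (M.chartDomain p)) c ⊗ₜ 1) =
            algebraMap ℝ _ c := e.symm.commutes c
        rw [this]
        exact A.algebraMap_mem c
      · have : (chartCoord p i * g i) ⊗ₜ[ℝ] (1 : Grassmann M.oddDim) =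
            (chartCoord p i ⊗ₜ 1) * (g i ⊗ₜ 1) := by
          rw [Algebra.TensorProduct.tmul_mul_tmul, one_mul]
        rw [this, map_mul]
        refine mul_mem_germSubalgebra hK _ (h (.inl i)) ?_
        rw [← value_eq_modelEval (M.triv p) (chartDomain_le p),
          AlgEquiv.apply_symm_apply]
        change (_ - _ : ℝ) * augmentation _ 1 = 0
        rw [sub_self, zero_mul]
    · apply ((M.triv p).equiv _ (inf_le_left.trans (chartDomain_le p))).injective
      rw [(M.triv p).equiv_res _ _ (chartDomain_le p), (M.triv p).equiv_res _ _ (chartDomain_le p),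
        AlgEquiv.apply_symm_apply, AlgEquiv.apply_symm_apply, modelRes_tmul, modelRes_tmul]
      congr 1
      ext x
      exact (hW ⟨x.1, x.2.1⟩ x.2.2).symm
  have hodd : ∀ b : Grassmann M.oddDim, e.symm (1 ⊗ₜ b) ∈ A := by
    intro b
    induction b using ExteriorAlgebra.induction with
    | algebraMap c =>
      have : (1 : Smooth (D := M.evenDim) (M.chartDomain p)) ⊗ₜ[ℝ]
          algebraMap ℝ (Grassmann M.oddDim) c = algebraMap ℝ _ c :=
        (Algebra.TensorProduct.algebraMap_apply' c).symm
      rw [this, AlgEquiv.commutes]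
      exact A.algebraMap_mem c
    | ι x =>
      have hx : ExteriorAlgebra.ι ℝ x = ∑ j, x j • ExteriorAlgebra.ι ℝ (Pi.single j 1) := by
        conv_lhs => rw [pi_eq_sum_univ' x]
        rw [map_sum]
        refine Finset.sum_congr rfl fun j _ => ?_
        rw [map_smul]
      rw [hx, TensorProduct.tmul_sum, map_sum]
      refine A.sum_mem fun j _ => ?_
      rw [TensorProduct.tmul_smul, map_smul]
      exact A.smul_mem (h (.inr j)) _
    | mul a b ha hb =>
      have : (1 : Smooth (D := M.evenDim) (M.chartDomain p)) ⊗ₜ[ℝ] (a * b) =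
          (1 ⊗ₜ a) * (1 ⊗ₜ b) := by
        rw [Algebra.TensorProduct.tmul_mul_tmul, one_mul]
      rw [this, map_mul]
      exact A.mul_mem ha hb
    | add a b ha hb =>
      rw [TensorProduct.tmul_add, map_add]
      exact A.add_mem ha hb
  rw [eq_top_iff]
  intro s _
  obtain ⟨τ, rfl⟩ := e.symm.surjective s
  induction τ using TensorProduct.induction_on with
  | zero => rw [map_zero]; exact A.zero_mem
  | add a b ha hb =>
    rw [map_add]
    exact A.add_mem (ha trivial) (hb trivial)
  | tmul a b =>
    have : a ⊗ₜ[ℝ] b = (a ⊗ₜ 1) * (1 ⊗ₜ b) := by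
      rw [Algebra.TensorProduct.tmul_mul_tmul, one_mul, mul_one]
    rw [this, map_mul]
    exact A.mul_mem (hsmooth a) (hodd b)

lemma exists_homogeneous_generators :
    ∃ y : Fin M.evenDim ⊕ Fin M.oddDim → M.Functions, (∀ j, y j ∈ M.parity ⊤ (M.coordDeg j)) ∧
      cotangentKer M p ⊔ Submodule.span ℝ (Set.range y) = ⊤ := by
  choose y hy W i hW e using fun j =>
    exists_extension_parity (coordSection p j) (coordSection_mem p j) p (mem_chartDomain p)
  refine ⟨y, hy, eq_top_iff.2 fun f _ => ?_⟩
  have hK : cotangentKer M p ≤ cotangentKer M p ⊔ Submodule.span ℝ (Set.range y) := le_sup_left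
  refine mem_of_res_mem_germSubalgebra hK (mem_chartDomain p) ?_
  rw [germSubalgebra_eq_top p hK]
  · trivial
  · exact fun j => ⟨y j, Submodule.mem_sup_right (Submodule.subset_span ⟨j, rfl⟩), W j, i j, hW j,
      e j⟩

/-- Homogeneous coordinates span the superfunctions modulo `cotangentKer`. A basis of this quotient
chosen among their classes has a dual basis consisting of homogeneous point derivations. -/
theorem exists_cotangentFrame : Nonempty (CotangentFrame M p) := by
  classical
  obtain ⟨y, hy, htop⟩ := exists_homogeneous_generators p
  set L := cotangentKer M p with hL
  -- Extracting a basis avoids proving the coordinates independent and keeps homogeneous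
  -- representatives.
  obtain ⟨κ, a, ha, hspan, hli⟩ := exists_linearIndependent' ℝ (L.mkQ ∘ y)
  have hfin : Fintype κ := Fintype.ofInjective a ha
  have hbtop : ⊤ ≤ Submodule.span ℝ (Set.range ((L.mkQ ∘ y) ∘ a)) := by
    rw [hspan, Set.range_comp, ← Submodule.map_span]
    intro q _
    obtain ⟨f, rfl⟩ := L.mkQ_surjective q
    have hf : f ∈ L ⊔ Submodule.span ℝ (Set.range y) := by rw [htop]; trivial
    obtain ⟨l, hl, g, hg, rfl⟩ := Submodule.mem_sup.1 hf
    refine ⟨g, hg, ?_⟩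
    rw [map_add, Submodule.mkQ_apply L l, (Submodule.Quotient.mk_eq_zero L).2 hl, zero_add]
  let b := Module.Basis.mk hli hbtop
  let v : κ → M.Functions →ₗ[ℝ] ℝ := fun i => b.coord i ∘ₗ L.mkQ
  have hv0 : ∀ i, ∀ f ∈ L, v i f = 0 := by
    intro i f hf
    change b.coord i (L.mkQ f) = 0
    rw [Submodule.mkQ_apply, (Submodule.Quotient.mk_eq_zero L).2 hf, map_zero]
  have hvy : ∀ i j, v i (y (a j)) = if i = j then 1 else 0 := by
    intro i j
    have : L.mkQ (y (a j)) = b j := by simp [b]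
    change b.coord i (L.mkQ (y (a j))) = _
    rw [this, Module.Basis.coord_apply, Module.Basis.repr_self, Finsupp.single_apply]
    simp only [eq_comm]
  have hexp : ∀ f, f - ∑ i, v i f • y (a i) ∈ L := by
    intro f
    rw [← Submodule.Quotient.mk_eq_zero, ← Submodule.mkQ_apply, map_sub, map_sum, sub_eq_zero]
    conv_lhs => rw [← b.sum_repr (L.mkQ f)]
    refine Finset.sum_congr rfl fun i _ => ?_
    rw [map_smul]
    simp [b, v]
  refine ⟨⟨κ, fun i => M.coordDeg (a i), fun i => y (a i), fun i => hy _, v, fun i => ⟨?_, ?_⟩,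
    hexp⟩⟩
  -- Since `cotangentKer` is stable under σ, the sign rule need only be checked on the frame part of
  -- `f`, where each generator is homogeneous.
  · intro f
    have h1 := hv0 i _ (sigma_mem_cotangentKer (hexp f))
    rw [map_sub, map_sub, sub_eq_zero] at h1
    rw [h1, map_sum, map_sum, Finset.sum_eq_single i]
    · rw [map_smul, mem_parity_iff.1 (hy (a i)), map_smul, map_smul, hvy, if_pos rfl]
      simp [mul_comm]
    · intro j _ hj
      rw [map_smul, mem_parity_iff.1 (hy (a j)), map_smul, map_smul, hvy, if_neg (Ne.symm hj)]
      simp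
    · simp
  · intro f h
    have h1 := hv0 i _ (mul_sub_mem_cotangentKer f h)
    rw [map_sub, map_add, map_smul, map_smul, sub_eq_zero] at h1
    rw [h1, smul_eq_mul, smul_eq_mul]
    ring

end Chart

end Supermanifold


namespace Supermanifold

/-! ### Superpoints -/

variable (S : Supermanifold.{u})

/-- The supermanifold `S × ℝ^{0|n}`. -/
def extPow : ℕ → Supermanifold.{u}
  | 0 => S
  | n + 1 => (extPow n).ext

/-- The projection `S × ℝ^{0|n} → S`. -/
def extPowProj : ∀ n, S.extPow n ⟶ S
  | 0 => 𝟙 S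
  | n + 1 => (S.extPow n).extProj ≫ extPowProj n

/-- The zero section `S → S × ℝ^{0|n}`. -/
def extPowZero : ∀ n, S ⟶ S.extPow n
  | 0 => 𝟙 S
  | n + 1 => extPowZero n ≫ (S.extPow n).extZero

variable {S} {M : Supermanifold.{u}}

/-- The superfunctions on `ℝ^{0|n}`, as superfunctions on `S × ℝ^{0|n}`. -/
lemma exists_grassmannHom (s : S.space) (n : ℕ) :
    ∃ c : Grassmann n →ₐ[ℝ] (S.extPow n).Functions,
      (∀ a, c (grassmannSigma n a) = (S.extPow n).sigma ⊤ (c a)) ∧ Function.Injective c ∧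
      (∀ a, pullback (S.extPowZero n) (c a) = algebraMap ℝ _ (augmentation n a)) ∧
      ∀ x a, (S.extPow n).evalAt x (c a) = augmentation n a := by
  induction n with
  | zero =>
    refine ⟨(Algebra.ofId ℝ S.Functions).comp (augmentation 0), fun a => ?_, fun a b h => ?_,
      fun a => rfl, fun x a => (S.evalAt x).commutes _⟩
    · refine Eq.trans ?_ ((S.sigma ⊤).commutes _).symm
      exact congrArg (algebraMap ℝ S.Functions) (augmentation_sigma a)
    -- Only here is the point `s` needed: if S were empty, the constants would collapse.
    · have h1 := congrArg (S.evalAt s) h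
      have h2 : ∀ a : Grassmann 0, S.evalAt s
          (((Algebra.ofId ℝ S.Functions).comp (augmentation 0)) a) = augmentation 0 a :=
        fun a => (S.evalAt s).commutes _
      rw [grassmann_zero_eq a, grassmann_zero_eq b, (h2 a).symm.trans (h1.trans (h2 b))]
  | succ n ih =>
    obtain ⟨c, hσ, hinj, hzero, heval⟩ := ih
    let d : Grassmann (n + 1) →ₐ[ℝ] (S.extPow (n + 1)).Functions :=
      (S.extPow n).extEquiv.symm.toAlgHom.comp
        ((OddExt.map (τ := (S.extPow n).sigma ⊤) c hσ).comp (grassmannSuccEquiv n).toAlgHom)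
    have hd : ∀ a, (S.extPow n).extEquiv (d a) =
      OddExt.map (τ := (S.extPow n).sigma ⊤) c hσ (grassmannSuccEquiv n a) := fun a => rfl
    refine ⟨d, fun a => ?_, fun a b h => ?_, fun a => ?_, fun x a => ?_⟩
    · apply (S.extPow n).extEquiv.injective
      refine Eq.trans ?_ (extEquiv_sigma (M := S.extPow n) (d a)).symm
      rw [hd, hd, grassmannSuccEquiv_sigma, OddExt.map_sigma]
    · apply (grassmannSuccEquiv n).injective
      have h1 := congrArg (S.extPow n).extEquiv h
      rw [hd, hd] at h1
      exact OddExt.ext (hinj (congrArg Prod.fst h1)) (hinj (congrArg Prod.snd h1))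
    · rw [← augmentation_succ, ← hzero]
      exact congrArg (pullback (S.extPowZero n)) (pullback_extZero (M := S.extPow n) (d a))
    · rw [← augmentation_succ]
      exact (ext_evalAt (M := S.extPow n) x (d a)).trans (heval x _)

/-- The Taylor expansion in the odd coordinates at the point `p`, in the trivialization at `x`. -/
def oddJet (x p : M.space) (hp : p ∈ M.trivDomain x) : M.Functions →ₐ[ℝ] Grassmann M.oddDim :=
  (modelCoeff (D := M.evenDim) M.oddDim p hp).comp
    (((M.triv x).equiv _ le_rfl).toAlgHom.comp (sectionRes M.space le_top))

lemma eq_zero_of_oddJet (f : M.Functions) (h : ∀ x p hp, oddJet (M := M) x p hp f = 0) :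
    f = 0 := by
  refine section_ext fun x _ => ⟨M.trivDomain x, le_top, M.mem_trivDomain x, ?_⟩
  apply ((M.triv x).equiv _ le_rfl).injective
  rw [map_zero, map_zero]
  exact model_eq_zero_of_modelCoeff _ fun p hp => h x p hp

/-- Superpoints of `M` detect its superfunctions. -/
lemma exists_superpoint (s : S.space) (x p : M.space) (hp : p ∈ M.trivDomain x) :
    ∃ q : S.extPow M.oddDim ⟶ M, S.extPowZero M.oddDim ≫ q = const S p ∧
      ∀ f, pullback q f = 0 → oddJet x p hp f = 0 := by
  obtain ⟨c, hσ, hinj, hzero, heval⟩ := exists_grassmannHom s M.oddDim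
  have haug : ∀ f, augmentation M.oddDim (oddJet x p hp f) = M.evalAt p f := by
    intro f
    refine (augmentation_modelCoeff p hp _).trans ?_
    refine (value_eq_modelEval (M.triv x) le_rfl p hp _).trans ?_
    exact M.value_res p le_top hp f
  -- The superpoint is the odd Taylor expansion at `p`, read in the superfunctions of ℝ^{0|n}. The
  -- latter step is injective, so nothing of the jet is lost.
  obtain ⟨q, hq⟩ := exists_hom (M := S.extPow M.oddDim) (fun _ => p) (c.comp (oddJet x p hp))
    contMDiff_const (fun y f => (heval y _).trans (haug f)) (fun f => by
      refine Eq.trans (congrArg c ?_) (hσ _)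
      refine Eq.trans ?_ (modelCoeff_sigma p hp _)
      refine congrArg (modelCoeff M.oddDim p hp) ?_
      exact (congrArg ((M.triv x).equiv _ le_rfl) (sigma_res _ f)).trans
        ((M.triv x).equiv_sigma _ le_rfl _))
  refine ⟨q, hom_ext_pullback fun f => ?_, fun f hf => ?_⟩
  · rw [pullback_comp, hq, pullback_const, ← haug f]
    exact hzero _
  · rw [hq] at hf
    exact hinj (hf.trans (map_zero c).symm)

lemma eq_xi_add (F : S.ext.Functions) : F = pullback S.extProj (S.extEquiv F).1 +
    xi S 1 * pullback S.extProj (S.extEquiv F).2 := by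
  apply S.extEquiv.injective
  rw [map_add, map_mul, extEquiv_pullback_extProj, extEquiv_pullback_extProj, extEquiv_xi]
  refine OddExt.ext ?_ ?_
  · change _ = _ + 0 * _
    simp
  · change _ = 0 + (S.sigma ⊤ 0 * 0 + 1 * _)
    simp

lemma xi_one_mem : xi S 1 ∈ S.ext.parity ⊤ 1 :=
  have h : (1 : S.Functions) ∈ S.parity ⊤ 0 := SetLike.GradedOne.one_mem
  ⟨zero_mem _, h⟩

end Supermanifold

open Supermanifold

namespace SuperAction

variable {𝒢 : LieSupergroup.{u}} {M S S' : Supermanifold.{u}} (Ψ : SuperAction 𝒢 M)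
  (B : CotangentFrame 𝒢.G 𝒢.e)

open LieSupergroup

/-! ### Superfunctions that are constant along the group -/

/-- Setting one odd variable to zero in the group component changes the pullback of `H` by that
variable times a combination of pullbacks of `(X_i ⊗ id) H`, all zero. The morphism `χ` keeps the
variable in `m` untouched. -/
lemma pullback_pair_extProj_extZero {H : Ψ.prod.pt.Functions}
    (hH : ∀ i, tensorId Ψ.prod (invariantDer (B.isPointDerivation i)) H = 0)
    (χ : S' ⟶ S.ext) (g : S.ext ⟶ 𝒢.G) (m : S' ⟶ M) :
    Supermanifold.pullback (pair Ψ.isLimit (χ ≫ g) m) H =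
      Supermanifold.pullback (pair Ψ.isLimit (χ ≫ S.extProj ≫ S.extZero ≫ g) m) H := by
  obtain ⟨a, ha, hY⟩ := exists_eq_sum_invariantDer B (isDerivationAlong_oddPart g)
  have hone : ∀ k : ZMod 2, 1 + k + k = 1 := fun k => by
    rw [add_assoc, zmod_two_add_self, add_zero]
  set ψ := χ ≫ S.extProj with hψ
  set q := pair Ψ.isLimit (χ ≫ S.extProj ≫ S.extZero ≫ g) m with hq
  have hqf : q ≫ prFst Ψ.prod = ψ ≫ S.extZero ≫ g := by
    rw [hq, pair_prFst, hψ, Category.assoc]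
  -- A derivation along `q` with components (pullback of the odd part of `g`, 0), so that `q + ξR`
  -- moves only the group component.
  let R : Ψ.prod.pt.Functions →ₗ[ℝ] S'.Functions := ∑ i,
    LinearMap.mulLeft ℝ (Supermanifold.pullback ψ (a i)) ∘ₗ (Supermanifold.pullback q).toLinearMap ∘ₗ
      tensorId Ψ.prod (invariantDer (B.isPointDerivation i))
  have hR : ∀ F, R F = ∑ i, Supermanifold.pullback ψ (a i) *
      Supermanifold.pullback q (tensorId Ψ.prod (invariantDer (B.isPointDerivation i)) F) := by
    intro F
    simp [R, LinearMap.sum_apply]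
  have hl := fun i => isLift_tensorId Ψ.isLimit
    (𝒢.leftMul.isSuperderivation_fundamental (B.isPointDerivation i))
  have hRd : IsDerivationAlong q 1 R := IsDerivationAlong.sum _ fun i _ => by
    have h1 := (((hl i).isDerivationAlong.precomp q).congr (Category.comp_id q)).mulLeft
      (pullback_mem_parity ψ (ha i))
    rwa [hone] at h1
  have hR1 : ∀ f, R (Supermanifold.pullback (prFst Ψ.prod) f) =
      Supermanifold.pullback ψ (oddPart g f) := by
    intro f
    rw [hR, hY, map_sum]
    refine Finset.sum_congr rfl fun i _ => ?_
    rw [map_mul, (hl i).fst, ← pullback_comp, ← hqf]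
    rfl
  have hR2 : ∀ f, R (Supermanifold.pullback (prSnd Ψ.prod) f) = 0 := by
    intro f
    rw [hR]
    refine Finset.sum_eq_zero fun i _ => ?_
    rw [(hl i).snd, LinearMap.zero_apply, map_zero, mul_zero]
  obtain ⟨Θ, hΘ⟩ := hRd.exists_hom
  -- Substituting the odd superfunction `χ^♯(ξ)` for the new variable turns `q + ξR` back into `(g ∘
  -- χ, m)`.
  obtain ⟨Γ, hΓ⟩ := exists_extGraph (pullback_mem_parity χ (xi_one_mem (S := S)))
  have hΓΘ : ∀ F, Supermanifold.pullback (Γ ≫ Θ) F =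
      Supermanifold.pullback q F + Supermanifold.pullback χ (xi S 1) * R F := by
    intro F
    rw [pullback_comp, hΓ, hΘ]
  have hχ : pair Ψ.isLimit (χ ≫ g) m = Γ ≫ Θ := by
    apply prod_hom_ext Ψ.isLimit
    · refine hom_ext_pullback fun f => ?_
      rw [pair_prFst, pullback_comp (Γ ≫ Θ), hΓΘ, hR1, ← pullback_comp q, hqf, pullback_comp χ g,
        eq_xi_add (Supermanifold.pullback g f), extEquiv_pullback, map_add, map_mul]
      rfl
    · refine hom_ext_pullback fun f => ?_
      rw [pair_prSnd, pullback_comp (Γ ≫ Θ), hΓΘ, hR2, mul_zero, add_zero, ← pullback_comp q, hq,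
        pair_prSnd]
  rw [hχ, hΓΘ, hR, Finset.sum_eq_zero, mul_zero, add_zero]
  intro i _
  rw [hH, map_zero, mul_zero]

/-- The last odd variable is removed first; generality in `χ` is what lets the induction continue
while the source S' stays fixed. -/
lemma pullback_pair_extPow {H : Ψ.prod.pt.Functions}
    (hH : ∀ i, tensorId Ψ.prod (invariantDer (B.isPointDerivation i)) H = 0) (n : ℕ)
    (χ : S' ⟶ S.extPow n) (g : S.extPow n ⟶ 𝒢.G) (m : S' ⟶ M) :
    Supermanifold.pullback (pair Ψ.isLimit (χ ≫ g) m) H =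
      Supermanifold.pullback
        (pair Ψ.isLimit (χ ≫ S.extPowProj n ≫ S.extPowZero n ≫ g) m) H := by
  induction n with
  | zero =>
    have : S.extPowProj 0 ≫ S.extPowZero 0 ≫ g = g :=
      (Category.id_comp _).trans (Category.id_comp _)
    rw [this]
  | succ n ih =>
    have key : ∀ (χ : S' ⟶ (S.extPow n).ext) (g : (S.extPow n).ext ⟶ 𝒢.G),
        Supermanifold.pullback (pair Ψ.isLimit (χ ≫ g) m) H =
          Supermanifold.pullback (pair Ψ.isLimit (χ ≫ ((S.extPow n).extProj ≫ S.extPowProj n) ≫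
            (S.extPowZero n ≫ (S.extPow n).extZero) ≫ g) m) H := by
      intro χ g
      have h := ih (χ ≫ (S.extPow n).extProj) ((S.extPow n).extZero ≫ g)
      rw [Category.assoc, Category.assoc] at h
      rw [pullback_pair_extProj_extZero Ψ B hH χ g m, h]
      simp only [Category.assoc]
    exact key χ g

lemma pullback_pair_const (g : 𝒢.G.space) (m : S ⟶ M) (H : Ψ.prod.pt.Functions) :
    Supermanifold.pullback (pair Ψ.isLimit (const S g) m) H =
      Supermanifold.pullback m (Ψ.evalFst g H) := by
  rw [evalFst, ← pullback_comp, comp_pair, comp_const, Category.comp_id]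

/-- A superfunction on `G ⊗ M` vanishes if it vanishes on `{g} ⊗ M` for all points `g` and is
killed by the invariant superderivations. -/
lemma eq_zero_of_tensorId_of_evalFst {H : Ψ.prod.pt.Functions}
    (hH : ∀ i, tensorId Ψ.prod (invariantDer (B.isPointDerivation i)) H = 0)
    (h0 : ∀ g, Ψ.evalFst g H = 0) : H = 0 := by
  refine eq_zero_of_oddJet H fun x p hp => ?_
  -- Any nonempty parameter space would do; the product itself has the point `p`.
  obtain ⟨q, hq, hjet⟩ := exists_superpoint (S := Ψ.prod.pt) p x p hp
  apply hjet
  have e : q = pair Ψ.isLimit (𝟙 _ ≫ q ≫ prFst Ψ.prod) (q ≫ prSnd Ψ.prod) :=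
    prod_hom_ext Ψ.isLimit (by rw [pair_prFst, Category.id_comp]) (by rw [pair_prSnd])
  have hc : const Ψ.prod.pt p ≫ prFst Ψ.prod =
      const Ψ.prod.pt ((Hom.map (prFst Ψ.prod)).hom.base p) :=
    hom_ext_pullback fun f => by
      rw [pullback_comp, pullback_const, pullback_const, evalAt_pullback]
  -- With its odd variables removed the group component is constant, with value the projection `g`
  -- of `p`, and the pullback factors through the restriction of `H` to {g} ⊗ M.
  rw [e, pullback_pair_extPow (S := Ψ.prod.pt) Ψ B hH _ (𝟙 _) (q ≫ prFst Ψ.prod)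
    (q ≫ prSnd Ψ.prod), Category.id_comp, ← Category.assoc (extPowZero _ _), hq, hc, comp_const,
    pullback_pair_const, h0, map_zero]

/-! ### Invariant superfunctions -/

lemma evalFst_snd (g : 𝒢.G.space) (f : M.Functions) :
    Ψ.evalFst g (Supermanifold.pullback (prSnd Ψ.prod) f) = f := by
  rw [evalFst, pullback_pair_snd, pullback_id]

lemma invariantFunction_iff (f : M.Functions) :
    Ψ.InvariantFunction f ↔
      Supermanifold.pullback Ψ.act f = Supermanifold.pullback (prSnd Ψ.prod) f := by
  change _ = Supermanifold.pullback (prFst Ψ.prod) 1 * Supermanifold.pullback (prSnd Ψ.prod) f ↔ _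
  rw [map_one, _root_.one_mul]

theorem invariantFunction_iff_bodyInvariantFunction (f : M.Functions) :
    Ψ.InvariantFunction f ↔
      Ψ.BodyInvariantFunction f ∧ ∀ X ∈ 𝒢.lieSuperalgebra, Ψ.gamma X f = 0 := by
  rw [invariantFunction_iff]
  constructor
  · intro h
    refine ⟨fun g => by rw [h, evalFst_snd], fun X hX => ?_⟩
    have : tensorId Ψ.prod X (Supermanifold.pullback (prSnd Ψ.prod) f) = 0 :=
      (isTensorId_tensorId Ψ.isLimit hX.1).snd f
    rw [gamma, h, this, map_zero]
  · rintro ⟨h0, h1⟩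
    obtain ⟨B⟩ := exists_cotangentFrame 𝒢.e
    rw [← sub_eq_zero]
    refine Ψ.eq_zero_of_tensorId_of_evalFst B (fun i => ?_) fun g => ?_
    · have e2 : tensorId Ψ.prod (invariantDer (B.isPointDerivation i))
          (Supermanifold.pullback (prSnd Ψ.prod) f) = 0 :=
        (isTensorId_tensorId Ψ.isLimit (invariantDer_mem _).1).snd f
      rw [map_sub, e2, tensorId_act, ← gamma_invariantDer, h1 _ (invariantDer_mem _), map_zero,
        sub_zero]
    · rw [map_sub, h0, evalFst_snd, sub_self]

/-! ### Invariant linear maps -/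

lemma map_one_of_mem_der {X : Module.End ℝ M.Functions} (hX : X ∈ Der M) : X 1 = 0 := by
  obtain ⟨X₀, X₁, h0, h1, rfl⟩ := exists_add_of_mem_der hX
  rw [LinearMap.add_apply, (isSuperderivation_iff.1 h0).map_one,
    (isSuperderivation_iff.1 h1).map_one, add_zero]

/-- The pairs `(F, c)` of superfunctions on `G ⊗ M` and on `G` which are combinations of
`(b ψ^♯(f), b)` and of `(b ψ^♯(γ(X) f'), 0)`, for invariant superderivations `X`. -/
def orbitSpan (f : M.Functions) : Submodule ℝ (Ψ.prod.pt.Functions × 𝒢.G.Functions) :=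
  Submodule.span ℝ
    ({x | ∃ b, x = (Supermanifold.pullback (prFst Ψ.prod) b * Supermanifold.pullback Ψ.act f, b)} ∪
     {x | ∃ b i f', x = (Supermanifold.pullback (prFst Ψ.prod) b *
        Supermanifold.pullback Ψ.act (Ψ.fundamental (B.isPointDerivation i) f'), 0)})

/-- Since `tensorId` is a choice, additivity is an instance of the uniqueness of X ⊗ id. -/
lemma tensorId_add {X Y : Module.End ℝ 𝒢.G.Functions} (hX : X ∈ Der 𝒢.G) (hY : Y ∈ Der 𝒢.G) :
    tensorId Ψ.prod (X + Y) = tensorId Ψ.prod X + tensorId Ψ.prod Y := by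
  have h1 := isTensorId_tensorId Ψ.isLimit hX
  have h2 := isTensorId_tensorId Ψ.isLimit hY
  refine tensorId_eq Ψ.isLimit (Submodule.add_mem _ hX hY)
    ⟨Submodule.add_mem _ h1.mem_der h2.mem_der, fun f => ?_, fun f => ?_⟩
  · rw [LinearMap.add_apply, LinearMap.add_apply, h1.fst, h2.fst]
    exact (map_add (Supermanifold.pullback (prFst Ψ.prod)) _ _).symm
  · rw [LinearMap.add_apply, h1.snd, h2.snd, add_zero]

/-- Write `Y = Σ a_i X_i` in the invariant frame. Then `Y ⊗ id` and `Σ a_i (X_i ⊗ id)` have the same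
components, and `tensorId_act` moves each `X_i` past ψ^♯. -/
lemma exists_tensorId_act {k : ZMod 2} {Y : Module.End ℝ 𝒢.G.Functions}
    (hY : IsSuperderivation k Y) : ∃ a : B.ι → 𝒢.G.Functions, ∀ f,
      tensorId Ψ.prod Y (Supermanifold.pullback Ψ.act f) =
        ∑ i, Supermanifold.pullback (prFst Ψ.prod) (a i) *
          Supermanifold.pullback Ψ.act (Ψ.fundamental (B.isPointDerivation i) f) := by
  obtain ⟨a, ha, h⟩ := exists_eq_sum_invariantDer B (isSuperderivation_iff.1 hY)
  have hl := fun i => isLift_tensorId Ψ.isLimit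
    (𝒢.leftMul.isSuperderivation_fundamental (B.isPointDerivation i))
  let R : Ψ.prod.pt.Functions →ₗ[ℝ] Ψ.prod.pt.Functions := ∑ i,
    LinearMap.mulLeft ℝ (Supermanifold.pullback (prFst Ψ.prod) (a i)) ∘ₗ
      tensorId Ψ.prod (invariantDer (B.isPointDerivation i))
  have hR : ∀ F, R F = ∑ i, Supermanifold.pullback (prFst Ψ.prod) (a i) *
      tensorId Ψ.prod (invariantDer (B.isPointDerivation i)) F := by
    intro F
    simp [R, LinearMap.sum_apply]
  have e : tensorId Ψ.prod Y = R := by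
    refine (isLift_tensorId Ψ.isLimit hY).unique Ψ.isLimit ⟨?_, fun f => ?_, fun f => ?_⟩
    · refine IsDerivationAlong.sum _ fun i _ => ?_
      have h1 := (hl i).isDerivationAlong.mulLeft (pullback_mem_parity (prFst Ψ.prod) (ha i))
      rwa [add_assoc, zmod_two_add_self, add_zero] at h1
    · rw [hR, LinearMap.comp_apply, h, AlgHom.toLinearMap_apply, map_sum]
      refine Finset.sum_congr rfl fun i _ => ?_
      rw [(hl i).fst, map_mul]
      rfl
    · rw [hR]
      refine Finset.sum_eq_zero fun i _ => ?_
      rw [(hl i).snd, LinearMap.zero_apply, mul_zero]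
  refine ⟨a, fun f => ?_⟩
  rw [e, hR]
  simp only [tensorId_act]

/-- In the Leibniz rule for `b ψ^♯(f')` the term differentiating `b` keeps the shape of the
generator, and the other term is a sum of generators of the second kind by `exists_tensorId_act`. -/
lemma map_mem_orbitSpan_of_isSuperderivation {k : ZMod 2} {Y : Module.End ℝ 𝒢.G.Functions}
    (hY : IsSuperderivation k Y) (f : M.Functions) {x : Ψ.prod.pt.Functions × 𝒢.G.Functions}
    (hx : x ∈ Ψ.orbitSpan B f) : (tensorId Ψ.prod Y x.1, Y x.2) ∈ Ψ.orbitSpan B f := by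
  obtain ⟨a, ha⟩ := Ψ.exists_tensorId_act B hY
  have hl := isLift_tensorId Ψ.isLimit hY
  have hmem : ∀ b i f', (Supermanifold.pullback (prFst Ψ.prod) b *
      Supermanifold.pullback Ψ.act (Ψ.fundamental (B.isPointDerivation i) f'),
      (0 : 𝒢.G.Functions)) ∈ Ψ.orbitSpan B f :=
    fun b i f' => Submodule.subset_span (Or.inr ⟨b, i, f', rfl⟩)
  have hsum : ∀ b f', (Supermanifold.pullback (prFst Ψ.prod) b *
      tensorId Ψ.prod Y (Supermanifold.pullback Ψ.act f'), (0 : 𝒢.G.Functions)) ∈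
      Ψ.orbitSpan B f := by
    intro b f'
    have e : (Supermanifold.pullback (prFst Ψ.prod) b *
        tensorId Ψ.prod Y (Supermanifold.pullback Ψ.act f'), (0 : 𝒢.G.Functions)) =
        ∑ i, (Supermanifold.pullback (prFst Ψ.prod) (b * a i) *
          Supermanifold.pullback Ψ.act (Ψ.fundamental (B.isPointDerivation i) f'),
          (0 : 𝒢.G.Functions)) := by
      rw [ha, Finset.mul_sum]
      refine Prod.ext ?_ ?_
      · rw [Prod.fst_sum]
        simp only [map_mul, _root_.mul_assoc]
      · rw [Prod.snd_sum]
        simp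
    rw [e]
    exact Submodule.sum_mem _ fun i _ => hmem _ i f'
  have hleib : ∀ b F, tensorId Ψ.prod Y (Supermanifold.pullback (prFst Ψ.prod) b * F) =
      Supermanifold.pullback (prFst Ψ.prod) (Y b) * F +
        Supermanifold.pullback (prFst Ψ.prod) ((𝒢.G.sigma ⊤ ^ k.val) b) * tensorId Ψ.prod Y F := by
    intro b F
    rw [hl.isDerivationAlong.leibniz, hl.fst, pullback_id, pullback_id, pullback_sigma_pow]
    rfl
  have hle : Ψ.orbitSpan B f ≤
      (Ψ.orbitSpan B f).comap ((tensorId Ψ.prod Y).prodMap Y) := by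
    refine Submodule.span_le.2 ?_
    rintro y (⟨b, rfl⟩ | ⟨b, i, f', rfl⟩)
    · change (tensorId Ψ.prod Y (_ * _), Y b) ∈ Ψ.orbitSpan B f
      have h1 : (Supermanifold.pullback (prFst Ψ.prod) (Y b) * Supermanifold.pullback Ψ.act f, Y b)
          ∈ Ψ.orbitSpan B f := Submodule.subset_span (Or.inl ⟨Y b, rfl⟩)
      have h2 := Submodule.add_mem _ h1 (hsum ((𝒢.G.sigma ⊤ ^ k.val) b) f)
      rwa [Prod.mk_add_mk, add_zero, ← hleib] at h2
    · change (tensorId Ψ.prod Y (_ * _), Y 0) ∈ Ψ.orbitSpan B f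
      have h2 := Submodule.add_mem _ (hmem (Y b) i f')
        (hsum ((𝒢.G.sigma ⊤ ^ k.val) b) (Ψ.fundamental (B.isPointDerivation i) f'))
      rwa [Prod.mk_add_mk, add_zero, ← hleib, ← map_zero Y] at h2
  exact hle hx

lemma map_mem_orbitSpan {Y : Module.End ℝ 𝒢.G.Functions} (hY : Y ∈ Der 𝒢.G) (f : M.Functions)
    {x : Ψ.prod.pt.Functions × 𝒢.G.Functions} (hx : x ∈ Ψ.orbitSpan B f) :
    (tensorId Ψ.prod Y x.1, Y x.2) ∈ Ψ.orbitSpan B f := by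
  obtain ⟨Y₀, Y₁, h0, h1, rfl⟩ := exists_add_of_mem_der hY
  rw [Ψ.tensorId_add h0.mem_der h1.mem_der]
  exact Submodule.add_mem _ (Ψ.map_mem_orbitSpan_of_isSuperderivation B h0 f hx)
    (Ψ.map_mem_orbitSpan_of_isSuperderivation B h1 f hx)

lemma prod_mem_orbitSpan (f : M.Functions) (Z : List (Der 𝒢.G)) :
    ((Z.map fun X => tensorId Ψ.prod X.1).prod (Supermanifold.pullback Ψ.act f),
      (Z.map fun X => X.1).prod 1) ∈ Ψ.orbitSpan B f := by
  induction Z with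
  | nil => exact Submodule.subset_span (Or.inl ⟨1, by
    rw [map_one (Supermanifold.pullback (prFst Ψ.prod)), _root_.one_mul]
    rfl⟩)
  | cons X Z ih =>
    rw [List.map_cons, List.map_cons, List.prod_cons, List.prod_cons]
    exact Ψ.map_mem_orbitSpan B X.2 f ih

lemma evalFst_fst_mul (g : 𝒢.G.space) (b : 𝒢.G.Functions) (F : Ψ.prod.pt.Functions) :
    Ψ.evalFst g (Supermanifold.pullback (prFst Ψ.prod) b * F) =
      𝒢.G.evalAt g b • Ψ.evalFst g F := by
  rw [map_mul, Algebra.smul_def]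
  congr 1
  rw [evalFst, pullback_pair_fst, pullback_const]

theorem invariantMap_iff_bodyInvariantMap {V : Type w} [AddCommGroup V] [Module ℝ V]
    (T : M.Functions →ₗ[ℝ] V) :
    Ψ.InvariantMap T ↔ Ψ.BodyInvariantMap T ∧
      ∀ X ∈ 𝒢.lieSuperalgebra, ∀ f : M.Functions, T (Ψ.gamma X f) = 0 := by
  constructor
  · intro h
    refine ⟨fun g f => ?_, fun X hX f => ?_⟩
    · have := congrFun (congrFun (h f) g) []
      rw [idTensor, oneTensor] at this
      simpa using this
    · have := congrFun (congrFun (h f) 𝒢.e) [⟨X, hX.1⟩]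
      rw [idTensor, oneTensor] at this
      simpa [gamma, map_one_of_mem_der hX.1] using this
  · rintro ⟨h0, h1⟩ f
    funext g Z
    obtain ⟨B⟩ := exists_cotangentFrame 𝒢.e
    -- The form `(F, c) ↦ T(F|_g) - c(g) T(f)` kills generators of the first kind by body invariance
    -- of `T`, and those of the second kind by body invariance followed by `T ∘ γ(X_i) = 0`.
    have hle : Ψ.orbitSpan B f ≤ LinearMap.ker
        (T ∘ₗ (Ψ.evalFst g).toLinearMap ∘ₗ LinearMap.fst ℝ _ _ -
          (LinearMap.toSpanSingleton ℝ V (T f)) ∘ₗ (𝒢.G.evalAt g).toLinearMap ∘ₗ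
            LinearMap.snd ℝ _ _) := by
      refine Submodule.span_le.2 ?_
      rintro x (⟨b, rfl⟩ | ⟨b, i, f', rfl⟩)
      · change T (Ψ.evalFst g (_ * _)) - 𝒢.G.evalAt g b • T f = 0
        rw [evalFst_fst_mul, map_smul, h0, sub_self]
      · change T (Ψ.evalFst g (_ * _)) - 𝒢.G.evalAt g 0 • T f = 0
        rw [evalFst_fst_mul, map_smul, h0, ← gamma_invariantDer, h1 _ (invariantDer_mem _),
          smul_zero, map_zero, zero_smul, sub_zero]
    exact sub_eq_zero.1 (hle (Ψ.prod_mem_orbitSpan B f Z))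

end SuperAction

end Supergeometry

end

theorem mainTheorem7 (𝒢 : Supergeometry.LieSupergroup.{u}) (M : Supergeometry.Supermanifold.{u})
    (Ψ : Supergeometry.SuperAction 𝒢 M) :
    (∀ f : M.Functions,
      Ψ.InvariantFunction f ↔
        Ψ.BodyInvariantFunction f ∧ ∀ X ∈ 𝒢.lieSuperalgebra, Ψ.gamma X f = 0) ∧
    (∀ (V : Type w) [AddCommGroup V] [Module ℝ V] (T : M.Functions →ₗ[ℝ] V),
      Ψ.InvariantMap T ↔
        Ψ.BodyInvariantMap T ∧ ∀ X ∈ 𝒢.lieSuperalgebra, ∀ f : M.Functions, T (Ψ.gamma X f) = 0) :=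
  ⟨Ψ.invariantFunction_iff_bodyInvariantFunction,
    fun _ _ _ T => Ψ.invariantMap_iff_bodyInvariantMap T⟩
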